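/- Let $Z_1,Z_2$ be independent standard normal random variables. An algorithm may use a function $\theta:\mathbb{R}^2\to\mathbb{R}$ only through the query $O_\theta:|z_1\rangle|z_2\rangle|y\rangle\mapsto|z_1\rangle|z_2\rangle|y+\theta(z_1,z_2)\rangle$. A second kind of query is the controlled rotation $W:|w\rangle|0\rangle\mapsto|w\rangle(\sqrt{w}\,|0\rangle+\sqrt{1-w}\,|1\rangle)$, $w\in[0,1]$. Inverse and controlled applications of $O_\theta$ and $W$ count as queries as well. Arithmetic on real-valued registers is exact and makes no queries. Grid. For $N=2^n$ and $0<u_{\min}<u_{\max}<1$ put $U^{(j)}=u_{\min}+\frac{u_{\max}-u_{\min}}{N-1}j$, $V^{(k)}=\frac{k}{N-1}$, $Z_1^{(j,k)}=\sqrt{-2\ln U^{(j)}}\sin(2\pi V^{(k)})$ and $Z_2^{(j,k)}=\sqrt{-2\ln U^{(j)}}\cos(2\pi V^{(k)})$ for $0\le j,k<N$. Algorithm 1 (for $g\circ\theta\in[0,1]$, with $t$ iterations and failure parameter $\delta$). Let $A$ be the circuit that prepares $\frac1N\sum_{j,k}|j\rangle|k\rangle|Z_1^{(j,k)}\rangle|Z_2^{(j,k)}\rangle|\theta\rangle|g(\theta)\rangle\big(\sqrt{g(\theta)}\,|0\rangle+\sqrt{1-g(\theta)}\,|1\rangle\big)$,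 where $\theta=\theta(Z_1^{(j,k)},Z_2^{(j,k)})$, by Hadamard gates, arithmetic, one application of $O_\theta$ and one of $W$. Perform amplitude estimation for the probability of the flag value $|0\rangle$, with $t$ Grover iterations: phase estimation on an auxiliary register $\{0,\dots,t\}$, with outcome $x$ turned into $\sin^2(\pi x/(t+1))$. Output the median of $\lceil R\log(1/\delta)\rceil$ independent runs. Algorithm 2 (for $f\circ\theta\ge0$, with parameters $B,\epsilon,\delta$). Put $\tilde\epsilon=\frac{\epsilon}{3(B+1)^2}$, $k=\lceil\log_2(1/\tilde\epsilon)\rceil$ and $t_0=\lceil\tilde D\sqrt{\log_2(1/\tilde\epsilon)}/\tilde\epsilon\rceil$, and let $N$ be the least power of two that is at least $\lceil D\sqrt{k+1}/\epsilon^{3/2}\rceil$. Write $f_{x,y}$ for the function equal to $f$ where $x\le f<y$ and to $0$ elsewhere. With this one grid and $t=t_0$, use Algorithm 1 to obtain estimates $\hat\mu_0$ for $f_{0,1}\circ\theta$, with failure parameter $\delta/2$, and $\hat\mu_l$ for $(f_{2^{l-1},2^l}/2^l)\circ\theta$, with failure parameter $\delta/(2k)$, $1\le l\le k$. Output $\hat\mu_0+\sum_{l=1}^k2^l\hat\mu_l$.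 Algorithm 3 (with parameters $\sigma,\epsilon$). Put $\theta'=\theta/\sigma$. On the grid that Algorithm 2 uses for accuracy $\epsilon/(8\sigma)$ and $B=1$, prepare the uniform superposition, evaluate $\theta'$ with one query, and measure its value $\hat\mu'$. Let $\tilde\theta=\theta'-\hat\mu'$, $\tilde\theta^-=\min(\tilde\theta,0)$ and $\tilde\theta^+=\max(\tilde\theta,0)$. Apply Algorithm 2 with $B=1$, accuracy $\epsilon/(8\sigma)$ and $\delta=1/9$ to $-\tilde\theta^- /4$ and to $\tilde\theta^+/4$, with outputs $\hat\mu^-$ and $\hat\mu^+$. Output $\hat\mu=\sigma(\hat\mu'-4\hat\mu^-+4\hat\mu^+)$. Theorem. There are universal constants $\tilde D,R,C_t>0$ and $c_t\in\mathbb{N}$, and for all $D_1,D_2\in\mathbb{R}$ there are $D,C_N>0$ and $c_N\in\mathbb{N}$ depending only on $D_1,D_2$, such that the following holds for all $\sigma$ and $\epsilon$ with $0<\epsilon<4\sigma$. There are truncation points $0<u_{\min}<u_{\max}<1$ (depending only on $D_1,D_2,\sigma,\epsilon$) such that, for Algorithm 3 with these parameters, $$N\le C_N\Big(\frac{\epsilon}{\sigma}\Big)^{-3/2}\log^{c_N}\Big(2+\frac\sigma\epsilon\Big),\qquad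 t_0\le C_t\Big(\frac{\epsilon}{\sigma}\Big)^{-1}\log^{c_t}\Big(2+\frac\sigma\epsilon\Big).$$ Moreover, let $\theta:\mathbb{R}^2\to\mathbb{R}$ be any function whose first and second partial derivatives exist everywhere, with $$\Big|\frac{\partial\theta}{\partial z_1}\Big|+\Big|\frac{\partial\theta}{\partial z_2}\Big|\le D_1\sigma,\qquad\Big|\frac{\partial^2\theta}{\partial z_1^2}\Big|+\Big|\frac{\partial^2\theta}{\partial z_1\partial z_2}\Big|+\Big|\frac{\partial^2\theta}{\partial z_2^2}\Big|\le D_2\sigma,$$ and with $\mathrm{Var}[\theta(Z_1,Z_2)]\le\sigma^2$. Then the output $\hat\mu$ of Algorithm 3 satisfies $|\mathbb{E}[\theta(Z_1,Z_2)]-\hat\mu|\le\epsilon$ with probability at least $2/3$, and in every run the total number of queries is at most $C_t(\epsilon/\sigma)^{-1}\log^{c_t}(2+\sigma/\epsilon)$. In short, $N\in\tilde O((\epsilon/\sigma)^{-3/2})$ and $t\in\tilde O((\epsilon/\sigma)^{-1})$. -/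

import Mathlib

open scoped ENNReal
open MeasureTheory ProbabilityTheory

noncomputable section

namespace QBM

/-! ## Unitary circuits on a set of computational basis states -/

/-- The squared norm of the vector `∑ b, ψ b |b⟩`. -/
def normSq {B : Type} (ψ : B → ℂ) : ℝ≥0∞ := ∑' b, ‖ψ b‖ₑ ^ 2

/-- A unitary circuit on the registers with basis states `B`: an invertible linear map which
preserves the norm, together with the number of queries which the circuit makes. The only circuits
that are ever declared to contain a query are `oracle` and `rotation` below; composition,
inversion and control count the queries of their parts. -/
structure Circuit (B : Type) where
  op : (B → ℂ) ≃ₗ[ℂ] (B → ℂ)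
  isometry : ∀ ψ, normSq (op ψ) = normSq ψ
  queries : ℕ

namespace Circuit

variable {B : Type}

/-- First `C₁`, then `C₂`. -/
def andThen (C₁ C₂ : Circuit B) : Circuit B where
  op := C₁.op.trans C₂.op
  isometry ψ := by
    rw [LinearEquiv.trans_apply, C₂.isometry, C₁.isometry]
  queries := C₁.queries + C₂.queries

/-- The inverse (adjoint) circuit; it makes as many queries as the circuit itself. -/
def inverse (C : Circuit B) : Circuit B where
  op := C.op.symm
  isometry ψ := by
    rw [← C.isometry (C.op.symm ψ), LinearEquiv.apply_symm_apply]
  queries := C.queries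

/-- The empty circuit. -/
def skip : Circuit B where
  op := LinearEquiv.refl ℂ _
  isometry _ := rfl
  queries := 0

/-- Reversible classical arithmetic `|b⟩ ↦ |e b⟩`. -/
def classical (e : B ≃ B) : Circuit B where
  op := LinearEquiv.funCongrLeft ℂ ℂ e.symm
  isometry ψ := e.symm.tsum_eq (fun b => ‖ψ b‖ₑ ^ 2)
  queries := 0

theorem normSq_unitary {ι : Type} [Fintype ι] [DecidableEq ι] (M : Matrix.unitaryGroup ι ℂ)
    (v : ι → ℂ) : ∑ i, ‖((M : Matrix ι ι ℂ).mulVec v) i‖ₑ ^ 2 = ∑ i, ‖v i‖ₑ ^ 2 := by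
  have key : ∀ w : ι → ℂ, ∑ i, ‖w i‖ₑ ^ 2 = ENNReal.ofReal (dotProduct (star w) w).re := by
    intro w
    have h : (dotProduct (star w) w).re = ∑ i, ‖w i‖ ^ 2 := by
      simp only [dotProduct, Complex.re_sum]
      refine Finset.sum_congr rfl fun i _ => ?_
      simp only [Pi.star_apply, RCLike.star_def, Complex.conj_mul']
      norm_cast
    rw [h, ENNReal.ofReal_sum_of_nonneg (fun i _ => by positivity)]
    refine Finset.sum_congr rfl fun i _ => ?_
    rw [ENNReal.ofReal_pow (norm_nonneg _), ofReal_norm]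
  rw [key, key, Matrix.star_mulVec, Matrix.dotProduct_mulVec, Matrix.vecMul_vecMul]
  have h := (Matrix.mem_unitaryGroup_iff' (A := (M : Matrix ι ι ℂ))).1 M.2
  rw [Matrix.star_eq_conjTranspose] at h
  rw [h, Matrix.vecMul_one]

/-- A unitary on one finite register `ι`, which may be controlled by the content `r` of the
other registers: `|r⟩|i⟩ ↦ |r⟩ M(r)|i⟩`. -/
def multiplexed {ρ ι : Type} [Fintype ι] [DecidableEq ι] (e : B ≃ ρ × ι)
    (M : ρ → Matrix.unitaryGroup ι ℂ) : Circuit B where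
  op :=
    { toFun := fun ψ b =>
        ((M (e b).1 : Matrix ι ι ℂ).mulVec fun i => ψ (e.symm ((e b).1, i))) (e b).2
      map_add' := fun ψ φ => by
        funext b
        exact congrFun (Matrix.mulVec_add _ (fun i => ψ (e.symm ((e b).1, i)))
          (fun i => φ (e.symm ((e b).1, i)))) _
      map_smul' := fun c ψ => by
        funext b
        exact congrFun (Matrix.mulVec_smul _ c (fun i => ψ (e.symm ((e b).1, i)))) _
      invFun := fun ψ b =>
        ((star (M (e b).1 : Matrix ι ι ℂ)).mulVec fun i => ψ (e.symm ((e b).1, i))) (e b).2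
      left_inv := fun ψ => by
        funext b
        have h := (Matrix.mem_unitaryGroup_iff' (A := (M (e b).1 : Matrix ι ι ℂ))).1 (M (e b).1).2
        simp only [Equiv.apply_symm_apply]
        change ((star (M (e b).1 : Matrix ι ι ℂ)).mulVec
          ((M (e b).1 : Matrix ι ι ℂ).mulVec fun i => ψ (e.symm ((e b).1, i)))) (e b).2 = ψ b
        rw [Matrix.mulVec_mulVec, h, Matrix.one_mulVec]
        simp
      right_inv := fun ψ => by
        funext b
        have h := (Matrix.mem_unitaryGroup_iff (A := (M (e b).1 : Matrix ι ι ℂ))).1 (M (e b).1).2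
        simp only [Equiv.apply_symm_apply]
        change ((M (e b).1 : Matrix ι ι ℂ).mulVec
          ((star (M (e b).1 : Matrix ι ι ℂ)).mulVec fun i => ψ (e.symm ((e b).1, i)))) (e b).2
            = ψ b
        rw [Matrix.mulVec_mulVec, h, Matrix.one_mulVec]
        simp }
  isometry ψ := by
    have split : ∀ φ : B → ℂ, normSq φ = ∑' r, ∑ i, ‖φ (e.symm (r, i))‖ₑ ^ 2 := by
      intro φ
      rw [normSq, ← e.symm.tsum_eq (fun b => ‖φ b‖ₑ ^ 2), ENNReal.tsum_prod']
      simp only [tsum_fintype]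
    rw [split, split]
    refine tsum_congr fun r => ?_
    rw [← normSq_unitary (M r) (fun i => ψ (e.symm (r, i)))]
    simp
  queries := 0

open Classical in
/-- The phase gate that changes the sign of the basis states in `S`. -/
def signFlip (S : Set B) : Circuit B where
  op :=
    { toFun := fun ψ b => if b ∈ S then -ψ b else ψ b
      map_add' := fun ψ φ => by
        funext b
        by_cases h : b ∈ S <;> simp [h, add_comm]
      map_smul' := fun c ψ => by
        funext b
        by_cases h : b ∈ S <;> simp [h]
      invFun := fun ψ b => if b ∈ S then -ψ b else ψ b
      left_inv := fun ψ => by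
        funext b
        by_cases h : b ∈ S <;> simp [h]
      right_inv := fun ψ => by
        funext b
        by_cases h : b ∈ S <;> simp [h] }
  isometry ψ := by
    refine tsum_congr fun b => ?_
    by_cases h : b ∈ S <;> simp [h]
  queries := 0

open Classical in
/-- `|x⟩|b⟩ ↦ |x⟩ C|b⟩` if `x` satisfies `P`, and `|x⟩|b⟩ ↦ |x⟩|b⟩` otherwise. -/
def controlled {X : Type} (P : X → Prop) (C : Circuit B) : Circuit (X × B) where
  op :=
    { toFun := fun ψ q => if P q.1 then C.op (fun b => ψ (q.1, b)) q.2 else ψ q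
      map_add' := fun ψ φ => by
        funext q
        by_cases h : P q.1
        · have := congrFun (C.op.map_add (fun b => ψ (q.1, b)) (fun b => φ (q.1, b))) q.2
          simp only [Pi.add_apply, if_pos h]
          exact this
        · simp [h]
      map_smul' := fun c ψ => by
        funext q
        by_cases h : P q.1
        · have := congrFun (C.op.map_smul c (fun b => ψ (q.1, b))) q.2
          simp only [Pi.smul_apply, if_pos h, RingHom.id_apply]
          exact this
        · simp [h]
      invFun := fun ψ q => if P q.1 then C.op.symm (fun b => ψ (q.1, b)) q.2 else ψ q
      left_inv := fun ψ => by
        funext q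
        by_cases h : P q.1 <;> simp [h]
      right_inv := fun ψ => by
        funext q
        by_cases h : P q.1 <;> simp [h] }
  isometry ψ := by
    simp only [normSq, ENNReal.tsum_prod']
    refine tsum_congr fun x => ?_
    by_cases h : P x
    · simpa [normSq, h] using C.isometry (fun b => ψ (x, b))
    · simp [h]
  queries := C.queries

open Classical in
theorem normSq_basis (b₀ : B) : normSq (Pi.single b₀ (1 : ℂ)) = 1 := by
  unfold normSq
  rw [tsum_eq_single b₀]
  · simp
  · intro b hb
    simp [hb]

open Classical in
/-- The distribution of the outcome when `C` is applied to the basis state `b₀` and all registers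
are measured in the computational basis. -/
def measured (C : Circuit B) (b₀ : B) : PMF B :=
  ⟨fun b => ‖C.op (Pi.single b₀ (1 : ℂ)) b‖ₑ ^ 2, by
    have h : normSq (C.op (Pi.single b₀ (1 : ℂ))) = 1 := by
      rw [C.isometry, normSq_basis]
    rw [← h]
    exact ENNReal.summable.hasSum⟩

end Circuit

/-! ## Quantum algorithms with classical control -/

/-- The joint law of the output of an algorithm and of the number of queries it has made. -/
abbrev Alg (α : Type) : Type := PMF (α × ℕ)

namespace Alg

/-- Return `a` without any query. -/
def ret {α : Type} (a : α) : Alg α := PMF.pure (a, 0)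

/-- Run `p`, and then `f` on the output of `p`; the queries are added up. -/
def andThen {α β : Type} (p : Alg α) (f : α → Alg β) : Alg β :=
  PMF.bind p fun x => PMF.map (fun y : β × ℕ => (y.1, x.2 + y.2)) (f x.1)

/-- Run the circuit `C` on `b₀`, measure, and post-process the outcome by `f`. -/
def ofCircuit {B α : Type} (C : Circuit B) (b₀ : B) (f : B → α) : Alg α :=
  PMF.map (fun b => (f b, C.queries)) (C.measured b₀)

/-- The list of the outputs of `r` independent runs of `p`. -/
def repeated {α : Type} (p : Alg α) : ℕ → Alg (List α)
  | 0 => ret []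
  | r + 1 => p.andThen fun a => (repeated p r).andThen fun l => ret (a :: l)

end Alg

/-- The (upper) median of a nonempty list. -/
def median (l : List ℝ) : ℝ := (l.insertionSort (· ≤ ·)).getD (l.length / 2) 0

/-! ## The registers and gates of the quantum Box-Muller method -/

/-- Basis states of `n` qubits. -/
abbrev Qubits (n : ℕ) : Type := Fin n → Fin 2

/-- The integer in `{0, …, 2 ^ n - 1}` with the given binary digits. -/
def Qubits.toNat {n : ℕ} (x : Qubits n) : ℕ := (finFunctionFinEquiv x : Fin (2 ^ n))

/-- The basis states `|j⟩|k⟩|z₁⟩|z₂⟩|y⟩|w⟩|flag⟩`: two registers of `n` qubits for the grid, two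
registers for the normal variables, one for the value of the function, one for the number derived
from it which governs the rotation, and the rotated qubit. The registers `z₁, z₂, y, w` hold real
numbers exactly. -/
@[ext] structure Reg (n : ℕ) where
  j : Qubits n
  k : Qubits n
  z₁ : ℝ
  z₂ : ℝ
  y : ℝ
  w : ℝ
  flag : Fin 2

/-- The initial basis state. -/
def Reg.zero (n : ℕ) : Reg n := ⟨0, 0, 0, 0, 0, 0, 0⟩

/-- Separates the registers `j, k` from the others. -/
def Reg.splitGrid (n : ℕ) : Reg n ≃ (ℝ × ℝ × ℝ × ℝ × Fin 2) × (Qubits n × Qubits n) where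
  toFun s := ((s.z₁, s.z₂, s.y, s.w, s.flag), (s.j, s.k))
  invFun p := ⟨p.2.1, p.2.2, p.1.1, p.1.2.1, p.1.2.2.1, p.1.2.2.2.1, p.1.2.2.2.2⟩
  left_inv _ := rfl
  right_inv _ := rfl

/-- Separates the rotated qubit from the other registers. -/
def Reg.splitFlag (n : ℕ) : Reg n ≃ (Qubits n × Qubits n × ℝ × ℝ × ℝ × ℝ) × Fin 2 where
  toFun s := ((s.j, s.k, s.z₁, s.z₂, s.y, s.w), s.flag)
  invFun p := ⟨p.1.1, p.1.2.1, p.1.2.2.1, p.1.2.2.2.1, p.1.2.2.2.2.1, p.1.2.2.2.2.2, p.2⟩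
  left_inv _ := rfl
  right_inv _ := rfl

/-- One Hadamard gate. -/
def hadamardEntry (a b : Fin 2) : ℂ := (if a = 1 ∧ b = 1 then -1 else 1) / (Real.sqrt 2 : ℂ)

theorem hadamardEntry_orthonormal (a b : Fin 2) :
    ∑ c, hadamardEntry a c * star (hadamardEntry b c) = if a = b then 1 else 0 := by
  have h : (Real.sqrt 2 : ℂ) * (Real.sqrt 2 : ℂ) = 2 := by
    rw [← Complex.ofReal_mul, Real.mul_self_sqrt (by norm_num)]
    norm_num
  have h0 : (Real.sqrt 2 : ℂ) ≠ 0 := by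
    intro h1
    rw [h1] at h
    norm_num at h
  fin_cases a <;> fin_cases b <;> simp [hadamardEntry, Fin.sum_univ_two] <;>
    field_simp <;> rw [sq, h] <;> norm_num

/-- The Hadamard gate on each of `n` qubits. -/
def hadamard (n : ℕ) : Matrix.unitaryGroup (Qubits n) ℂ :=
  ⟨Matrix.of fun x y => ∏ i, hadamardEntry (x i) (y i), by
    rw [Matrix.mem_unitaryGroup_iff]
    ext x y
    rw [Matrix.mul_apply]
    simp only [Matrix.star_apply, Matrix.of_apply, star_prod, ← Finset.prod_mul_distrib]
    rw [← Fintype.prod_sum (fun i c => hadamardEntry (x i) c * star (hadamardEntry (y i) c))]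
    simp only [hadamardEntry_orthonormal]
    rw [Matrix.one_apply]
    by_cases h : x = y
    · simp [h]
    · obtain ⟨i, hi⟩ := Function.ne_iff.1 h
      rw [if_neg h]
      exact Finset.prod_eq_zero (Finset.mem_univ i) (by simp [hi])⟩

/-- Hadamard gates on the two grid registers. -/
def hadamards (n : ℕ) : Circuit (Reg n) :=
  Circuit.multiplexed (Reg.splitGrid n) fun _ =>
    ⟨Matrix.kronecker (hadamard n : Matrix (Qubits n) (Qubits n) ℂ) (hadamard n),
      Matrix.kronecker_mem_unitary (hadamard n).2 (hadamard n).2⟩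

/-- `U^(j) = u_min + (u_max - u_min) j / (N - 1)` with `N = 2 ^ n`. -/
def gridU (n : ℕ) (umin umax : ℝ) (j : ℕ) : ℝ := umin + (umax - umin) / ((2 : ℝ) ^ n - 1) * j

/-- `V^(k) = k / (N - 1)` with `N = 2 ^ n`. -/
def gridV (n : ℕ) (k : ℕ) : ℝ := k / ((2 : ℝ) ^ n - 1)

/-- `Z₁ = √(-2 ln U) sin (2πV)`. -/
def boxMuller₁ (u v : ℝ) : ℝ := Real.sqrt (-2 * Real.log u) * Real.sin (2 * Real.pi * v)

/-- `Z₂ = √(-2 ln U) cos (2πV)`. -/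
def boxMuller₂ (u v : ℝ) : ℝ := Real.sqrt (-2 * Real.log u) * Real.cos (2 * Real.pi * v)

/-- `|j⟩|k⟩|z₁⟩|z₂⟩ ↦ |j⟩|k⟩|z₁ + Z₁^(j,k)⟩|z₂ + Z₂^(j,k)⟩`. -/
def boxMullerGate (n : ℕ) (umin umax : ℝ) : Circuit (Reg n) :=
  Circuit.classical
    { toFun := fun s => { s with
        z₁ := s.z₁ + boxMuller₁ (gridU n umin umax s.j.toNat) (gridV n s.k.toNat)
        z₂ := s.z₂ + boxMuller₂ (gridU n umin umax s.j.toNat) (gridV n s.k.toNat) }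
      invFun := fun s => { s with
        z₁ := s.z₁ - boxMuller₁ (gridU n umin umax s.j.toNat) (gridV n s.k.toNat)
        z₂ := s.z₂ - boxMuller₂ (gridU n umin umax s.j.toNat) (gridV n s.k.toNat) }
      left_inv := fun s => by simp
      right_inv := fun s => by simp }

/-- The query `O_θ : |z₁⟩|z₂⟩|y⟩ ↦ |z₁⟩|z₂⟩|y + θ(z₁, z₂)⟩`. -/
def oracle (n : ℕ) (θ : ℝ → ℝ → ℝ) : Circuit (Reg n) :=
  { Circuit.classical
      { toFun := fun s => { s with y := s.y + θ s.z₁ s.z₂ }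
        invFun := fun s => { s with y := s.y - θ s.z₁ s.z₂ }
        left_inv := fun s => by simp
        right_inv := fun s => by simp } with queries := 1 }

/-- Arithmetic on the value of the function: `|y⟩|w⟩ ↦ |y⟩|w + g(y)⟩`. -/
def arithmetic (n : ℕ) (g : ℝ → ℝ) : Circuit (Reg n) :=
  Circuit.classical
    { toFun := fun s => { s with w := s.w + g s.y }
      invFun := fun s => { s with w := s.w - g s.y }
      left_inv := fun s => by simp
      right_inv := fun s => by simp }

/-- The rotation `|0⟩ ↦ √p |0⟩ + √(1 - p) |1⟩`, `|1⟩ ↦ -√(1 - p) |0⟩ + √p |1⟩`. -/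
def rotationMatrix (p : ℝ) (hp : p ∈ Set.Icc (0 : ℝ) 1) : Matrix.unitaryGroup (Fin 2) ℂ :=
  ⟨!![(Real.sqrt p : ℂ), -(Real.sqrt (1 - p) : ℂ); (Real.sqrt (1 - p) : ℂ), (Real.sqrt p : ℂ)], by
    have h1 : (Real.sqrt p : ℂ) * (Real.sqrt p : ℂ) = p := by
      rw [← Complex.ofReal_mul, Real.mul_self_sqrt hp.1]
    have h2 : (Real.sqrt (1 - p) : ℂ) * (Real.sqrt (1 - p) : ℂ) = 1 - p := by
      rw [← Complex.ofReal_mul, Real.mul_self_sqrt (by linarith [hp.2])]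
      push_cast
      ring
    rw [Matrix.mem_unitaryGroup_iff]
    ext a b
    fin_cases a <;> fin_cases b <;>
      simp [Matrix.mul_apply, Fin.sum_univ_two, Matrix.star_apply, h1, h2] <;> ring⟩

/-- The query `W : |w⟩|0⟩ ↦ |w⟩(√w |0⟩ + √(1 - w) |1⟩)` for `w ∈ [0,1]`. It is extended to a
unitary on all basis states; a `w` outside `[0,1]` is replaced by the nearest point of `[0,1]`. -/
def rotation (n : ℕ) : Circuit (Reg n) :=
  { Circuit.multiplexed (Reg.splitFlag n) (fun r =>
      rotationMatrix (Set.projIcc (0 : ℝ) 1 zero_le_one r.2.2.2.2.2)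
        (Set.projIcc (0 : ℝ) 1 zero_le_one r.2.2.2.2.2).2) with queries := 1 }

/-- Prepares `(1/N) ∑_{j,k} |j⟩|k⟩|Z₁⟩|Z₂⟩|θ(Z₁,Z₂)⟩|g(θ(Z₁,Z₂))⟩|0⟩`. -/
def valueCircuit (n : ℕ) (umin umax : ℝ) (θ : ℝ → ℝ → ℝ) (g : ℝ → ℝ) : Circuit (Reg n) :=
  (((hadamards n).andThen (boxMullerGate n umin umax)).andThen (oracle n θ)).andThen
    (arithmetic n g)

/-- Prepares `(1/N) ∑_{j,k} |j⟩|k⟩|Z₁⟩|Z₂⟩|θ⟩|g(θ)⟩(√g(θ) |0⟩ + √(1 - g(θ)) |1⟩)`. -/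
def amplitudeCircuit (n : ℕ) (umin umax : ℝ) (θ : ℝ → ℝ → ℝ) (g : ℝ → ℝ) : Circuit (Reg n) :=
  (valueCircuit n umin umax θ g).andThen (rotation n)

/-! ## Quantum amplitude estimation -/

/-- The quantum Fourier transform on `ℤ/M`, with entries `exp (2πi x y / M) / √M`. -/
def qft (M : ℕ) : Matrix.unitaryGroup (Fin M) ℂ :=
  ⟨Matrix.of fun x y =>
      Complex.exp (2 * Real.pi * Complex.I * ((x : ℕ) * (y : ℕ) / M)) / (Real.sqrt M : ℂ), by
    rw [Matrix.mem_unitaryGroup_iff]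
    ext x y
    have hM : 0 < M := x.pos
    have hMC : (M : ℂ) ≠ 0 := by exact_mod_cast hM.ne'
    have hs : (Real.sqrt M : ℂ) * (Real.sqrt M : ℂ) = M := by
      rw [← Complex.ofReal_mul, Real.mul_self_sqrt (by positivity)]
      simp
    rw [Matrix.mul_apply]
    set ζ : ℂ := Complex.exp (2 * Real.pi * Complex.I * (((x : ℕ) - (y : ℕ)) / M)) with hζ
    have term : ∀ z : Fin M,
        (Matrix.of fun x y : Fin M =>
          Complex.exp (2 * Real.pi * Complex.I * ((x : ℕ) * (y : ℕ) / M)) / (Real.sqrt M : ℂ)) x z *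
        (star (Matrix.of fun x y : Fin M =>
          Complex.exp (2 * Real.pi * Complex.I * ((x : ℕ) * (y : ℕ) / M)) /
            (Real.sqrt M : ℂ))) z y
        = ζ ^ (z : ℕ) / M := by
      intro z
      simp only [Matrix.star_apply, Matrix.of_apply, RCLike.star_def, map_div₀, ← Complex.exp_conj,
        Complex.conj_ofReal]
      rw [div_mul_div_comm, hs, ← Complex.exp_add, hζ, ← Complex.exp_nat_mul]
      congr 2
      simp only [map_mul, map_div₀, Complex.conj_ofReal, Complex.conj_I, map_ofNat, map_natCast]
      field_simp
      ring
    rw [Finset.sum_congr rfl fun z _ => term z, ← Finset.sum_div,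
      Fin.sum_univ_eq_sum_range (fun i => ζ ^ i) M, Matrix.one_apply]
    by_cases h : x = y
    · rw [if_pos h]
      have : ζ = 1 := by simp [hζ, h]
      simp [this, hMC]
    · rw [if_neg h]
      have hpow : ζ ^ M = 1 := by
        rw [hζ, ← Complex.exp_nat_mul]
        have : (M : ℂ) * (2 * Real.pi * Complex.I * (((x : ℕ) - (y : ℕ)) / M))
            = ((((x : ℕ) : ℤ) - ((y : ℕ) : ℤ) : ℤ) : ℂ) * (2 * Real.pi * Complex.I) := by
          push_cast
          field_simp
        rw [this, Complex.exp_int_mul_two_pi_mul_I]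
      have hne : ζ ≠ 1 := by
        intro h1
        rw [hζ, Complex.exp_eq_one_iff] at h1
        obtain ⟨m, hm⟩ := h1
        have hpi : (2 * Real.pi * Complex.I : ℂ) ≠ 0 := by
          simp [Real.pi_ne_zero]
        have h2 : (((x : ℕ) : ℂ) - ((y : ℕ) : ℂ)) / M = m := by
          apply mul_left_cancel₀ hpi
          rw [hm]
          ring
        rw [div_eq_iff hMC] at h2
        have h3 : ((x : ℕ) : ℤ) - ((y : ℕ) : ℤ) = m * M := by exact_mod_cast h2
        have hx := x.isLt
        have hy := y.isLt
        have hdvd : (M : ℤ) ∣ ((x : ℕ) : ℤ) - ((y : ℕ) : ℤ) := ⟨m, by rw [h3]; ring⟩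
        have h4 := Int.eq_zero_of_abs_lt_dvd hdvd (by rw [abs_lt]; constructor <;> omega)
        exact h (Fin.ext (by omega))
      have hg := mul_neg_geom_sum ζ M
      rw [hpow, sub_self] at hg
      have : ∑ i ∈ Finset.range M, ζ ^ i = 0 :=
        (mul_eq_zero.1 hg).resolve_left (sub_ne_zero.2 (Ne.symm hne))
      simp [this]⟩

/-- The Grover iterate `A (2|0⟩⟨0| - 1) A⁻¹ (1 - 2 P)`, with `P` the projection onto the states in
which the flag qubit is `|0⟩`. -/
def grover {n : ℕ} (A : Circuit (Reg n)) : Circuit (Reg n) :=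
  (((Circuit.signFlip {s : Reg n | s.flag = 0}).andThen A.inverse).andThen
    (Circuit.signFlip {s : Reg n | s ≠ Reg.zero n})).andThen A

/-- `|x⟩|s⟩ ↦ |x⟩ Q^(min x t)|s⟩` as a sequence of `t` controlled applications of `Q`. -/
def controlledPowers {M : ℕ} {B : Type} (Q : Circuit B) : ℕ → Circuit (Fin M × B)
  | 0 => Circuit.skip
  | c + 1 => (controlledPowers Q c).andThen
      (Circuit.controlled (fun x : Fin M => c < (x : ℕ)) Q)

/-- Amplitude estimation by phase estimation with `t` Grover iterations: the auxiliary register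
runs through `{0, …, t}`. -/
def amplitudeEstimationCircuit {n : ℕ} (A : Circuit (Reg n)) (t : ℕ) :
    Circuit (Fin (t + 1) × Reg n) :=
  let F : Circuit (Fin (t + 1) × Reg n) :=
    Circuit.multiplexed (Equiv.prodComm _ _) fun _ => qft (t + 1)
  (((Circuit.controlled (fun _ => True) A).andThen F).andThen
    (controlledPowers (grover A) t)).andThen F.inverse

/-- Measure the auxiliary register of amplitude estimation and output `sin² (π x / (t + 1))`, an
estimate of the probability that the flag qubit of `A|0⟩` is measured as `0`. -/
def amplitudeEstimation {n : ℕ} (A : Circuit (Reg n)) (t : ℕ) : Alg ℝ :=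
  Alg.ofCircuit (amplitudeEstimationCircuit A t) (0, Reg.zero n) fun q =>
    Real.sin (Real.pi * (q.1 : ℕ) / (t + 1 : ℝ)) ^ 2

/-! ## The three algorithms

Every algorithm has access to `θ` through the gate `oracle` only. A function of the form `g ∘ θ`
with an explicit `g` is evaluated by a call of the oracle followed by arithmetic. -/

/-- First algorithm: estimate `E[g(θ(Z₁,Z₂))]` for `g ∘ θ` with values in `[0,1]`, as the median of
`⌈R log (1/δ)⌉` runs of amplitude estimation with `t` iterations each. -/
def algorithm₁ (R : ℝ) (n : ℕ) (umin umax : ℝ) (t : ℕ) (δ : ℝ) (θ : ℝ → ℝ → ℝ) (g : ℝ → ℝ) :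
    Alg ℝ :=
  (Alg.repeated (amplitudeEstimation (amplitudeCircuit n umin umax θ g) t)
    ⌈R * Real.log (1 / δ)⌉₊).andThen fun l => Alg.ret (median l)

/-- `f_S` is equal to `f` where `f ∈ S`, and to `0` elsewhere. -/
def cut (S : Set ℝ) (f : ℝ → ℝ) : ℝ → ℝ := fun y => S.indicator id (f y)

/-- The level functions `f_{0,1}` (for `l = 0`) and `f_{2^(l-1),2^l} / 2^l` (for `l ≥ 1`). -/
def level (f : ℝ → ℝ) : ℕ → ℝ → ℝ
  | 0 => cut (Set.Ico 0 1) f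
  | l + 1 => fun y => cut (Set.Ico (2 ^ l) (2 ^ (l + 1))) f y / 2 ^ (l + 1)

/-- `ε̃ = ε / (3 (B + 1)²)`. -/
def epsTilde (B ε : ℝ) : ℝ := ε / (3 * (B + 1) ^ 2)

/-- `k = ⌈log₂ (1/ε̃)⌉`. -/
def numLevels (B ε : ℝ) : ℕ := ⌈Real.logb 2 (1 / epsTilde B ε)⌉₊

/-- `t₀ = ⌈D̃ √(log₂ (1/ε̃)) / ε̃⌉`. -/
def numIterations (Dt B ε : ℝ) : ℕ :=
  ⌈Dt * Real.sqrt (Real.logb 2 (1 / epsTilde B ε)) / epsTilde B ε⌉₊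

/-- The number of qubits `n = ⌈log₂ N₀⌉` with `N₀ = ⌈D √(k + 1) / ε^(3/2)⌉`. -/
def numQubits (D B ε : ℝ) : ℕ :=
  Nat.clog 2 ⌈D * Real.sqrt (numLevels B ε + 1) / ε ^ (3 / 2 : ℝ)⌉₊

/-- `est 0 + ∑_{l=1}^k 2^l est l`, where the estimates `est l` are run one after the other. -/
def sumLevels (est : ℕ → Alg ℝ) : ℕ → Alg ℝ
  | 0 => est 0
  | k + 1 => (sumLevels est k).andThen fun s =>
      (est (k + 1)).andThen fun m => Alg.ret (s + 2 ^ (k + 1) * m)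

/-- Second algorithm: estimate `E[f(θ(Z₁,Z₂))]` for `f ∘ θ ≥ 0` with `E[f(θ)²] ≤ B²`. All levels
use the same grid. -/
def algorithm₂ (Dt R D : ℝ) (umin umax B ε δ : ℝ) (θ : ℝ → ℝ → ℝ) (f : ℝ → ℝ) : Alg ℝ :=
  sumLevels (fun l => algorithm₁ R (numQubits D B ε) umin umax (numIterations Dt B ε)
    (if l = 0 then δ / 2 else δ / (2 * numLevels B ε)) θ (level f l)) (numLevels B ε)

/-- Evaluate `g ∘ θ` once, on the uniform superposition of the grid, and measure the value. -/
def sampleValue (n : ℕ) (umin umax : ℝ) (θ : ℝ → ℝ → ℝ) (g : ℝ → ℝ) : Alg ℝ :=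
  Alg.ofCircuit (valueCircuit n umin umax θ g) (Reg.zero n) Reg.w

/-- Third algorithm: put `θ' = θ/σ`, obtain one output `m` of `θ'`, let `θ̃ = θ' - m`, apply the
second algorithm with `B = 1`, accuracy `ε/(8σ)` and failure probability `1/9` to `-θ̃⁻/4` and to
`θ̃⁺/4`, and output `σ (m - 4 μ⁻ + 4 μ⁺)`. -/
def algorithm₃ (Dt R D : ℝ) (umin umax σ ε : ℝ) (θ : ℝ → ℝ → ℝ) : Alg ℝ :=
  (sampleValue (numQubits D 1 (ε / (8 * σ))) umin umax θ (fun y => y / σ)).andThen fun m =>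
    (algorithm₂ Dt R D umin umax 1 (ε / (8 * σ)) (1 / 9) θ
      (fun y => -cut (Set.Iio 0) (fun x => x / σ - m) y / 4)).andThen fun a =>
    (algorithm₂ Dt R D umin umax 1 (ε / (8 * σ)) (1 / 9) θ
      (fun y => cut (Set.Ici 0) (fun x => x / σ - m) y / 4)).andThen fun b =>
    Alg.ret (σ * (m - 4 * a + 4 * b))

/-! ## Assumptions on the function -/

/-- `∂f/∂z₁`. -/
def partial₁ (f : ℝ → ℝ → ℝ) (x y : ℝ) : ℝ := deriv (fun s => f s y) x

/-- `∂f/∂z₂`. -/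
def partial₂ (f : ℝ → ℝ → ℝ) (x y : ℝ) : ℝ := deriv (fun s => f x s) y

/-- The partial derivatives of `θ` of order one and two exist everywhere, and
`|∂θ/∂z₁| + |∂θ/∂z₂| ≤ D₁` and `|∂²θ/∂z₁²| + |∂²θ/∂z₁∂z₂| + |∂²θ/∂z₂²| ≤ D₂`. -/
structure BoundedDerivatives (θ : ℝ → ℝ → ℝ) (D₁ D₂ : ℝ) : Prop where
  diff₁ : ∀ y, Differentiable ℝ fun x => θ x y
  diff₂ : ∀ x, Differentiable ℝ fun y => θ x y
  diff₁₁ : ∀ y, Differentiable ℝ fun x => partial₁ θ x y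
  diff₁₂ : ∀ y, Differentiable ℝ fun x => partial₂ θ x y
  diff₂₂ : ∀ x, Differentiable ℝ fun y => partial₂ θ x y
  bound₁ : ∀ x y, |partial₁ θ x y| + |partial₂ θ x y| ≤ D₁
  bound₂ : ∀ x y, |partial₁ (partial₁ θ) x y| + |partial₁ (partial₂ θ) x y|
    + |partial₂ (partial₂ θ) x y| ≤ D₂

/-- The law of `(Z₁, Z₂)`: two independent standard normal variables. -/
def normalPair : Measure (ℝ × ℝ) := (gaussianReal 0 1).prod (gaussianReal 0 1)

end QBM

end

namespace QBM

/-! ## Expectations and query counts -/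

/-! The error splits into a bias, the difference between the normal mean and the mean over the `N ×
N` grid, and a statistical part, the distance of the output from the grid mean. Each is at most `ε /
2`. Write `e = ε / (8σ)`.

Bias. With `umin = 1 / (2N)` and `umax = 1 - 1 / (2N)` the points `U^(j)` are the midpoints of the
`N` cells of `[0, 1]`, and `V^(k)` lies in the closed `k`-th cell. So the grid mean is the integral
of a step function over the unit square (`gridMean_midpoint`), and by `map_boxMuller` the normal
mean is an integral over the same square. Since `θ / σ` is Lipschitz, their difference is controlled
by the mean rounding error of the radius `√(-2 ln u)` and an angular error of order `N^(1/4) / N`.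
The radius blows up at `0` but is decreasing, so its rounding error telescopes to an integral over
`[0, 2 / N]` (`integral_abs_sub_cellMid_le`), which is of order `N^(-3/4)`. As `N` is at least a
large multiple of `e^(-3/2)`, the bias of `θ / σ` is below `4e`; the same argument for the squares
bounds the second moment on the grid about the true mean by `3` (`gridMean_estimates`).

Amplitude estimation. The Grover iterate rotates the plane spanned by the two flag components of
`A|0⟩`, with `sin² τ` equal to the grid mean `a` (`groverState_eq`). The law of the outcome is an
average of two phase estimation kernels (`outcome_probability`), and the two integers around `(t +
1) τ / π` alone carry probability `17/25`. The resulting error is `2π √a / (t + 1) + π² / (t + 1)²`,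
and the median of logarithmically many runs makes failure as rare as desired (`prob_median_le`).

Levels. The factor `√a` makes the dyadic decomposition work: level `l` has weight `2^l`, and
Cauchy–Schwarz bounds `∑ 2^l √a_l` by the root of the number of levels times the second moment
(`sum_estimationError_le`). Values above the top level cost little, again by the second moment.

Centering. By Chebyshev one measured value `m` of `θ / σ` is within `6` of the mean, so the positive
and negative parts of `θ / σ - m`, divided by `4`, have bounded second moments and Algorithm 2
applies to both (`prob_algorithm₃_le`). The queries are the product of the number of levels, the
number of repetitions and `4t + 2`, twice, plus one. -/

theorem tsum_pure_mul {α : Type} (a : α) (h : α → ℝ≥0∞) : ∑' y, (PMF.pure a) y * h y = h a := by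
  rw [tsum_eq_single a]
  · simp
  · intro b hb
    simp [PMF.pure_apply, hb]

theorem tsum_bind_mul {α β : Type} (p : PMF α) (q : α → PMF β) (h : β → ℝ≥0∞) :
    ∑' y, (p.bind q) y * h y = ∑' a, p a * ∑' y, q a y * h y := by
  simp only [PMF.bind_apply, ← ENNReal.tsum_mul_right, ← ENNReal.tsum_mul_left]
  rw [ENNReal.tsum_comm]
  simp only [mul_assoc]

theorem tsum_map_mul {α β : Type} (p : PMF α) (f : α → β) (h : β → ℝ≥0∞) :
    ∑' y, (p.map f) y * h y = ∑' a, p a * h (f a) := by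
  rw [PMF.map, tsum_bind_mul]
  simp only [Function.comp, tsum_pure_mul]

namespace Alg

/-- The expectation of a nonnegative function of the output. -/
noncomputable def expect {α : Type} (p : Alg α) (f : α → ℝ≥0∞) : ℝ≥0∞ := ∑' x, p x * f x.1

/-- Every run makes at most `c` queries. -/
def QueriesLE {α : Type} (p : Alg α) (c : ℕ) : Prop := ∀ x ∈ p.support, x.2 ≤ c

variable {α β : Type}

theorem expect_ret (a : α) (f : α → ℝ≥0∞) : (ret a).expect f = f a := by
  rw [expect, ret, tsum_pure_mul (a, 0) (fun x : α × ℕ => f x.1)]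

theorem expect_andThen (p : Alg α) (q : α → Alg β) (f : β → ℝ≥0∞) :
    (p.andThen q).expect f = p.expect fun a => (q a).expect f := by
  unfold expect andThen
  rw [tsum_bind_mul p _ (fun x : β × ℕ => f x.1)]
  refine tsum_congr fun a => ?_
  rw [tsum_map_mul (q a.1) _ (fun x : β × ℕ => f x.1)]

theorem expect_ofCircuit {B : Type} (C : Circuit B) (b₀ : B) (g : B → α) (f : α → ℝ≥0∞) :
    (ofCircuit C b₀ g).expect f = ∑' b, C.measured b₀ b * f (g b) := by
  unfold expect ofCircuit
  rw [tsum_map_mul _ _ (fun x : α × ℕ => f x.1)]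

theorem expect_mono (p : Alg α) {f g : α → ℝ≥0∞} (h : ∀ a, f a ≤ g a) :
    p.expect f ≤ p.expect g :=
  ENNReal.tsum_le_tsum fun x => mul_le_mul_right (h x.1) _

theorem expect_add (p : Alg α) (f g : α → ℝ≥0∞) :
    p.expect (fun a => f a + g a) = p.expect f + p.expect g := by
  simp only [expect, mul_add, ENNReal.tsum_add]

theorem expect_const (p : Alg α) (c : ℝ≥0∞) : p.expect (fun _ => c) = c := by
  rw [expect, ENNReal.tsum_mul_right, p.tsum_coe, one_mul]

theorem expect_mul_const (p : Alg α) (f : α → ℝ≥0∞) (c : ℝ≥0∞) :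
    p.expect (fun a => f a * c) = p.expect f * c := by
  simp only [expect, ← mul_assoc, ENNReal.tsum_mul_right]

theorem expect_const_mul (p : Alg α) (f : α → ℝ≥0∞) (c : ℝ≥0∞) :
    p.expect (fun a => c * f a) = c * p.expect f := by
  simp only [mul_comm c, expect_mul_const]

open Classical in
/-- The probability that the output satisfies `P`. -/
noncomputable def prob (p : Alg α) (P : α → Prop) : ℝ≥0∞ :=
  p.expect fun a => if P a then 1 else 0

theorem prob_mono (p : Alg α) {P Q : α → Prop} (h : ∀ a, P a → Q a) : p.prob P ≤ p.prob Q := by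
  refine expect_mono _ fun a => ?_
  by_cases hP : P a
  · simp [hP, h a hP]
  · simp [hP]

theorem prob_add_prob_not (p : Alg α) (P : α → Prop) :
    p.prob P + p.prob (fun a => ¬ P a) = 1 := by
  rw [prob, prob, ← expect_add]
  refine Eq.trans ?_ (p.expect_const 1)
  congr 1
  funext a
  by_cases hP : P a <;> simp [hP]

theorem prob_le_one (p : Alg α) (P : α → Prop) : p.prob P ≤ 1 :=
  le_self_add.trans (prob_add_prob_not p P).le

theorem prob_eq_toOuterMeasure (p : Alg α) (P : α → Prop) :
    p.toOuterMeasure {x : α × ℕ | P x.1} = p.prob P := by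
  rw [PMF.toOuterMeasure_apply, prob, expect]
  refine tsum_congr fun x => ?_
  by_cases hP : P x.1 <;> simp [Set.indicator, hP]

theorem prob_ret_of_not {a : α} {P : α → Prop} (h : ¬ P a) : (ret a).prob P = 0 := by
  rw [prob, expect_ret, if_neg h]

/-- A union bound: the second stage has to succeed only if the first one did. -/
theorem prob_andThen_le (p : Alg α) (q : α → Alg β) (P : α → Prop) (Q : β → Prop) {c : ℝ≥0∞}
    (h : ∀ a, ¬ P a → (q a).prob Q ≤ c) : (p.andThen q).prob Q ≤ p.prob P + c := by
  rw [prob, expect_andThen, prob, ← p.expect_const c, ← expect_add]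
  refine expect_mono _ fun a => ?_
  by_cases hP : P a
  · simp only [hP, if_true]
    exact (prob_le_one (q a) Q).trans le_self_add
  · rw [if_neg hP, zero_add]
    exact h a hP

/-- Independence of the runs in the form needed for exponential moments: the expectation of a
product of functions of the single runs factorises. -/
theorem expect_repeated (p : Alg α) (f : α → ℝ≥0∞) (r : ℕ) :
    (repeated p r).expect (fun l => (l.map f).prod) = p.expect f ^ r := by
  induction r with
  | zero => simp [repeated, expect_ret]
  | succ r ih =>
    simp only [repeated, expect_andThen, expect_ret, List.map_cons, List.prod_cons,
      expect_const_mul, ih, expect_mul_const, pow_succ']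

theorem QueriesLE.mono {p : Alg α} {c d : ℕ} (h : p.QueriesLE c) (hcd : c ≤ d) :
    p.QueriesLE d :=
  fun x hx => (h x hx).trans hcd

theorem queriesLE_ret (a : α) : (ret a).QueriesLE 0 := by
  intro x hx
  simp only [ret, PMF.support_pure, Set.mem_singleton_iff] at hx
  simp [hx]

theorem QueriesLE.andThen {p : Alg α} {q : α → Alg β} {c d : ℕ} (hp : p.QueriesLE c)
    (hq : ∀ a, (q a).QueriesLE d) : (p.andThen q).QueriesLE (c + d) := by
  intro x hx
  simp only [Alg.andThen, PMF.support_bind, PMF.support_map, Set.mem_iUnion,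
    Set.mem_image] at hx
  obtain ⟨a, ha, y, hy, rfl⟩ := hx
  exact add_le_add (hp a ha) (hq a.1 y hy)

theorem queriesLE_ofCircuit {B : Type} (C : Circuit B) (b₀ : B) (g : B → α) :
    (ofCircuit C b₀ g).QueriesLE C.queries := by
  intro x hx
  simp only [ofCircuit, PMF.support_map, Set.mem_image] at hx
  obtain ⟨b, -, rfl⟩ := hx
  exact le_rfl

theorem QueriesLE.repeated {p : Alg α} {c : ℕ} (hp : p.QueriesLE c) (r : ℕ) :
    (repeated p r).QueriesLE (r * c) := by
  induction r with
  | zero => exact (queriesLE_ret _).mono (by simp)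
  | succ r ih =>
    exact (hp.andThen fun a => ih.andThen fun l => queriesLE_ret (a :: l)).mono
      (by rw [add_zero, Nat.succ_mul, add_comm])

/-- Every output of `repeated p r` has length `r`, expressed through expectations. -/
theorem expect_repeated_length (p : Alg α) (r : ℕ) (f : List α → ℝ≥0∞) :
    (repeated p r).expect f = (repeated p r).expect fun l => if l.length = r then f l else 0 := by
  induction r generalizing f with
  | zero => simp [repeated, expect_ret]
  | succ r ih =>
    simp only [repeated, expect_andThen, expect_ret, List.length_cons, Nat.add_right_cancel_iff]
    congr 1
    funext a
    rw [ih]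

end Alg

/-! ## The median -/

open Classical in
-- The values that do not satisfy `P` are order-convex by `hP`. If the median satisfies `P`, they
-- cannot occur both at or below and at or above it in the sorted list, so on one side, the median
-- included, every entry satisfies `P`; either side holds at least half of the list.
theorem length_le_two_mul_countP_of_median {l : List ℝ} (hl : l ≠ []) {P : ℝ → Prop}
    (hP : ∀ x y z, ¬ P x → ¬ P z → x ≤ y → y ≤ z → ¬ P y) (h : P (median l)) :
    l.length ≤ 2 * l.countP (fun x => decide (P x)) := by
  set s := l.insertionSort (· ≤ ·) with hs
  have hperm : s.Perm l := List.perm_insertionSort _ _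
  have hsorted : s.Pairwise (· ≤ ·) := List.pairwise_insertionSort _ _
  have hlen : s.length = l.length := hperm.length_eq
  rw [← hperm.countP_eq, ← hlen]
  have hpos : 0 < s.length := by rw [hlen]; exact List.length_pos_iff.2 hl
  set m := s.length / 2 with hm
  have hmlt : m < s.length := Nat.div_lt_self hpos one_lt_two
  have hmed : P s[m] := by
    have : median l = s[m] := by
      rw [median, ← hs, ← hlen, ← hm, List.getD_eq_getElem _ _ hmlt]
    rwa [← this]
  have mono : ∀ i j (hi : i < s.length) (hj : j < s.length), i ≤ j → s[i] ≤ s[j] := by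
    intro i j hi hj hij
    rcases hij.eq_or_lt with rfl | hij
    · exact le_rfl
    · exact List.pairwise_iff_getElem.1 hsorted i j hi hj hij
  by_cases hlow : ∃ i, ∃ hi : i < s.length, i ≤ m ∧ ¬ P s[i]
  · obtain ⟨i, hi, him, hPi⟩ := hlow
    have hhigh : ∀ x ∈ s.drop m, decide (P x) = true := by
      intro x hx
      obtain ⟨j, hj, rfl⟩ := List.getElem_of_mem hx
      rw [List.getElem_drop]
      simp only [decide_eq_true_eq]
      by_contra hPj
      exact hP _ _ _ hPi hPj (mono i m _ _ him) (mono m (m + j) _ _ (by omega)) hmed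
    have h1 : (s.drop m).countP (fun x => decide (P x)) = (s.drop m).length :=
      List.countP_eq_length.2 hhigh
    have h2 := (List.drop_sublist m s).countP_le (p := fun x => decide (P x))
    rw [h1, List.length_drop] at h2
    omega
  · push Not at hlow
    have hall : ∀ x ∈ s.take (m + 1), decide (P x) = true := by
      intro x hx
      obtain ⟨j, hj, rfl⟩ := List.getElem_of_mem hx
      rw [List.getElem_take]
      simp only [List.length_take] at hj
      simpa using hlow j (by omega) (by omega)
    have h1 : (s.take (m + 1)).countP (fun x => decide (P x)) = (s.take (m + 1)).length :=
      List.countP_eq_length.2 hall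
    have h2 := (List.take_sublist (m + 1) s).countP_le (p := fun x => decide (P x))
    rw [h1, List.length_take] at h2
    omega

open Classical in
theorem prod_map_ite_eq_pow_countP {α : Type} (P : α → Prop) (c : ℝ≥0∞) (l : List α) :
    (l.map fun a => if P a then c else 1).prod = c ^ l.countP (fun x => decide (P x)) := by
  induction l with
  | nil => simp
  | cons a l ih =>
    by_cases h : P a <;> simp [h, ih, pow_succ']

/-- If a single run fails with probability at most `8/25`, the median of `⌈50 log (1/δ)⌉` runs
fails with probability at most `δ`. -/
theorem prob_median_le (p : Alg ℝ) {P : ℝ → Prop}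
    (hP : ∀ x y z, ¬ P x → ¬ P z → x ≤ y → y ≤ z → ¬ P y) (hp : p.prob P ≤ 8 / 25) {δ : ℝ}
    (hδ0 : 0 < δ) (hδ1 : δ < 1) :
    ((Alg.repeated p ⌈50 * Real.log (1 / δ)⌉₊).andThen fun l => Alg.ret (median l)).prob P
      ≤ ENNReal.ofReal δ := by
  classical
  set r := ⌈50 * Real.log (1 / δ)⌉₊ with hr
  have hlog : 0 < Real.log (1 / δ) := Real.log_pos (by rw [lt_div_iff₀ hδ0]; linarith)
  have hr0 : r ≠ 0 := by
    rw [hr]; exact (Nat.ceil_pos.2 (by positivity)).ne'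
  -- The weight `4` per failure gives `1 + 3 * (8 / 25) = 49 / 25`, which is below `2`, the weight
  -- per run forced by a bad median.
  have hE : p.expect (fun a => if P a then 4 else 1) ≤ 49 / 25 := by
    have : (fun a => if P a then (4 : ℝ≥0∞) else 1) = fun a => 1 + 3 * (if P a then 1 else 0) := by
      funext a
      by_cases h : P a <;> simp [h]
      norm_num
    rw [this, Alg.expect_add, Alg.expect_const, Alg.expect_const_mul]
    calc 1 + 3 * p.expect (fun a => if P a then 1 else 0) ≤ 1 + 3 * (8 / 25 : ℝ≥0∞) := by
          gcongr
          exact hp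
      _ = 49 / 25 := by
          rw [← ENNReal.toReal_eq_toReal_iff' (by finiteness) (by finiteness)]
          rw [ENNReal.toReal_add (by finiteness) (by finiteness)]
          simp only [ENNReal.toReal_mul, ENNReal.toReal_div, ENNReal.toReal_ofNat,
            ENNReal.toReal_one]
          norm_num
  -- Markov's inequality: a bad median means at least `r / 2` failures, hence a product of weights
  -- at least `4 ^ (r / 2) = 2 ^ r`.
  have key : 2 ^ r * ((Alg.repeated p r).andThen fun l => Alg.ret (median l)).prob P
      ≤ (49 / 25) ^ r := by
    calc 2 ^ r * ((Alg.repeated p r).andThen fun l => Alg.ret (median l)).prob P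
        = (Alg.repeated p r).expect fun l => 2 ^ r * (if P (median l) then 1 else 0) := by
          rw [Alg.prob, Alg.expect_andThen, Alg.expect_const_mul]
          simp only [Alg.expect_ret]
      _ ≤ (Alg.repeated p r).expect fun l => (l.map fun a => if P a then 4 else 1).prod := by
          rw [Alg.expect_repeated_length]
          refine Alg.expect_mono _ fun l => ?_
          split_ifs with hl h
          · rw [prod_map_ite_eq_pow_countP, mul_one]
            have hne : l ≠ [] := by
              rintro rfl
              exact hr0 hl.symm
            have h2 := length_le_two_mul_countP_of_median hne hP h
            rw [hl] at h2
            calc (2 : ℝ≥0∞) ^ r ≤ 2 ^ (2 * l.countP (fun x => decide (P x))) :=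
                  pow_le_pow_right₀ (by norm_num) h2
              _ = 4 ^ l.countP (fun x => decide (P x)) := by
                  rw [pow_mul]; norm_num
          · simp
          · simp
      _ = (p.expect fun a => if P a then 4 else 1) ^ r := Alg.expect_repeated _ _ _
      _ ≤ (49 / 25) ^ r := by gcongr
  -- The ratio `49 / 50` is at most `exp (-1 / 50)`; this is where the factor `50` in the number of
  -- runs comes from.
  have hreal : (49 / 50 : ℝ) ^ r ≤ δ := by
    have h1 : (49 / 50 : ℝ) ≤ Real.exp (-(1 / 50)) := by
      have := Real.add_one_le_exp (-(1 / 50) : ℝ)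
      linarith
    calc (49 / 50 : ℝ) ^ r ≤ Real.exp (-(1 / 50)) ^ r := by gcongr
      _ = Real.exp (-(r / 50)) := by rw [← Real.exp_nat_mul]; congr 1; ring
      _ ≤ Real.exp (-Real.log (1 / δ)) := by
          have := Nat.le_ceil (50 * Real.log (1 / δ))
          rw [← hr] at this
          exact Real.exp_le_exp.2 (by linarith)
      _ = δ := by rw [one_div, Real.log_inv, neg_neg, Real.exp_log hδ0]
  have h2 : (49 / 25 : ℝ≥0∞) ^ r = 2 ^ r * ENNReal.ofReal ((49 / 50) ^ r) := by
    rw [ENNReal.ofReal_pow (by norm_num), ← mul_pow]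
    congr 1
    rw [← ENNReal.toReal_eq_toReal_iff' (by finiteness) (by finiteness)]
    simp only [ENNReal.toReal_mul, ENNReal.toReal_div, ENNReal.toReal_ofNat]
    rw [ENNReal.toReal_ofReal (by norm_num)]
    norm_num
  rw [h2] at key
  have h3 := (ENNReal.mul_le_mul_iff_right (a := (2 : ℝ≥0∞) ^ r) (by positivity)
    (by finiteness)).1 key
  exact h3.trans (ENNReal.ofReal_le_ofReal hreal)

end QBM

namespace QBM

/-! ## The kernel of phase estimation -/

/-- `∑_{x < M} exp (2πi x Δ)`. -/
noncomputable def phaseSum (M : ℕ) (Δ : ℝ) : ℂ :=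
  ∑ x ∈ Finset.range M, Complex.exp (Complex.I * (2 * Real.pi * Δ : ℝ)) ^ x

/-- Geometric series, together with `|exp (ix) - 1| = 2 |sin (x / 2)|`. The product form stays valid
where the denominator `sin (πΔ)` vanishes. -/
theorem norm_phaseSum_mul (M : ℕ) (Δ : ℝ) :
    ‖phaseSum M Δ‖ * |Real.sin (Real.pi * Δ)| = |Real.sin (Real.pi * (M * Δ))| := by
  have h := geom_sum_mul (Complex.exp (Complex.I * (2 * Real.pi * Δ : ℝ))) M
  have h1 : Complex.exp (Complex.I * (2 * Real.pi * Δ : ℝ)) ^ M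
      = Complex.exp (Complex.I * (2 * Real.pi * (M * Δ) : ℝ)) := by
    rw [← Complex.exp_nat_mul]
    congr 1
    push_cast
    ring
  have h2 := congrArg norm h
  rw [h1, norm_mul, Complex.norm_exp_I_mul_ofReal_sub_one,
    Complex.norm_exp_I_mul_ofReal_sub_one] at h2
  have e1 : 2 * Real.pi * Δ / 2 = Real.pi * Δ := by ring
  have e2 : 2 * Real.pi * (M * Δ) / 2 = Real.pi * (M * Δ) := by ring
  rw [e1, e2, norm_mul, norm_mul, Real.norm_eq_abs, Real.norm_eq_abs, Real.norm_eq_abs,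
    abs_two] at h2
  rw [phaseSum]
  linarith

/-- The normalised kernel is `|sin (πs)| / (M |sin (πs / M)|)`, and replacing the sine in the
denominator by its argument removes the dependence on `M`. -/
theorem abs_sinc_le_norm_phaseSum {M : ℕ} (hM : 0 < M) (s : ℝ) :
    |Real.sinc (Real.pi * s)| ≤ ‖phaseSum M (s / M)‖ / M := by
  have hM' : (0 : ℝ) < M := by exact_mod_cast hM
  rcases eq_or_ne s 0 with rfl | hs
  · simp [phaseSum, hM'.ne']
  have hπ := Real.pi_pos
  rw [Real.sinc_of_ne_zero (by positivity), abs_div, div_le_div_iff₀ (by positivity) hM']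
  have h := norm_phaseSum_mul M (s / M)
  rw [mul_div_cancel₀ s hM'.ne'] at h
  have h1 : |Real.sin (Real.pi * (s / M))| ≤ |Real.pi * (s / M)| := Real.abs_sin_le_abs
  have h2 : |Real.pi * (s / M)| * M = |Real.pi * s| := by
    rw [← abs_of_pos hM', ← abs_mul, abs_of_pos hM']
    congr 1
    field_simp
  rw [← h, ← h2, ← mul_assoc]
  gcongr

/-- A lower bound for the combined weight of the two integers adjacent to the phase. At `s = 1 / 2`
the sum is `8 / π² ≈ 0.81`, so there is room for crude estimates: up to `1 / 4` the first term alone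
suffices, and beyond it both terms share the numerator `sin (πs)`, which is estimated through the
cosine of `π (1 / 2 - s)`. -/
theorem sinc_sq_add_sinc_sq_aux {s : ℝ} (h0 : 0 ≤ s) (h1 : s ≤ 1 / 2) :
    17 / 25 ≤ Real.sinc (Real.pi * s) ^ 2 + Real.sinc (Real.pi * (1 - s)) ^ 2 := by
  have hπ0 := Real.pi_pos
  have hπ1 := Real.pi_lt_d4
  have hπ3 := Real.pi_gt_three
  rcases h0.eq_or_lt with rfl | h0
  · simp only [mul_zero, Real.sinc_zero]
    nlinarith [sq_nonneg (Real.sinc (Real.pi * (1 - 0)))]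
  rcases le_total s (1 / 4) with h4 | h4
  · have hx0 : 0 < Real.pi * s := by positivity
    have hx1 : Real.pi * s ≤ 0.7854 := by nlinarith
    have h := Real.sin_gt_sub_cube hx0
    have h2 : 0.8457 ≤ Real.sinc (Real.pi * s) := by
      rw [Real.sinc_of_ne_zero hx0.ne', le_div_iff₀ hx0]
      nlinarith [mul_pos hx0 hx0]
    nlinarith [sq_nonneg (Real.sinc (Real.pi * (1 - s)))]
  · have h1s : 0 < 1 - s := by linarith
    have hc : 1 - (Real.pi * (1 / 2 - s)) ^ 2 / 2 ≤ Real.sin (Real.pi * s) := by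
      have := Real.one_sub_sq_div_two_le_cos (x := Real.pi * (1 / 2 - s))
      have e : Real.pi * (1 / 2 - s) = Real.pi / 2 - Real.pi * s := by ring
      rw [e, Real.cos_pi_div_two_sub] at this
      rwa [e]
    have hs' : Real.sin (Real.pi * (1 - s)) = Real.sin (Real.pi * s) := by
      rw [mul_sub, mul_one, Real.sin_pi_sub]
    rw [Real.sinc_of_ne_zero (by positivity), Real.sinc_of_ne_zero (by positivity), hs']
    set c := Real.sin (Real.pi * s)
    have hq : (1 / 2 - s) ^ 2 ≤ 1 / 16 := by nlinarith
    have hπ2 : Real.pi ^ 2 ≤ 9.87 := by nlinarith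
    -- Since `4 * (s * (1 - s)) = 1 - 4 * (1 / 2 - s) ^ 2`, the quadratic bound for the cosine can
    -- be traded for a multiple of `s * (1 - s)`, which then cancels against the denominator. The
    -- factor `0.92` is admissible because `(1 / 2 - s) ^ 2 ≤ 1 / 16`.
    have hc2 : 0.92 * (4 * (s * (1 - s))) ≤ c := by
      nlinarith [sq_nonneg (1 / 2 - s)]
    have hp : 0 < s * (1 - s) := by positivity
    have hcs : 0.8464 * 16 * (s * (1 - s)) ^ 2 ≤ c ^ 2 := by
      have := pow_le_pow_left₀ (by positivity) hc2 2
      nlinarith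
    have e : (c / (Real.pi * s)) ^ 2 + (c / (Real.pi * (1 - s))) ^ 2
        = c ^ 2 * (s ^ 2 + (1 - s) ^ 2) / (Real.pi ^ 2 * (s * (1 - s)) ^ 2) := by
      field_simp
      ring
    rw [e, le_div_iff₀ (by positivity)]
    have hh : (1 : ℝ) / 2 ≤ s ^ 2 + (1 - s) ^ 2 := by nlinarith [sq_nonneg (1 / 2 - s)]
    calc 17 / 25 * (Real.pi ^ 2 * (s * (1 - s)) ^ 2)
        ≤ 17 / 25 * (9.87 * (s * (1 - s)) ^ 2) := by gcongr
      _ ≤ (0.8464 * 16 * (s * (1 - s)) ^ 2) * (1 / 2) := by nlinarith [sq_nonneg (s * (1 - s))]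
      _ ≤ c ^ 2 * (s ^ 2 + (1 - s) ^ 2) := by gcongr

theorem sinc_sq_add_sinc_sq {s : ℝ} (h0 : 0 ≤ s) (h1 : s ≤ 1) :
    17 / 25 ≤ Real.sinc (Real.pi * s) ^ 2 + Real.sinc (Real.pi * (1 - s)) ^ 2 := by
  rcases le_total s (1 / 2) with h | h
  · exact sinc_sq_add_sinc_sq_aux h0 h
  · have := sinc_sq_add_sinc_sq_aux (s := 1 - s) (by linarith) (by linarith)
    rw [sub_sub_cancel] at this
    linarith

/-- The outcomes of phase estimation on `{0, …, M - 1}` which give a good estimate of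
`sin² (πω)`. -/
def GoodOutcome (M : ℕ) (ω : ℝ) (y : ℕ) : Prop :=
  |Real.sin (Real.pi * y / M) ^ 2 - Real.sin (Real.pi * ω) ^ 2|
    ≤ 2 * Real.pi * |Real.sin (Real.pi * ω)| / M + Real.pi ^ 2 / M ^ 2

theorem sin_sq_sub_sin_sq (x y : ℝ) :
    Real.sin x ^ 2 - Real.sin y ^ 2 = Real.sin (x - y) * Real.sin (x + y) := by
  rw [Real.sin_sub, Real.sin_add]
  have hx := Real.sin_sq_add_cos_sq x
  have hy := Real.sin_sq_add_cos_sq y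
  linear_combination (Real.sin x) ^ 2 * (-hy) + (Real.sin y) ^ 2 * hx

/-- By `sin² x - sin² y = sin (x - y) sin (x + y)` the error is a product: the first factor is at
most `π / M`, and the second, with argument `d + 2πω`, is at most `π / M + 2 |sin (πω)|`. The error
is therefore small when the estimated probability is small. -/
theorem goodOutcome_of_abs_le {M : ℕ} (hM : 0 < M) {ω : ℝ} {y : ℕ} (h : |(y : ℝ) - M * ω| ≤ 1) :
    GoodOutcome M ω y := by
  have hM' : (0 : ℝ) < M := by exact_mod_cast hM
  have hπ := Real.pi_pos
  unfold GoodOutcome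
  rw [sin_sq_sub_sin_sq, abs_mul]
  set d := Real.pi * y / M - Real.pi * ω with hd
  have hdabs : |d| ≤ Real.pi / M := by
    have : d = Real.pi / M * (y - M * ω) := by rw [hd]; field_simp
    rw [this, abs_mul, abs_of_pos (by positivity)]
    exact mul_le_of_le_one_right (by positivity) h
  have e : Real.pi * y / M + Real.pi * ω = d + 2 * (Real.pi * ω) := by rw [hd]; ring
  have h1 : |Real.sin d| ≤ Real.pi / M := Real.abs_sin_le_abs.trans hdabs
  have h2 : |Real.sin (d + 2 * (Real.pi * ω))| ≤
      Real.pi / M + 2 * |Real.sin (Real.pi * ω)| := by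
    rw [Real.sin_add, Real.sin_two_mul]
    refine (abs_add_le _ _).trans (add_le_add ?_ ?_)
    · rw [abs_mul]
      exact (mul_le_of_le_one_right (abs_nonneg _) (Real.abs_cos_le_one _)).trans h1
    · rw [abs_mul, abs_mul, abs_mul, abs_two]
      have := Real.abs_cos_le_one d
      have := Real.abs_cos_le_one (Real.pi * ω)
      calc |Real.cos d| * (2 * |Real.sin (Real.pi * ω)| * |Real.cos (Real.pi * ω)|)
          ≤ 1 * (2 * |Real.sin (Real.pi * ω)| * 1) := by gcongr
        _ = _ := by ring
  rw [e]
  calc |Real.sin d| * |Real.sin (d + 2 * (Real.pi * ω))|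
      ≤ Real.pi / M * (Real.pi / M + 2 * |Real.sin (Real.pi * ω)|) := by gcongr
    _ = _ := by field_simp; ring

open Classical in
-- Only the two integers around `M * ω` are counted. With `ω ≤ 1 / 2` and `4 ≤ M` both lie in `{0,
-- …, M - 1}`, so no wrap-around modulo `M` is needed.
theorem sum_goodOutcome_phaseSum {M : ℕ} (hM : 4 ≤ M) {ω : ℝ} (h0 : 0 ≤ ω) (h1 : ω ≤ 1 / 2) :
    17 / 25 ≤ ∑ y : Fin M, if GoodOutcome M ω y then (‖phaseSum M (ω - y / M)‖ / M) ^ 2 else 0 := by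
  have hMpos : 0 < M := by omega
  have hM' : (4 : ℝ) ≤ M := by exact_mod_cast hM
  have hω : 0 ≤ M * ω := by positivity
  set m := ⌊M * ω⌋₊ with hm
  have hm1 : (m : ℝ) ≤ M * ω := Nat.floor_le hω
  have hm2 : M * ω < m + 1 := Nat.lt_floor_add_one _
  have hmM : m + 1 < M := by
    have : (m : ℝ) + 1 < M := by nlinarith
    exact_mod_cast this
  set y₀ : Fin M := ⟨m, by omega⟩
  set y₁ : Fin M := ⟨m + 1, hmM⟩
  have hne : y₀ ≠ y₁ := by simp [y₀, y₁]
  have g0 : GoodOutcome M ω (y₀ : ℕ) := goodOutcome_of_abs_le hMpos (by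
    rw [abs_le]; constructor <;> simp only [y₀] <;> linarith)
  have g1 : GoodOutcome M ω (y₁ : ℕ) := goodOutcome_of_abs_le hMpos (by
    rw [abs_le]; constructor <;> simp only [y₁] <;> push_cast <;> linarith)
  have hsum : ∑ y ∈ {y₀, y₁}, (if GoodOutcome M ω (y : Fin M) then
      (‖phaseSum M (ω - (y : ℕ) / M)‖ / M) ^ 2 else 0) ≤
      ∑ y : Fin M, if GoodOutcome M ω y then (‖phaseSum M (ω - y / M)‖ / M) ^ 2 else 0 :=
    Finset.sum_le_sum_of_subset_of_nonneg (Finset.subset_univ _)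
      (fun _ _ _ => by split_ifs <;> positivity)
  refine le_trans ?_ hsum
  rw [Finset.sum_pair hne, if_pos g0, if_pos g1]
  have hMne : (M : ℝ) ≠ 0 := by positivity
  have e0 : ω - ((y₀ : ℕ) : ℝ) / M = (M * ω - m) / M := by simp only [y₀]; field_simp
  have e1 : ω - ((y₁ : ℕ) : ℝ) / M = (-(1 - (M * ω - m))) / M := by
    simp only [y₁]; push_cast; field_simp; ring
  have k0 := abs_sinc_le_norm_phaseSum hMpos (M * ω - m)
  have k1 := abs_sinc_le_norm_phaseSum hMpos (-(1 - (M * ω - m)))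
  rw [mul_neg, Real.sinc_neg] at k1
  rw [e0, e1]
  refine (sinc_sq_add_sinc_sq (s := M * ω - m) (by linarith) (by linarith)).trans ?_
  rw [← sq_abs (Real.sinc _), ← sq_abs (Real.sinc (Real.pi * (1 - _)))]
  gcongr

theorem norm_phaseSum_neg (M : ℕ) (Δ : ℝ) : ‖phaseSum M (-Δ)‖ = ‖phaseSum M Δ‖ := by
  have : phaseSum M (-Δ) = (starRingEnd ℂ) (phaseSum M Δ) := by
    simp only [phaseSum, map_sum, map_pow, ← Complex.exp_conj, map_mul, Complex.conj_I,
      Complex.conj_ofReal]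
    refine Finset.sum_congr rfl fun x _ => ?_
    congr 2
    push_cast
    ring
  rw [this, RCLike.norm_conj]

theorem phaseSum_sub_one (M : ℕ) (Δ : ℝ) : phaseSum M (Δ - 1) = phaseSum M Δ := by
  have : Complex.exp (Complex.I * (2 * Real.pi * (Δ - 1) : ℝ))
      = Complex.exp (Complex.I * (2 * Real.pi * Δ : ℝ)) := by
    rw [Complex.exp_eq_exp_iff_exists_int]
    exact ⟨-1, by push_cast; ring⟩
  rw [phaseSum, this, phaseSum]

theorem val_neg_fin {t : ℕ} (y : Fin (t + 1)) :
    (((-y : Fin (t + 1)) : ℕ) = 0 ∧ (y : ℕ) = 0) ∨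
      (((-y : Fin (t + 1)) : ℕ) : ℝ) = (t + 1 : ℕ) - (y : ℕ) := by
  rcases Nat.eq_zero_or_pos (y : ℕ) with h | h
  · left
    refine ⟨?_, h⟩
    rw [Fin.val_neg']
    simp [h]
  · right
    have := y.isLt
    rw [Fin.val_neg', Nat.mod_eq_of_lt (by omega), Nat.cast_sub (by omega)]

/-- The reflection of the outcomes exchanges the two eigenphases `±ω`: the kernel is conjugated by a
change of sign and has period `1`. The outcome `0` is its own reflection and needs no shift by the
period. -/
theorem norm_phaseSum_fin_neg {t : ℕ} (ω : ℝ) (y : Fin (t + 1)) :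
    ‖phaseSum (t + 1) (-ω - ((-y : Fin (t + 1)) : ℕ) / (t + 1 : ℕ))‖
      = ‖phaseSum (t + 1) (ω - (y : ℕ) / (t + 1 : ℕ))‖ := by
  rcases val_neg_fin y with ⟨h, h'⟩ | h
  · rw [h, h', ← norm_phaseSum_neg]
    congr 2
    simp
  · have hM : ((t + 1 : ℕ) : ℝ) ≠ 0 := by positivity
    rw [h, ← norm_phaseSum_neg (Δ := ω - _), ← phaseSum_sub_one (Δ := -(ω - _))]
    congr 2
    field_simp
    ring

theorem goodOutcome_fin_neg {t : ℕ} (ω : ℝ) (y : Fin (t + 1)) :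
    GoodOutcome (t + 1) ω ((-y : Fin (t + 1)) : ℕ) ↔ GoodOutcome (t + 1) ω (y : ℕ) := by
  unfold GoodOutcome
  rcases val_neg_fin y with ⟨h, h'⟩ | h
  · rw [h, h']
  · have hM : ((t + 1 : ℕ) : ℝ) ≠ 0 := by positivity
    have : Real.pi * (((t + 1 : ℕ) : ℝ) - (y : ℕ)) / (t + 1 : ℕ)
        = Real.pi - Real.pi * (y : ℕ) / (t + 1 : ℕ) := by
      field_simp
    rw [h, this, Real.sin_pi_sub]

/-- The probability of a good outcome of phase estimation, for the superposition of the eigenvalues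
`exp (± 2πi ω)` which occurs in amplitude estimation. -/
theorem sum_goodOutcome_prob {t : ℕ} (ht : 3 ≤ t) {ω : ℝ} (h0 : 0 ≤ ω) (h1 : ω ≤ 1 / 2)
    (P : Fin (t + 1) → ℝ) (hP0 : ∀ y, 0 ≤ P y)
    (hP : ∀ y, P y = ((‖phaseSum (t + 1) (ω - (y : ℕ) / (t + 1 : ℕ))‖ / (t + 1 : ℕ)) ^ 2
      + (‖phaseSum (t + 1) (-ω - (y : ℕ) / (t + 1 : ℕ))‖ / (t + 1 : ℕ)) ^ 2) / 2)
    (S : Set (Fin (t + 1))) (hS : ∀ y : Fin (t + 1), GoodOutcome (t + 1) ω (y : ℕ) → y ∈ S) :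
    17 / 25 ≤ ∑ y, S.indicator P y := by
  classical
  have key := sum_goodOutcome_phaseSum (M := t + 1) (by omega) h0 h1
  -- `sin² (πy / M)` does not distinguish `y` from `-y`, so the eigenphase `-ω` gives good outcomes
  -- the same weight as `ω`.
  have key2 : ∑ y : Fin (t + 1), (if GoodOutcome (t + 1) ω (y : ℕ) then
        (‖phaseSum (t + 1) (-ω - (y : ℕ) / (t + 1 : ℕ))‖ / (t + 1 : ℕ)) ^ 2 else 0)
      = ∑ y : Fin (t + 1), if GoodOutcome (t + 1) ω (y : ℕ) then
        (‖phaseSum (t + 1) (ω - (y : ℕ) / (t + 1 : ℕ))‖ / (t + 1 : ℕ)) ^ 2 else 0 := by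
    rw [← Equiv.sum_comp (Equiv.neg (Fin (t + 1)))]
    refine Finset.sum_congr rfl fun y _ => ?_
    simp only [Equiv.neg_apply, goodOutcome_fin_neg, norm_phaseSum_fin_neg]
  have : ∑ y : Fin (t + 1), (if GoodOutcome (t + 1) ω (y : ℕ) then P y else 0)
      ≤ ∑ y, S.indicator P y := by
    refine Finset.sum_le_sum fun y _ => ?_
    split_ifs with hg
    · rw [Set.indicator_of_mem (hS y hg)]
    · exact Set.indicator_nonneg (fun y _ => hP0 y) y
  refine le_trans ?_ this
  have e : ∀ y : Fin (t + 1), (if GoodOutcome (t + 1) ω (y : ℕ) then P y else 0)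
      = ((if GoodOutcome (t + 1) ω (y : ℕ) then
        (‖phaseSum (t + 1) (ω - (y : ℕ) / (t + 1 : ℕ))‖ / (t + 1 : ℕ)) ^ 2 else 0)
      + (if GoodOutcome (t + 1) ω (y : ℕ) then
        (‖phaseSum (t + 1) (-ω - (y : ℕ) / (t + 1 : ℕ))‖ / (t + 1 : ℕ)) ^ 2 else 0)) / 2 := by
    intro y
    split_ifs
    · exact hP y
    · simp
  rw [Finset.sum_congr rfl fun y _ => e y, ← Finset.sum_div, Finset.sum_add_distrib, key2]
  linarith

end QBM

namespace QBM

/-! ## The states prepared by the circuits -/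

open Classical in
/-- The state vector of the initial basis state. -/
noncomputable def groundState (n : ℕ) : Reg n → ℂ := Pi.single (Reg.zero n) 1

theorem groundState_of_ne {n : ℕ} {b : Reg n} (h : b ≠ Reg.zero n) : groundState n b = 0 := by
  simp [groundState, h]

theorem groundState_zero (n : ℕ) : groundState n (Reg.zero n) = 1 := by
  simp [groundState]

theorem multiplexed_apply {B ρ ι : Type} [Fintype ι] [DecidableEq ι] (e : B ≃ ρ × ι)
    (M : ρ → Matrix.unitaryGroup ι ℂ) (ψ : B → ℂ) (b : B) :
    (Circuit.multiplexed e M).op ψ b =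
      ∑ i, (M (e b).1 : Matrix ι ι ℂ) (e b).2 i * ψ (e.symm ((e b).1, i)) := rfl

theorem multiplexed_symm_apply {B ρ ι : Type} [Fintype ι] [DecidableEq ι] (e : B ≃ ρ × ι)
    (M : ρ → Matrix.unitaryGroup ι ℂ) (ψ : B → ℂ) (b : B) :
    (Circuit.multiplexed e M).op.symm ψ b =
      ∑ i, star ((M (e b).1 : Matrix ι ι ℂ) i (e b).2) * ψ (e.symm ((e b).1, i)) := rfl

/-- The values of `θ` at the grid points. -/
noncomputable def gridValue (n : ℕ) (umin umax : ℝ) (θ : ℝ → ℝ → ℝ) (i : Qubits n × Qubits n) : ℝ :=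
  θ (boxMuller₁ (gridU n umin umax i.1.toNat) (gridV n i.2.toNat))
    (boxMuller₂ (gridU n umin umax i.1.toNat) (gridV n i.2.toNat))

/-- The basis states in the support of the prepared states. -/
noncomputable def gridState (n : ℕ) (umin umax : ℝ) (θ : ℝ → ℝ → ℝ) (g : ℝ → ℝ)
    (i : (Qubits n × Qubits n) × Fin 2) : Reg n where
  j := i.1.1
  k := i.1.2
  z₁ := boxMuller₁ (gridU n umin umax i.1.1.toNat) (gridV n i.1.2.toNat)
  z₂ := boxMuller₂ (gridU n umin umax i.1.1.toNat) (gridV n i.1.2.toNat)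
  y := gridValue n umin umax θ i.1
  w := g (gridValue n umin umax θ i.1)
  flag := i.2

theorem gridState_injective (n : ℕ) (umin umax : ℝ) (θ : ℝ → ℝ → ℝ) (g : ℝ → ℝ) :
    Function.Injective (gridState n umin umax θ g) := by
  intro i i' h
  have h1 : i.1.1 = i'.1.1 := congrArg Reg.j h
  have h2 : i.1.2 = i'.1.2 := congrArg Reg.k h
  have h3 : i.2 = i'.2 := congrArg Reg.flag h
  exact Prod.ext (Prod.ext h1 h2) h3

theorem hadamardEntry_zero_right (a : Fin 2) : hadamardEntry a 0 = ((Real.sqrt 2 : ℝ) : ℂ)⁻¹ := by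
  simp [hadamardEntry]

theorem hadamard_apply_zero (n : ℕ) (x : Qubits n) :
    (hadamard n : Matrix (Qubits n) (Qubits n) ℂ) x 0 = ((Real.sqrt 2 : ℝ) : ℂ)⁻¹ ^ n := by
  simp [hadamard, hadamardEntry_zero_right]

theorem sqrt_two_inv_pow_mul_self (n : ℕ) :
    ((Real.sqrt 2 : ℝ) : ℂ)⁻¹ ^ n * ((Real.sqrt 2 : ℝ) : ℂ)⁻¹ ^ n = (((1 / 2 : ℝ) ^ n : ℝ) : ℂ) := by
  rw [← mul_pow, ← Complex.ofReal_inv, ← Complex.ofReal_mul, ← Complex.ofReal_pow]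
  congr 2
  rw [← mul_inv, Real.mul_self_sqrt (by norm_num)]
  norm_num

/-- Hadamard gates on two registers, as a matrix. -/
noncomputable def hadamardPair (n : ℕ) : Matrix.unitaryGroup (Qubits n × Qubits n) ℂ :=
  ⟨Matrix.kronecker (hadamard n : Matrix (Qubits n) (Qubits n) ℂ) (hadamard n),
    Matrix.kronecker_mem_unitary (hadamard n).2 (hadamard n).2⟩

theorem hadamards_eq (n : ℕ) :
    hadamards n = Circuit.multiplexed (Reg.splitGrid n) fun _ => hadamardPair n := rfl

theorem hadamardPair_apply_zero (n : ℕ) (i : Qubits n × Qubits n) :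
    (hadamardPair n : Matrix (Qubits n × Qubits n) (Qubits n × Qubits n) ℂ) i (0, 0)
      = (((1 / 2 : ℝ) ^ n : ℝ) : ℂ) := by
  have h : (hadamardPair n : Matrix (Qubits n × Qubits n) (Qubits n × Qubits n) ℂ) i (0, 0)
      = (hadamard n : Matrix (Qubits n) (Qubits n) ℂ) i.1 0
        * (hadamard n : Matrix (Qubits n) (Qubits n) ℂ) i.2 0 := rfl
  rw [h, hadamard_apply_zero, hadamard_apply_zero, sqrt_two_inv_pow_mul_self]

theorem andThen_apply {B : Type} (C₁ C₂ : Circuit B) (ψ : B → ℂ) :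
    (C₁.andThen C₂).op ψ = C₂.op (C₁.op ψ) := rfl

theorem andThen_symm_apply {B : Type} (C₁ C₂ : Circuit B) (ψ : B → ℂ) :
    (C₁.andThen C₂).op.symm ψ = C₁.op.symm (C₂.op.symm ψ) := rfl

open Classical in
theorem hadamards_apply_zero (n : ℕ) (b : Reg n) :
    (hadamards n).op (groundState n) b =
      if b = { Reg.zero n with j := b.j, k := b.k } then (((1 / 2 : ℝ) ^ n : ℝ) : ℂ) else 0 := by
  rw [hadamards_eq, multiplexed_apply, Finset.sum_eq_single (0, 0)]
  · rw [hadamardPair_apply_zero]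
    by_cases h : b = { Reg.zero n with j := b.j, k := b.k }
    · rw [if_pos h]
      have : (Reg.splitGrid n).symm ((Reg.splitGrid n b).1, (0, 0)) = Reg.zero n := by
        rw [h]; rfl
      rw [this, groundState_zero, mul_one]
    · rw [if_neg h, groundState_of_ne, mul_zero]
      intro h'
      apply h
      simp only [Reg.splitGrid, Equiv.coe_fn_mk, Equiv.coe_fn_symm_mk, Reg.zero,
        Reg.ext_iff] at h' ⊢
      simp_all
  · intro i _ hi
    rw [groundState_of_ne, mul_zero]
    intro h
    exact hi (Prod.ext (congrArg Reg.j h) (congrArg Reg.k h))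
  · simp

/-- The reflection about `|0⟩` in the Grover iterate sees only the zero coefficient of the preimage
of a vector, so the inverse circuits are computed at this one basis state. -/
theorem hadamards_symm_apply_zero (n : ℕ) (φ : Reg n → ℂ) :
    (hadamards n).op.symm φ (Reg.zero n) =
      ∑ i : Qubits n × Qubits n,
        (((1 / 2 : ℝ) ^ n : ℝ) : ℂ) * φ { Reg.zero n with j := i.1, k := i.2 } := by
  rw [hadamards_eq, multiplexed_symm_apply]
  refine Finset.sum_congr rfl fun i _ => ?_
  rw [show (Reg.splitGrid n (Reg.zero n)).2 = (0, 0) from rfl, hadamardPair_apply_zero]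
  simp only [RCLike.star_def, Complex.conj_ofReal]
  rfl

section Circuits

variable (n : ℕ) (umin umax : ℝ) (θ : ℝ → ℝ → ℝ) (g : ℝ → ℝ)

open Classical in
theorem valueCircuit_apply_zero (b : Reg n) :
    (valueCircuit n umin umax θ g).op (groundState n) b =
      if b = gridState n umin umax θ g ((b.j, b.k), 0) then (((1 / 2 : ℝ) ^ n : ℝ) : ℂ) else 0 := by
  -- Classical gates permute the basis states, so the amplitude at `b` is that of the Hadamard state
  -- at the preimage of `b` under the three gates.
  change (hadamards n).op (groundState n)
    { b with
      z₁ := b.z₁ - boxMuller₁ (gridU n umin umax b.j.toNat) (gridV n b.k.toNat)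
      z₂ := b.z₂ - boxMuller₂ (gridU n umin umax b.j.toNat) (gridV n b.k.toNat)
      y := b.y - θ b.z₁ b.z₂
      w := b.w - g b.y } = _
  rw [hadamards_apply_zero]
  refine if_congr ?_ rfl rfl
  simp only [Reg.ext_iff, Reg.zero, gridState, gridValue, sub_eq_zero, true_and]
  constructor
  · rintro ⟨h1, h2, h3, h4, h5⟩
    refine ⟨h1, h2, ?_, ?_, h5⟩
    · rw [h3, h1, h2]
    · rw [h4, h3, h1, h2]
  · rintro ⟨h1, h2, h3, h4, h5⟩
    refine ⟨h1, h2, ?_, ?_, h5⟩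
    · rw [h3, h1, h2]
    · rw [h4, h3]

theorem valueCircuit_symm_apply_zero (φ : Reg n → ℂ) :
    (valueCircuit n umin umax θ g).op.symm φ (Reg.zero n) =
      ∑ i, (((1 / 2 : ℝ) ^ n : ℝ) : ℂ) * φ (gridState n umin umax θ g (i, 0)) := by
  change (hadamards n).op.symm (fun b => φ
    { b with
      z₁ := b.z₁ + boxMuller₁ (gridU n umin umax b.j.toNat) (gridV n b.k.toNat)
      z₂ := b.z₂ + boxMuller₂ (gridU n umin umax b.j.toNat) (gridV n b.k.toNat)
      y := b.y + θ (b.z₁ + boxMuller₁ (gridU n umin umax b.j.toNat) (gridV n b.k.toNat))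
        (b.z₂ + boxMuller₂ (gridU n umin umax b.j.toNat) (gridV n b.k.toNat))
      w := b.w + g (b.y + θ (b.z₁ + boxMuller₁ (gridU n umin umax b.j.toNat) (gridV n b.k.toNat))
        (b.z₂ + boxMuller₂ (gridU n umin umax b.j.toNat) (gridV n b.k.toNat))) })
    (Reg.zero n) = _
  rw [hadamards_symm_apply_zero]
  simp only [Reg.zero, zero_add]
  rfl

/-- The amplitudes `√p, √(1 - p)` of the rotated qubit. -/
noncomputable def flagAmplitude (w : ℝ) (f : Fin 2) : ℝ :=
  if f = 0 then Real.sqrt (Set.projIcc (0 : ℝ) 1 zero_le_one w)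
  else Real.sqrt (1 - Set.projIcc (0 : ℝ) 1 zero_le_one w)

/-- The rotation which is applied to the flag qubit when the governing register contains `w`. -/
noncomputable def flagRotation (w : ℝ) : Matrix.unitaryGroup (Fin 2) ℂ :=
  rotationMatrix (Set.projIcc (0 : ℝ) 1 zero_le_one w) (Set.projIcc (0 : ℝ) 1 zero_le_one w).2

theorem flagRotation_apply_zero (w : ℝ) (f : Fin 2) :
    (flagRotation w : Matrix (Fin 2) (Fin 2) ℂ) f 0 = flagAmplitude w f := by
  fin_cases f <;> simp [flagRotation, rotationMatrix, flagAmplitude]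

theorem multiplexed_flag_apply (M : ℝ → Matrix.unitaryGroup (Fin 2) ℂ) (ψ : Reg n → ℂ)
    (b : Reg n) :
    (Circuit.multiplexed (Reg.splitFlag n) (fun r => M r.2.2.2.2.2)).op ψ b =
      ∑ f : Fin 2, (M b.w : Matrix (Fin 2) (Fin 2) ℂ) b.flag f * ψ { b with flag := f } := rfl

theorem multiplexed_flag_symm_apply (M : ℝ → Matrix.unitaryGroup (Fin 2) ℂ) (ψ : Reg n → ℂ)
    (b : Reg n) :
    (Circuit.multiplexed (Reg.splitFlag n) (fun r => M r.2.2.2.2.2)).op.symm ψ b =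
      ∑ f : Fin 2, star ((M b.w : Matrix (Fin 2) (Fin 2) ℂ) f b.flag) * ψ { b with flag := f } :=
  rfl

/-- Only the operators agree: the two circuits differ in their declared number of queries. -/
theorem rotation_op :
    (rotation n).op =
      (Circuit.multiplexed (Reg.splitFlag n) (fun r => flagRotation r.2.2.2.2.2)).op := rfl

theorem flagAmplitude_sq_zero {w : ℝ} (hw : w ∈ Set.Icc (0 : ℝ) 1) :
    flagAmplitude w 0 ^ 2 = w := by
  rw [flagAmplitude, if_pos rfl, Set.projIcc_of_mem _ hw]
  exact Real.sq_sqrt hw.1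

theorem flagAmplitude_sq_one {w : ℝ} (hw : w ∈ Set.Icc (0 : ℝ) 1) :
    flagAmplitude w 1 ^ 2 = 1 - w := by
  rw [flagAmplitude, if_neg (by decide), Set.projIcc_of_mem _ hw]
  exact Real.sq_sqrt (by linarith [hw.2])

open Classical in
theorem amplitudeCircuit_apply_zero (b : Reg n) :
    (amplitudeCircuit n umin umax θ g).op (groundState n) b =
      if b = gridState n umin umax θ g ((b.j, b.k), b.flag) then
        (((1 / 2 : ℝ) ^ n * flagAmplitude b.w b.flag : ℝ) : ℂ) else 0 := by
  rw [amplitudeCircuit, andThen_apply, rotation_op, multiplexed_flag_apply, Finset.sum_eq_single 0]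
  · rw [flagRotation_apply_zero, valueCircuit_apply_zero]
    have : ({ b with flag := 0 } : Reg n) = gridState n umin umax θ g ((b.j, b.k), 0) ↔
        b = gridState n umin umax θ g ((b.j, b.k), b.flag) := by
      simp [Reg.ext_iff, gridState]
    simp only [this, mul_ite, mul_zero]
    split_ifs
    · push_cast; ring
    · rfl
  · intro f _ hf
    rw [valueCircuit_apply_zero, if_neg, mul_zero]
    intro h
    exact hf (congrArg Reg.flag h)
  · simp

/-- By unitarity the zero coefficient of `A⁻¹ φ` is the inner product of `A|0⟩` with `φ`; the
amplitudes of `A|0⟩` are real, so no conjugation appears. -/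
theorem amplitudeCircuit_symm_apply_zero (φ : Reg n → ℂ) :
    (amplitudeCircuit n umin umax θ g).op.symm φ (Reg.zero n) =
      ∑ i : Qubits n × Qubits n, ∑ f : Fin 2,
        (((1 / 2 : ℝ) ^ n * flagAmplitude (g (gridValue n umin umax θ i)) f : ℝ) : ℂ)
          * φ (gridState n umin umax θ g (i, f)) := by
  rw [amplitudeCircuit, andThen_symm_apply, valueCircuit_symm_apply_zero]
  refine Finset.sum_congr rfl fun i _ => ?_
  rw [rotation_op, multiplexed_flag_symm_apply, Finset.mul_sum]
  refine Finset.sum_congr rfl fun f _ => ?_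
  have h : star ((flagRotation (gridState n umin umax θ g (i, 0)).w :
        Matrix (Fin 2) (Fin 2) ℂ) f (gridState n umin umax θ g (i, 0)).flag)
      = ((flagAmplitude (g (gridValue n umin umax θ i)) f : ℝ) : ℂ) := by
    simp only [gridState]
    rw [flagRotation_apply_zero, RCLike.star_def, Complex.conj_ofReal]
  rw [h]
  simp only [gridState]
  push_cast
  ring

theorem amplitudeCircuit_gridState (i : Qubits n × Qubits n) (f : Fin 2) :
    (amplitudeCircuit n umin umax θ g).op (groundState n)
      (gridState n umin umax θ g (i, f)) =
      (((1 / 2 : ℝ) ^ n * flagAmplitude (g (gridValue n umin umax θ i)) f : ℝ) : ℂ) := by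
  rw [amplitudeCircuit_apply_zero]
  simp only [gridState, if_true]

theorem amplitudeCircuit_of_notMem {b : Reg n} (hb : b ∉ Set.range (gridState n umin umax θ g)) :
    (amplitudeCircuit n umin umax θ g).op (groundState n) b = 0 := by
  rw [amplitudeCircuit_apply_zero, if_neg]
  intro h
  exact hb ⟨_, h.symm⟩

/-- The mean of `φ` over the values of `θ` at the grid points. -/
noncomputable def gridMean (φ : ℝ → ℝ) : ℝ :=
  ∑ i : Qubits n × Qubits n, ((1 / 2 : ℝ) ^ n) ^ 2 * φ (gridValue n umin umax θ i)

end Circuits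

/-! ## The Grover iterate -/

section Grover

variable {n : ℕ} (A : Circuit (Reg n))

/-- The component of `A|0⟩` in which the flag qubit is `|0⟩`. -/
noncomputable def goodPart : Reg n → ℂ := fun b =>
  if b.flag = 0 then A.op (groundState n) b else 0

/-- The component of `A|0⟩` in which the flag qubit is `|1⟩`. -/
noncomputable def badPart : Reg n → ℂ := fun b =>
  if b.flag = 0 then 0 else A.op (groundState n) b

theorem goodPart_add_badPart :
    goodPart A + badPart A = A.op (groundState n) := by
  funext b
  by_cases h : b.flag = 0 <;> simp [goodPart, badPart, h]

/-- With `Ψ = A|0⟩`, the sum of the good and the bad part, the iterate is the sign change of the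
good part followed by `2 |Ψ⟩⟨Ψ| - 1`. Only the overlaps of `Ψ` with the two parts enter; they are
`a` and, because `A⁻¹ Ψ = |0⟩`, `1 - a`. -/
theorem grover_apply {a : ℂ} (ha : A.op.symm (goodPart A) (Reg.zero n) = a) (s c : ℂ) :
    (grover A).op (s • goodPart A + c • badPart A) =
      (s + 2 * (c * (1 - a) - s * a)) • goodPart A
        + (-c + 2 * (c * (1 - a) - s * a)) • badPart A := by
  classical
  have hb : A.op.symm (badPart A) (Reg.zero n) = 1 - a := by
    have h : badPart A = A.op (groundState n) - goodPart A := by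
      rw [← goodPart_add_badPart A, add_sub_cancel_left]
    rw [h, map_sub, LinearEquiv.symm_apply_apply, Pi.sub_apply, ha, groundState_zero]
  have h1 : (Circuit.signFlip {s : Reg n | s.flag = 0}).op (s • goodPart A + c • badPart A)
      = (-s) • goodPart A + c • badPart A := by
    funext b
    by_cases h : b.flag = 0 <;> simp [Circuit.signFlip, h, goodPart, badPart]
  have h2 : ∀ χ : Reg n → ℂ, (Circuit.signFlip {s : Reg n | s ≠ Reg.zero n}).op χ
      = -χ + (2 * χ (Reg.zero n)) • groundState n := by
    intro χ
    funext b
    by_cases h : b = Reg.zero n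
    · subst h
      simp [Circuit.signFlip, groundState_zero]
      ring
    · simp [Circuit.signFlip, h, groundState_of_ne h]
  change A.op ((Circuit.signFlip {s : Reg n | s ≠ Reg.zero n}).op
    (A.op.symm ((Circuit.signFlip {s : Reg n | s.flag = 0}).op _))) = _
  rw [h1, h2]
  simp only [map_add, map_smul, map_neg, LinearEquiv.apply_symm_apply, Pi.add_apply,
    Pi.smul_apply, ha, hb]
  funext b
  have hΨ := congrFun (goodPart_add_badPart A) b
  simp only [Pi.add_apply, Pi.neg_apply, Pi.smul_apply, smul_eq_mul] at hΨ ⊢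
  rw [← hΨ]
  ring

/-- The state after `x` Grover iterations. -/
noncomputable def groverState (x : ℕ) : Reg n → ℂ :=
  ((grover A).op)^[x] (A.op (groundState n))

/-- Each iteration rotates the plane of good and bad part by `2τ`, which is checked by the addition
formulas. The coefficients are specified only after multiplication by `sin τ` and `cos τ`, so the
degenerate cases `a = 0` and `a = 1` need no separate treatment. -/
theorem groverState_eq {τ : ℝ}
    (ha : A.op.symm (goodPart A) (Reg.zero n) = ((Real.sin τ ^ 2 : ℝ) : ℂ)) (x : ℕ) :
    ∃ s c : ℝ, groverState A x = (s : ℂ) • goodPart A + (c : ℂ) • badPart A ∧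
      s * Real.sin τ = Real.sin ((2 * x + 1) * τ) ∧
      c * Real.cos τ = Real.cos ((2 * x + 1) * τ) := by
  induction x with
  | zero =>
    refine ⟨1, 1, ?_, ?_, ?_⟩
    · simp [groverState, goodPart_add_badPart A]
    · simp
    · simp
  | succ x ih =>
    obtain ⟨s, c, h, hs, hc⟩ := ih
    have hsc := Real.sin_sq_add_cos_sq τ
    have e : (2 * ((x + 1 : ℕ) : ℝ) + 1) * τ = (2 * x + 1) * τ + 2 * τ := by push_cast; ring
    refine ⟨s + 2 * (c * (1 - Real.sin τ ^ 2) - s * Real.sin τ ^ 2),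
      -c + 2 * (c * (1 - Real.sin τ ^ 2) - s * Real.sin τ ^ 2), ?_, ?_, ?_⟩
    · rw [groverState, Function.iterate_succ_apply', ← groverState, h, grover_apply A ha]
      push_cast
      rfl
    · rw [e, Real.sin_add, ← hs, ← hc, Real.sin_two_mul, Real.cos_two_mul']
      linear_combination (-2 * c * Real.sin τ - s * Real.sin τ) * hsc
    · rw [e, Real.cos_add, ← hs, ← hc, Real.sin_two_mul, Real.cos_two_mul']
      linear_combination (-c * Real.cos τ) * hsc

end Grover

end QBM

namespace QBM

/-! ## Amplitude estimation -/

section Preparation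

variable (n : ℕ) (umin umax : ℝ) (θ : ℝ → ℝ → ℝ) (g : ℝ → ℝ)

theorem goodPart_gridState (i : Qubits n × Qubits n) (f : Fin 2) :
    goodPart (amplitudeCircuit n umin umax θ g) (gridState n umin umax θ g (i, f)) =
      if f = 0 then
        (((1 / 2 : ℝ) ^ n * flagAmplitude (g (gridValue n umin umax θ i)) 0 : ℝ) : ℂ) else 0 := by
  rw [goodPart, amplitudeCircuit_gridState]
  by_cases h : f = 0 <;> simp [h, gridState]

theorem badPart_gridState (i : Qubits n × Qubits n) (f : Fin 2) :
    badPart (amplitudeCircuit n umin umax θ g) (gridState n umin umax θ g (i, f)) =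
      if f = 0 then 0 else
        (((1 / 2 : ℝ) ^ n * flagAmplitude (g (gridValue n umin umax θ i)) f : ℝ) : ℂ) := by
  rw [badPart, amplitudeCircuit_gridState]
  by_cases h : f = 0 <;> simp [h, gridState]

/-- This identifies the probability that amplitude estimation recovers. The range condition matters
because the rotation clamps its argument to `[0, 1]`; only inside the interval is the squared flag
amplitude equal to `g`. -/
theorem amplitudeCircuit_symm_goodPart
    (hg : ∀ i, g (gridValue n umin umax θ i) ∈ Set.Icc (0 : ℝ) 1) :
    (amplitudeCircuit n umin umax θ g).op.symm (goodPart (amplitudeCircuit n umin umax θ g))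
      (Reg.zero n) = (gridMean n umin umax θ g : ℂ) := by
  rw [amplitudeCircuit_symm_apply_zero, gridMean, Complex.ofReal_sum]
  refine Finset.sum_congr rfl fun i _ => ?_
  rw [Fin.sum_univ_two, goodPart_gridState, goodPart_gridState, if_pos rfl, if_neg (by decide),
    mul_zero, add_zero, ← Complex.ofReal_mul]
  congr 1
  linear_combination ((1 / 2 : ℝ) ^ n) ^ 2 * flagAmplitude_sq_zero (hg i)

theorem card_qubits_pair : ((Fintype.card (Qubits n × Qubits n) : ℕ) : ℝ) = ((2 : ℝ) ^ n) ^ 2 := by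
  simp [sq]

theorem gridMean_const (c : ℝ) : gridMean n umin umax θ (fun _ => c) = c := by
  rw [gridMean, Finset.sum_const, Finset.card_univ, nsmul_eq_mul, card_qubits_pair, ← mul_assoc,
    ← mul_pow, ← mul_pow]
  norm_num

theorem gridMean_add (φ ψ : ℝ → ℝ) :
    gridMean n umin umax θ (fun y => φ y + ψ y) =
      gridMean n umin umax θ φ + gridMean n umin umax θ ψ := by
  simp only [gridMean, mul_add, Finset.sum_add_distrib]

theorem gridMean_const_mul (c : ℝ) (φ : ℝ → ℝ) :
    gridMean n umin umax θ (fun y => c * φ y) = c * gridMean n umin umax θ φ := by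
  simp only [gridMean, Finset.mul_sum]
  exact Finset.sum_congr rfl fun i _ => by ring

theorem gridMean_mono {φ ψ : ℝ → ℝ} (h : ∀ y, φ y ≤ ψ y) :
    gridMean n umin umax θ φ ≤ gridMean n umin umax θ ψ :=
  Finset.sum_le_sum fun i _ => mul_le_mul_of_nonneg_left (h _) (by positivity)

theorem gridMean_nonneg {φ : ℝ → ℝ} (h : ∀ y, 0 ≤ φ y) : 0 ≤ gridMean n umin umax θ φ :=
  Finset.sum_nonneg fun i _ => mul_nonneg (by positivity) (h _)

/-- Pythagoras: the two parts have disjoint supports among the finitely many grid states, and their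
squared norms are `a` and `1 - a`. -/
theorem tsum_normSq_goodPart_badPart
    (hg : ∀ i, g (gridValue n umin umax θ i) ∈ Set.Icc (0 : ℝ) 1) (s c : ℂ) :
    ∑' b, ‖s * goodPart (amplitudeCircuit n umin umax θ g) b
        + c * badPart (amplitudeCircuit n umin umax θ g) b‖ₑ ^ 2
      = ENNReal.ofReal (‖s‖ ^ 2 * gridMean n umin umax θ g
          + ‖c‖ ^ 2 * (1 - gridMean n umin umax θ g)) := by
  have hsupp : Function.support (fun b => ‖s * goodPart (amplitudeCircuit n umin umax θ g) b
        + c * badPart (amplitudeCircuit n umin umax θ g) b‖ₑ ^ 2)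
      ⊆ Set.range (gridState n umin umax θ g) := by
    intro b hb
    by_contra h
    apply hb
    simp [goodPart, badPart, amplitudeCircuit_of_notMem n umin umax θ g h]
  rw [← (gridState_injective n umin umax θ g).tsum_eq hsupp, tsum_fintype,
    Fintype.sum_prod_type]
  have term : ∀ z : ℂ, ‖z‖ₑ ^ 2 = ENNReal.ofReal (‖z‖ ^ 2) := by
    intro z
    rw [ENNReal.ofReal_pow (norm_nonneg _), ofReal_norm]
  simp only [term]
  rw [← Finset.sum_congr rfl fun i _ => ENNReal.ofReal_sum_of_nonneg (fun f _ => by positivity),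
    ← ENNReal.ofReal_sum_of_nonneg (fun i _ => Finset.sum_nonneg fun f _ => by positivity)]
  congr 1
  have h1 : 1 - gridMean n umin umax θ g = gridMean n umin umax θ (fun y => 1 - g y) := by
    have := gridMean_add n umin umax θ g (fun y => 1 - g y)
    simp only [add_sub_cancel, gridMean_const] at this
    linarith
  rw [h1, gridMean, gridMean, Finset.mul_sum, Finset.mul_sum, ← Finset.sum_add_distrib]
  refine Finset.sum_congr rfl fun i _ => ?_
  rw [Fin.sum_univ_two]
  simp only [goodPart_gridState, badPart_gridState, if_true, one_ne_zero, if_false, mul_zero,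
    add_zero, zero_add, norm_mul, Complex.norm_real, Real.norm_eq_abs, mul_pow, sq_abs]
  rw [flagAmplitude_sq_zero (hg i), flagAmplitude_sq_one (hg i)]

end Preparation

/-! ### The state before the measurement -/

theorem controlled_apply_of_pos {X B : Type} {P : X → Prop} (C : Circuit B) (ψ : X × B → ℂ)
    {x : X} (hx : P x) (b : B) :
    (Circuit.controlled P C).op ψ (x, b) = C.op (fun b => ψ (x, b)) b :=
  if_pos hx

theorem controlled_apply_of_neg {X B : Type} {P : X → Prop} (C : Circuit B) (ψ : X × B → ℂ)
    {x : X} (hx : ¬ P x) (b : B) :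
    (Circuit.controlled P C).op ψ (x, b) = ψ (x, b) :=
  if_neg hx

/-- The gate number `i` fires exactly when `i < x`, so after `c` gates a register with value `x` has
received `min x c` applications of `Q`. -/
theorem controlledPowers_apply {M : ℕ} {B : Type} (Q : Circuit B) (Φ : B → ℂ) (κ : ℂ) (c : ℕ)
    (x : Fin M) (b : B) :
    (controlledPowers Q c).op (fun q : Fin M × B => κ * Φ q.2) (x, b)
      = κ * (Q.op)^[min x c] Φ b := by
  induction c generalizing b with
  | zero => simp [controlledPowers, Circuit.skip]
  | succ c ih =>
    rw [controlledPowers, andThen_apply]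
    have h : (fun b => (controlledPowers Q c).op (fun q : Fin M × B => κ * Φ q.2) (x, b))
        = κ • (Q.op)^[min x c] Φ := by
      funext b
      rw [ih]
      rfl
    by_cases hc : c < (x : ℕ)
    · rw [controlled_apply_of_pos (P := fun x : Fin M => c < (x : ℕ)) _ _ hc, h, map_smul, Pi.smul_apply, smul_eq_mul, min_eq_right (by omega),
        min_eq_right (by omega), Function.iterate_succ_apply']
    · rw [controlled_apply_of_neg (P := fun x : Fin M => c < (x : ℕ)) _ _ hc, ih, min_eq_left (by omega), min_eq_left (by omega)]

theorem qft_apply (M : ℕ) (x y : Fin M) :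
    (qft M : Matrix (Fin M) (Fin M) ℂ) x y =
      Complex.exp (2 * Real.pi * Complex.I * ((x : ℕ) * (y : ℕ) / M)) / (Real.sqrt M : ℂ) := rfl

theorem multiplexed_aux_apply {M : ℕ} {B : Type} (U : Matrix.unitaryGroup (Fin M) ℂ)
    (ψ : Fin M × B → ℂ) (x : Fin M) (b : B) :
    (Circuit.multiplexed (Equiv.prodComm (Fin M) B) fun _ => U).op ψ (x, b) =
      ∑ i, (U : Matrix (Fin M) (Fin M) ℂ) x i * ψ (i, b) := rfl

theorem multiplexed_aux_symm_apply {M : ℕ} {B : Type} (U : Matrix.unitaryGroup (Fin M) ℂ)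
    (ψ : Fin M × B → ℂ) (x : Fin M) (b : B) :
    (Circuit.multiplexed (Equiv.prodComm (Fin M) B) fun _ => U).op.symm ψ (x, b) =
      ∑ i, star ((U : Matrix (Fin M) (Fin M) ℂ) i x) * ψ (i, b) := rfl

/-- The coefficients `exp (-2πi x y / M) / M`. -/
noncomputable def outcomeCoeff (M : ℕ) (x y : ℕ) : ℂ :=
  Complex.exp (-(2 * Real.pi * Complex.I * (x * y / M))) / M

theorem measured_apply {B : Type} [DecidableEq B] (C : Circuit B) (b₀ b : B) :
    C.measured b₀ b = ‖C.op (Pi.single b₀ (1 : ℂ)) b‖ₑ ^ 2 := by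
  have : (fun a b => Classical.propDecidable (a = b)) = (inferInstance : DecidableEq B) :=
    Subsingleton.elim _ _
  subst this
  rfl

/-- The first Fourier transform turns `|0⟩` into the uniform superposition, the controlled gates
attach the `x`-th Grover state to `|x⟩`, and the inverse transform supplies the conjugate
characters; the two factors `1 / √(t + 1)` combine. -/
theorem amplitudeEstimationCircuit_apply {n t : ℕ} [DecidableEq (Fin (t + 1) × Reg n)] (A : Circuit (Reg n)) (y : Fin (t + 1))
    (b : Reg n) :
    (amplitudeEstimationCircuit A t).op (Pi.single (0, Reg.zero n) (1 : ℂ)) (y, b) =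
      ∑ x : Fin (t + 1), outcomeCoeff (t + 1) x y * groverState A x b := by
  set F : Circuit (Fin (t + 1) × Reg n) :=
    Circuit.multiplexed (Equiv.prodComm _ _) fun _ => qft (t + 1) with hF
  have h1 : (Circuit.controlled (fun _ => True) A).op
      (Pi.single ((0 : Fin (t + 1)), Reg.zero n) (1 : ℂ))
      = fun q => if q.1 = 0 then A.op (groundState n) q.2 else 0 := by
    funext q
    rw [← Prod.mk.eta (p := q), controlled_apply_of_pos _ _ trivial]
    simp only
    by_cases hq : q.1 = 0
    · rw [if_pos hq]
      refine congrFun (congrArg A.op ?_) q.2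
      funext b
      by_cases hb : b = Reg.zero n
      · rw [hb, hq, Pi.single_eq_same, groundState_zero]
      · rw [groundState_of_ne hb, Pi.single_eq_of_ne]
        intro h
        exact hb (congrArg Prod.snd h)
    · rw [if_neg hq]
      have : (fun b => (Pi.single ((0 : Fin (t + 1)), Reg.zero n) (1 : ℂ) :
          Fin (t + 1) × Reg n → ℂ) (q.1, b)) = 0 := by
        funext b
        rw [Pi.single_eq_of_ne, Pi.zero_apply]
        intro h
        exact hq (congrArg Prod.fst h)
      rw [this, map_zero, Pi.zero_apply]
  have h2 : F.op (fun q => if q.1 = 0 then A.op (groundState n) q.2 else 0)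
      = fun q => ((Real.sqrt (t + 1 : ℕ) : ℝ) : ℂ)⁻¹ * A.op (groundState n) q.2 := by
    funext q
    obtain ⟨x, b⟩ := q
    rw [hF, multiplexed_aux_apply, Finset.sum_eq_single 0]
    · rw [qft_apply]
      simp
    · intro i _ hi
      simp [hi]
    · simp
  have hdef : (amplitudeEstimationCircuit A t).op (Pi.single (0, Reg.zero n) (1 : ℂ))
      = F.op.symm ((controlledPowers (grover A) t).op (F.op
        ((Circuit.controlled (fun _ => True) A).op
          (Pi.single ((0 : Fin (t + 1)), Reg.zero n) (1 : ℂ))))) := rfl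
  rw [hdef, h1, h2, hF, multiplexed_aux_symm_apply]
  refine Finset.sum_congr rfl fun x _ => ?_
  rw [controlledPowers_apply, min_eq_left (by omega), ← groverState, ← mul_assoc]
  congr 1
  have hs : ((Real.sqrt (t + 1 : ℕ) : ℝ) : ℂ) * (Real.sqrt (t + 1 : ℕ) : ℝ) = (t + 1 : ℕ) := by
    rw [← Complex.ofReal_mul, Real.mul_self_sqrt (by positivity)]
    simp
  rw [qft_apply, outcomeCoeff, RCLike.star_def, map_div₀, Complex.conj_ofReal, ← Complex.exp_conj,
    ← div_eq_mul_inv, div_div, hs]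
  congr 2
  simp only [map_mul, map_div₀, Complex.conj_ofReal, Complex.conj_I, map_ofNat, map_natCast]
  ring

theorem sum_outcomeCoeff_exp (M : ℕ) (y : ℕ) (τ : ℝ) :
    ‖∑ x : Fin M, outcomeCoeff M x y *
        Complex.exp (Complex.I * ((2 * ((x : ℕ) : ℝ) + 1) * τ : ℝ))‖
      = ‖phaseSum M (τ / Real.pi - y / M)‖ / M := by
  have hπ : (Real.pi : ℂ) ≠ 0 := by exact_mod_cast Real.pi_ne_zero
  have : ∑ x : Fin M, outcomeCoeff M x y *
        Complex.exp (Complex.I * ((2 * ((x : ℕ) : ℝ) + 1) * τ : ℝ))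
      = Complex.exp (Complex.I * τ) / M * phaseSum M (τ / Real.pi - y / M) := by
    rw [phaseSum, ← Fin.sum_univ_eq_sum_range
      (fun x => Complex.exp (Complex.I * (2 * Real.pi * (τ / Real.pi - y / M) : ℝ)) ^ x),
      Finset.mul_sum]
    refine Finset.sum_congr rfl fun x _ => ?_
    rw [outcomeCoeff, div_mul_eq_mul_div, div_mul_eq_mul_div, ← Complex.exp_nat_mul,
      ← Complex.exp_add, ← Complex.exp_add]
    congr 2
    push_cast
    field_simp
    ring
  rw [this, norm_mul, norm_div, mul_comm Complex.I, Complex.norm_exp_ofReal_mul_I]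
  simp
  ring

/-- If `S` and `C` denote the sine and cosine sums, the sums with `exp (±i (2x + 1) τ)` are `C ±
iS`, and the parallelogram law relates the squared norms. This takes the place of a diagonalisation
of the Grover iterate. -/
theorem outcome_probability (M : ℕ) (y : ℕ) (τ : ℝ) :
    ‖∑ x : Fin M, outcomeCoeff M x y * (Real.sin ((2 * ((x : ℕ) : ℝ) + 1) * τ) : ℝ)‖ ^ 2
      + ‖∑ x : Fin M, outcomeCoeff M x y * (Real.cos ((2 * ((x : ℕ) : ℝ) + 1) * τ) : ℝ)‖ ^ 2
      = ((‖phaseSum M (τ / Real.pi - y / M)‖ / M) ^ 2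
        + (‖phaseSum M (-(τ / Real.pi) - y / M)‖ / M) ^ 2) / 2 := by
  have h1 := sum_outcomeCoeff_exp M y τ
  have h2 := sum_outcomeCoeff_exp M y (-τ)
  rw [neg_div] at h2
  rw [← h1, ← h2]
  set S := ∑ x : Fin M, outcomeCoeff M x y * (Real.sin ((2 * ((x : ℕ) : ℝ) + 1) * τ) : ℝ) with hS
  set C := ∑ x : Fin M, outcomeCoeff M x y * (Real.cos ((2 * ((x : ℕ) : ℝ) + 1) * τ) : ℝ) with hC
  have e1 : ∑ x : Fin M, outcomeCoeff M x y *
        Complex.exp (Complex.I * ((2 * ((x : ℕ) : ℝ) + 1) * τ : ℝ)) = C + Complex.I * S := by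
    rw [hS, hC, Finset.mul_sum, ← Finset.sum_add_distrib]
    refine Finset.sum_congr rfl fun x _ => ?_
    rw [mul_comm Complex.I (((2 * ((x : ℕ) : ℝ) + 1) * τ : ℝ) : ℂ), Complex.exp_mul_I,
      ← Complex.ofReal_cos, ← Complex.ofReal_sin]
    ring
  have e2 : ∑ x : Fin M, outcomeCoeff M x y *
        Complex.exp (Complex.I * ((2 * ((x : ℕ) : ℝ) + 1) * -τ : ℝ)) = C - Complex.I * S := by
    rw [hS, hC, Finset.mul_sum, ← Finset.sum_sub_distrib]
    refine Finset.sum_congr rfl fun x _ => ?_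
    rw [mul_neg, mul_comm Complex.I, Complex.exp_mul_I,
      ← Complex.ofReal_cos, ← Complex.ofReal_sin, Real.cos_neg, Real.sin_neg]
    push_cast
    ring
  have hp := parallelogram_law_with_norm ℝ C (Complex.I * S)
  have hI : ‖Complex.I * S‖ = ‖S‖ := by simp
  rw [hI] at hp
  rw [e1, e2]
  nlinarith [hp]

/-- The accuracy of amplitude estimation. -/
noncomputable def estimationError (t : ℕ) (a : ℝ) : ℝ :=
  2 * Real.pi * Real.sqrt a / (t + 1) + Real.pi ^ 2 / (t + 1) ^ 2

theorem tsum_measured_amplitudeEstimation {n t : ℕ} (umin umax : ℝ) (θ : ℝ → ℝ → ℝ) (g : ℝ → ℝ)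
    (hg : ∀ y, g y ∈ Set.Icc (0 : ℝ) 1) {τ : ℝ}
    (hsin2 : Real.sin τ ^ 2 = gridMean n umin umax θ g) (y : Fin (t + 1)) :
    ∑' b, (Circuit.measured (amplitudeEstimationCircuit (amplitudeCircuit n umin umax θ g) t)
        (0, Reg.zero n)) (y, b)
      = ENNReal.ofReal (‖∑ x : Fin (t + 1), outcomeCoeff (t + 1) x y *
        (Real.sin ((2 * ((x : ℕ) : ℝ) + 1) * τ) : ℝ)‖ ^ 2
      + ‖∑ x : Fin (t + 1), outcomeCoeff (t + 1) x y *
        (Real.cos ((2 * ((x : ℕ) : ℝ) + 1) * τ) : ℝ)‖ ^ 2) := by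
  classical
  set A := amplitudeCircuit n umin umax θ g with hA
  have hcos2 : Real.cos τ ^ 2 = 1 - gridMean n umin umax θ g := by
    have := Real.sin_sq_add_cos_sq τ
    linarith
  have hgood : A.op.symm (goodPart A) (Reg.zero n) = ((Real.sin τ ^ 2 : ℝ) : ℂ) := by
    rw [hsin2]
    exact amplitudeCircuit_symm_goodPart n umin umax θ g fun i => hg _
  choose s c hstate hs hc using groverState_eq A hgood
  have h1 : ∀ b, (Circuit.measured (amplitudeEstimationCircuit A t) (0, Reg.zero n)) (y, b)
      = ‖(∑ x : Fin (t + 1), outcomeCoeff (t + 1) x y * (s x : ℂ)) * goodPart A b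
        + (∑ x : Fin (t + 1), outcomeCoeff (t + 1) x y * (c x : ℂ)) * badPart A b‖ₑ ^ 2 := by
    intro b
    rw [measured_apply, amplitudeEstimationCircuit_apply]
    congr 2
    rw [Finset.sum_mul, Finset.sum_mul, ← Finset.sum_add_distrib]
    refine Finset.sum_congr rfl fun x _ => ?_
    rw [hstate]
    simp only [Pi.add_apply, Pi.smul_apply, smul_eq_mul]
    ring
  -- The squared norms `sin² τ` and `cos² τ` of the two parts are absorbed into the sums; this uses
  -- the Grover coefficients only through their products with `sin τ` and `cos τ`.
  have coeff : ∀ (u v : ℝ) (f : ℕ → ℝ) (h : ℕ → ℝ), (∀ x, f x * u = h x) → u ^ 2 = v →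
      ‖∑ x : Fin (t + 1), outcomeCoeff (t + 1) x y * (f x : ℂ)‖ ^ 2 * v
        = ‖∑ x : Fin (t + 1), outcomeCoeff (t + 1) x y * (h x : ℂ)‖ ^ 2 := by
    intro u v f h hfh huv
    rw [← huv, ← sq_abs u, ← mul_pow, ← Real.norm_eq_abs, ← Complex.norm_real, ← norm_mul,
      Finset.sum_mul]
    congr 2
    refine Finset.sum_congr rfl fun x _ => ?_
    rw [mul_assoc, ← Complex.ofReal_mul, hfh]
  rw [tsum_congr h1, tsum_normSq_goodPart_badPart n umin umax θ g fun i => hg _,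
    coeff _ _ s _ hs hsin2, coeff _ _ c _ hc hcos2]

/-- The angle `τ = arcsin √a` gives a phase `τ / π` in `[0, 1 / 2]`, where the kernel estimate
applies. The failure probability is `1 - 17 / 25`. -/
theorem prob_amplitudeEstimation_le {n : ℕ} (umin umax : ℝ) (θ : ℝ → ℝ → ℝ) (g : ℝ → ℝ)
    (hg : ∀ y, g y ∈ Set.Icc (0 : ℝ) 1) {t : ℕ} (ht : 3 ≤ t) :
    (amplitudeEstimation (amplitudeCircuit n umin umax θ g) t).prob
      (fun x => ¬ |x - gridMean n umin umax θ g|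
        ≤ estimationError t (gridMean n umin umax θ g)) ≤ 8 / 25 := by
  classical
  set A := amplitudeCircuit n umin umax θ g with hA
  set a := gridMean n umin umax θ g with ha
  have ha0 : 0 ≤ a := gridMean_nonneg n umin umax θ fun y => (hg y).1
  have ha1 : a ≤ 1 := by
    rw [← gridMean_const n umin umax θ 1]
    exact gridMean_mono n umin umax θ fun y => (hg y).2
  set τ := Real.arcsin (Real.sqrt a) with hτ
  have hs0 : 0 ≤ Real.sqrt a := Real.sqrt_nonneg a
  have hs1 : Real.sqrt a ≤ 1 := Real.sqrt_le_one.2 ha1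
  have hsin : Real.sin τ = Real.sqrt a := Real.sin_arcsin (by linarith) hs1
  have hsin2 : Real.sin τ ^ 2 = a := by rw [hsin, Real.sq_sqrt ha0]
  have hπ := Real.pi_pos
  have hτ0 : 0 ≤ τ := Real.arcsin_nonneg.2 hs0
  have hτ1 : τ ≤ Real.pi / 2 := Real.arcsin_le_pi_div_two _
  have hω0 : 0 ≤ τ / Real.pi := by positivity
  have hω1 : τ / Real.pi ≤ 1 / 2 := by
    rw [div_le_iff₀ hπ]
    linarith
  set P : Fin (t + 1) → ℝ := fun y =>
    ‖∑ x : Fin (t + 1), outcomeCoeff (t + 1) x y *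
      (Real.sin ((2 * ((x : ℕ) : ℝ) + 1) * τ) : ℝ)‖ ^ 2
      + ‖∑ x : Fin (t + 1), outcomeCoeff (t + 1) x y *
        (Real.cos ((2 * ((x : ℕ) : ℝ) + 1) * τ) : ℝ)‖ ^ 2 with hP
  have hlaw : ∀ y : Fin (t + 1),
      ∑' b, (Circuit.measured (amplitudeEstimationCircuit A t) (0, Reg.zero n)) (y, b)
        = ENNReal.ofReal (P y) :=
    fun y => tsum_measured_amplitudeEstimation umin umax θ g hg hsin2 y
  set S : Set (Fin (t + 1)) := {y | |Real.sin (Real.pi * (y : ℕ) / (t + 1 : ℝ)) ^ 2 - a|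
    ≤ estimationError t a} with hS
  have hsum := sum_goodOutcome_prob ht hω0 hω1 P (fun y => by positivity)
    (fun y => outcome_probability (t + 1) y τ) S (by
      intro y hy
      have hy' : GoodOutcome (t + 1) (τ / Real.pi) (y : ℕ) := hy
      unfold GoodOutcome at hy'
      rw [mul_div_cancel₀ τ hπ.ne', hsin2, hsin, abs_of_nonneg hs0] at hy'
      rw [hS, Set.mem_ofPred_eq, estimationError]
      push_cast at hy'
      exact hy')
  have hprob : ENNReal.ofReal (17 / 25) ≤
      (amplitudeEstimation A t).prob (fun x => |x - a| ≤ estimationError t a) := by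
    rw [Alg.prob, amplitudeEstimation, Alg.expect_ofCircuit, ENNReal.tsum_prod']
    rw [tsum_fintype]
    refine (ENNReal.ofReal_le_ofReal hsum).trans ?_
    rw [ENNReal.ofReal_sum_of_nonneg
      (fun y _ => Set.indicator_nonneg (fun y _ => by positivity) y)]
    refine Finset.sum_le_sum fun y _ => ?_
    by_cases hy : y ∈ S
    · rw [Set.indicator_of_mem hy, ← hlaw]
      refine ENNReal.tsum_le_tsum fun b => ?_
      rw [if_pos (show |Real.sin (Real.pi * (y : ℕ) / (t + 1 : ℝ)) ^ 2 - a| ≤ estimationError t a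
        from hy), mul_one]
    · rw [Set.indicator_of_notMem hy]
      simp
  have htot := Alg.prob_add_prob_not (amplitudeEstimation A t)
    (fun x => |x - a| ≤ estimationError t a)
  have h2 : ENNReal.ofReal (17 / 25) + (amplitudeEstimation A t).prob
      (fun x => ¬ |x - a| ≤ estimationError t a) ≤ ENNReal.ofReal (17 / 25) + 8 / 25 := by
    have : ENNReal.ofReal (17 / 25) + 8 / 25 = 1 := by
      rw [← ENNReal.toReal_eq_toReal_iff' (by finiteness) (by finiteness),
        ENNReal.toReal_add (by finiteness) (by finiteness), ENNReal.toReal_ofReal (by norm_num)]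
      norm_num
    rw [this, ← htot]
    gcongr
  exact (ENNReal.add_le_add_iff_left (by finiteness)).1 h2

end QBM

namespace QBM

/-! ## The three algorithms on a fixed grid -/

section Levels

theorem level_zero_apply (f : ℝ → ℝ) (y : ℝ) :
    level f 0 y = if 0 ≤ f y ∧ f y < 1 then f y else 0 := by
  simp [level, cut, Set.indicator]

theorem level_succ_apply (f : ℝ → ℝ) (l : ℕ) (y : ℝ) :
    level f (l + 1) y = (if 2 ^ l ≤ f y ∧ f y < 2 ^ (l + 1) then f y else 0) / 2 ^ (l + 1) := by
  simp [level, cut, Set.indicator]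

theorem level_mem_Icc (f : ℝ → ℝ) (l : ℕ) (y : ℝ) : level f l y ∈ Set.Icc (0 : ℝ) 1 := by
  cases l with
  | zero =>
    rw [level_zero_apply]
    split_ifs with h
    · exact ⟨h.1, h.2.le⟩
    · simp
  | succ l =>
    rw [level_succ_apply]
    split_ifs with h
    · have h2 : (0 : ℝ) < 2 ^ l := by positivity
      have h0 : 0 ≤ f y := h2.le.trans h.1
      exact ⟨by positivity, by rw [div_le_one (by positivity)]; exact h.2.le⟩
    · simp

/-- The levels partition the values in `[0, 2 ^ k)`, so the weighted sum telescopes to the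
truncation of `f`. -/
theorem sum_two_pow_mul_level {f : ℝ → ℝ} (hf : ∀ y, 0 ≤ f y) (k : ℕ) (y : ℝ) :
    ∑ l ∈ Finset.range (k + 1), 2 ^ l * level f l y = if f y < 2 ^ k then f y else 0 := by
  induction k with
  | zero => simp [level_zero_apply, hf]
  | succ k ih =>
    rw [Finset.sum_range_succ, ih, level_succ_apply, mul_div_cancel₀ _ (by positivity)]
    have : (2 : ℝ) ^ k ≤ 2 ^ (k + 1) := pow_le_pow_right₀ (by norm_num) (by omega)
    by_cases h1 : f y < 2 ^ k
    · rw [if_pos h1, if_neg (by intro h; linarith [h.1]), if_pos (by linarith), add_zero]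
    · rw [if_neg h1, zero_add]
      simp [not_lt.1 h1]

/-- At most one level is nonzero at `y`, and on level `l + 1` one has `2 ^ (l + 1) ≤ 2 * f y`. This
is the second moment input for Cauchy–Schwarz. -/
theorem sum_four_pow_mul_level_le {f : ℝ → ℝ} (k : ℕ) (y : ℝ) :
    ∑ l ∈ Finset.range k, 4 ^ (l + 1) * level f (l + 1) y
      ≤ if f y < 2 ^ k then 2 * f y ^ 2 else 0 := by
  induction k with
  | zero => simp; split_ifs <;> positivity
  | succ k ih =>
    rw [Finset.sum_range_succ, level_succ_apply]
    have h12 : (2 : ℝ) ^ k ≤ 2 ^ (k + 1) := pow_le_pow_right₀ (by norm_num) (by omega)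
    have h4 : (4 : ℝ) ^ (k + 1) = 2 ^ (k + 1) * 2 ^ (k + 1) := by
      rw [← mul_pow]; norm_num
    rw [h4, mul_assoc, mul_div_cancel₀ _ (by positivity)]
    by_cases h1 : f y < 2 ^ k
    · rw [if_pos h1] at ih
      rw [if_neg (by intro h; linarith [h.1]), if_pos (by linarith), mul_zero, add_zero]
      exact ih
    · rw [if_neg h1] at ih
      refine (add_le_add_left ih _).trans ?_
      rw [zero_add]
      by_cases h2 : f y < 2 ^ (k + 1)
      · rw [if_pos ⟨not_lt.1 h1, h2⟩, if_pos h2, pow_succ]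
        have h0 : (0 : ℝ) < 2 ^ k := by positivity
        nlinarith [not_lt.1 h1]
      · rw [if_neg (fun h => h2 h.2), if_neg h2, mul_zero]

end Levels

theorem gridMean_sum {ι : Type} (n : ℕ) (umin umax : ℝ) (θ : ℝ → ℝ → ℝ) (s : Finset ι)
    (φ : ι → ℝ → ℝ) :
    gridMean n umin umax θ (fun y => ∑ l ∈ s, φ l y) = ∑ l ∈ s, gridMean n umin umax θ (φ l) := by
  simp only [gridMean, Finset.mul_sum]
  exact Finset.sum_comm

theorem prob_algorithm₁_le {n : ℕ} (umin umax : ℝ) (θ : ℝ → ℝ → ℝ) (g : ℝ → ℝ)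
    (hg : ∀ y, g y ∈ Set.Icc (0 : ℝ) 1) {t : ℕ} (ht : 3 ≤ t) {δ : ℝ} (hδ0 : 0 < δ) (hδ1 : δ < 1) :
    (algorithm₁ 50 n umin umax t δ θ g).prob
      (fun x => ¬ |x - gridMean n umin umax θ g|
        ≤ estimationError t (gridMean n umin umax θ g)) ≤ ENNReal.ofReal δ := by
  refine prob_median_le _ ?_ (prob_amplitudeEstimation_le umin umax θ g hg ht) hδ0 hδ1
  intro x y z hx hz hxy hyz
  rw [not_not] at hx hz ⊢
  rw [abs_le] at hx hz ⊢
  constructor <;> linarith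

theorem prob_sumLevels_le (est : ℕ → Alg ℝ) (a err : ℕ → ℝ) (δ : ℕ → ℝ≥0∞)
    (h : ∀ l, (est l).prob (fun x => ¬ |x - a l| ≤ err l) ≤ δ l) (k : ℕ) :
    (sumLevels est k).prob (fun x => ¬ |x - ∑ l ∈ Finset.range (k + 1), 2 ^ l * a l|
        ≤ ∑ l ∈ Finset.range (k + 1), 2 ^ l * err l) ≤ ∑ l ∈ Finset.range (k + 1), δ l := by
  induction k with
  | zero => simpa [sumLevels] using h 0
  | succ k ih =>
    rw [sumLevels, Finset.sum_range_succ _ (k + 1), Finset.sum_range_succ _ (k + 1),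
      Finset.sum_range_succ _ (k + 1)]
    refine (Alg.prob_andThen_le _ _ _ _ fun s hs => ?_).trans (add_le_add_left ih _)
    refine (Alg.prob_andThen_le _ _ _ _ (c := 0) fun m hm => ?_).trans
      ((add_zero _).le.trans (h (k + 1)))
    rw [Alg.prob_ret_of_not]
    rw [not_not] at hs hm ⊢
    have e : s + 2 ^ (k + 1) * m - (∑ l ∈ Finset.range (k + 1), 2 ^ l * a l
        + 2 ^ (k + 1) * a (k + 1)) = (s - ∑ l ∈ Finset.range (k + 1), 2 ^ l * a l)
        + 2 ^ (k + 1) * (m - a (k + 1)) := by ring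
    rw [e]
    refine (abs_add_le _ _).trans (add_le_add hs ?_)
    rw [abs_mul, abs_of_pos (by positivity)]
    gcongr

/-! ### Elementary bounds for the number of levels and of iterations -/

section Parameters

variable {e : ℝ}

theorem epsTilde_one (e : ℝ) : epsTilde 1 e = e / 12 := by
  rw [epsTilde]
  norm_num

theorem four_le_logb (he0 : 0 < e) (he1 : e < 1 / 2) : 4 ≤ Real.logb 2 (1 / epsTilde 1 e) := by
  rw [epsTilde_one, Real.le_logb_iff_rpow_le (by norm_num) (by positivity),
    le_div_iff₀ (by positivity)]
  norm_num
  linarith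

theorem logb_le_numLevels (e : ℝ) : Real.logb 2 (1 / epsTilde 1 e) ≤ numLevels 1 e :=
  Nat.le_ceil _

theorem numLevels_le (he0 : 0 < e) (he1 : e < 1 / 2) :
    (numLevels 1 e : ℝ) ≤ Real.logb 2 (1 / epsTilde 1 e) + 1 :=
  (Nat.ceil_lt_add_one (by linarith [four_le_logb he0 he1])).le

theorem four_le_numLevels (he0 : 0 < e) (he1 : e < 1 / 2) : 4 ≤ numLevels 1 e := by
  have := (four_le_logb he0 he1).trans (logb_le_numLevels e)
  exact_mod_cast this

theorem inv_le_two_pow_numLevels (he0 : 0 < e) : 1 / epsTilde 1 e ≤ 2 ^ numLevels 1 e := by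
  have h0 : 0 < 1 / epsTilde 1 e := by rw [epsTilde_one]; positivity
  have := logb_le_numLevels e
  rwa [Real.logb_le_iff_le_rpow (by norm_num) h0, Real.rpow_natCast] at this

theorem two_pow_numLevels_le (he0 : 0 < e) (he1 : e < 1 / 2) :
    2 ^ numLevels 1 e ≤ 2 / epsTilde 1 e := by
  have h0 : 0 < epsTilde 1 e := by rw [epsTilde_one]; positivity
  have := numLevels_le he0 he1
  have h2 : Real.logb 2 (1 / epsTilde 1 e) + 1 = Real.logb 2 (2 / epsTilde 1 e) := by
    rw [show (2 : ℝ) / epsTilde 1 e = 1 / epsTilde 1 e * 2 by ring,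
      Real.logb_mul (by positivity) (by norm_num), Real.logb_self_eq_one (by norm_num)]
  rwa [h2, Real.le_logb_iff_rpow_le (by norm_num) (by positivity), Real.rpow_natCast] at this

theorem le_numIterations (e : ℝ) :
    100 * Real.sqrt (Real.logb 2 (1 / epsTilde 1 e)) / epsTilde 1 e ≤ numIterations 100 1 e :=
  Nat.le_ceil _

theorem three_le_numIterations (he0 : 0 < e) (he1 : e < 1 / 2) : 3 ≤ numIterations 100 1 e := by
  have h0 : 0 < epsTilde 1 e := by rw [epsTilde_one]; positivity
  have h1 : epsTilde 1 e ≤ 1 := by rw [epsTilde_one]; linarith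
  have h2 : 1 ≤ Real.sqrt (Real.logb 2 (1 / epsTilde 1 e)) :=
    Real.one_le_sqrt.2 (by linarith [four_le_logb he0 he1])
  have h3 : (3 : ℝ) ≤ 100 * Real.sqrt (Real.logb 2 (1 / epsTilde 1 e)) / epsTilde 1 e := by
    rw [le_div_iff₀ h0]
    linarith
  exact_mod_cast h3.trans (le_numIterations e)

end Parameters

/-! ### Accuracy of Algorithm 2 relative to the grid mean -/

section SecondAlgorithm

variable {n : ℕ} {umin umax : ℝ} {θ : ℝ → ℝ → ℝ} {f : ℝ → ℝ} {e : ℝ}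

/-- The two terms of the estimation error are summed separately. Cauchy–Schwarz gives `∑ 2^l √a_l ≤
1 + √(10 k)`, which is of the order of the numerator `√(log₂ (1/ε̃))` of `t₀`; the geometric sum of
the weights is at most `4 / ε̃` and meets the square of `t₀`. With `D̃ = 100` each contributes at
most `ε̃ / 2`, even for the second moment `5` that the grid guarantees. -/
theorem sum_estimationError_le (hM : gridMean n umin umax θ (fun y => f y ^ 2) ≤ 5)
    (he0 : 0 < e) (he1 : e < 1 / 2) :
    ∑ l ∈ Finset.range (numLevels 1 e + 1), 2 ^ l *
      estimationError (numIterations 100 1 e) (gridMean n umin umax θ (level f l))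
      ≤ epsTilde 1 e := by
  set a : ℕ → ℝ := fun l => gridMean n umin umax θ (level f l) with ha
  set k := numLevels 1 e with hk
  set t := numIterations 100 1 e with ht
  set ε := epsTilde 1 e with hε
  set Λ := Real.logb 2 (1 / ε) with hΛ
  have hε0 : 0 < ε := by rw [hε, epsTilde_one]; positivity
  have hΛ4 : 4 ≤ Λ := four_le_logb he0 he1
  have ha0 : ∀ l, 0 ≤ a l := fun l =>
    gridMean_nonneg n umin umax θ fun y => (level_mem_Icc f l y).1
  have ha1 : ∀ l, a l ≤ 1 := fun l => by
    rw [← gridMean_const n umin umax θ 1]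
    exact gridMean_mono n umin umax θ fun y => (level_mem_Icc f l y).2
  have hsq : ∑ l ∈ Finset.range k, 4 ^ (l + 1) * a (l + 1) ≤ 10 := by
    have h1 : ∑ l ∈ Finset.range k, 4 ^ (l + 1) * a (l + 1)
        = gridMean n umin umax θ
          (fun y => ∑ l ∈ Finset.range k, 4 ^ (l + 1) * level f (l + 1) y) := by
      rw [gridMean_sum]
      exact Finset.sum_congr rfl fun l _ => (gridMean_const_mul n umin umax θ _ _).symm
    have h2 : gridMean n umin umax θ
        (fun y => ∑ l ∈ Finset.range k, 4 ^ (l + 1) * level f (l + 1) y)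
        ≤ gridMean n umin umax θ (fun y => 2 * f y ^ 2) := by
      refine gridMean_mono n umin umax θ fun y => (sum_four_pow_mul_level_le k y).trans ?_
      split_ifs
      · exact le_rfl
      · positivity
    rw [gridMean_const_mul] at h2
    linarith
  have hroot : ∑ l ∈ Finset.range (k + 1), 2 ^ l * Real.sqrt (a l) ≤ 1 + Real.sqrt (10 * k) := by
    rw [Finset.sum_range_succ', add_comm]
    refine add_le_add ?_ (Real.le_sqrt_of_sq_le ?_)
    · rw [pow_zero, one_mul]
      exact Real.sqrt_le_one.2 (ha1 0)
    · refine (sq_sum_le_card_mul_sum_sq).trans ?_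
      rw [Finset.card_range, mul_comm (10 : ℝ)]
      refine mul_le_mul_of_nonneg_left (le_trans (le_of_eq ?_) hsq) (by positivity)
      refine Finset.sum_congr rfl fun l _ => ?_
      rw [mul_pow, Real.sq_sqrt (ha0 _), ← pow_mul, mul_comm (l + 1), pow_mul]
      norm_num
  have hpow : ∑ l ∈ Finset.range (k + 1), (2 : ℝ) ^ l ≤ 4 / ε := by
    rw [geom_sum_eq (by norm_num)]
    have := two_pow_numLevels_le he0 he1
    rw [← hk, ← hε] at this
    rw [pow_succ, show (4 : ℝ) / ε = 2 / ε * 2 by ring]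
    linarith
  have hexp : ∑ l ∈ Finset.range (k + 1), 2 ^ l * estimationError t (a l)
      = 2 * Real.pi / (t + 1) * ∑ l ∈ Finset.range (k + 1), 2 ^ l * Real.sqrt (a l)
        + Real.pi ^ 2 / (t + 1) ^ 2 * ∑ l ∈ Finset.range (k + 1), (2 : ℝ) ^ l := by
    rw [Finset.mul_sum, Finset.mul_sum, ← Finset.sum_add_distrib]
    refine Finset.sum_congr rfl fun l _ => ?_
    rw [estimationError]
    ring
  set r := Real.sqrt Λ with hr
  have hr2 : 2 ≤ r := Real.le_sqrt_of_sq_le (by linarith)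
  have hrsq : r ^ 2 = Λ := Real.sq_sqrt (by linarith)
  have hkr : Real.sqrt (10 * k) ≤ 3.6 * r := by
    refine Real.sqrt_le_iff.2 ⟨by positivity, ?_⟩
    have := numLevels_le he0 he1
    rw [← hk, ← hε, ← hΛ] at this
    nlinarith
  have hM0 : (0 : ℝ) < t + 1 := by positivity
  have htr : 100 * r ≤ ε * (t + 1) := by
    have := le_numIterations e
    rw [← ht, ← hε, ← hΛ, ← hr, div_le_iff₀ hε0] at this
    nlinarith
  have hπ0 := Real.pi_pos
  have hπ1 := Real.pi_lt_d4
  rw [hexp]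
  have h1 : 2 * Real.pi / (t + 1) * ∑ l ∈ Finset.range (k + 1), 2 ^ l * Real.sqrt (a l)
      ≤ ε / 2 := by
    calc _ ≤ 2 * Real.pi / (t + 1) * (5 * r) := by
          gcongr
          linarith
      _ ≤ ε / 2 := by
          rw [div_mul_eq_mul_div, div_le_iff₀ hM0]
          nlinarith
  have h2 : Real.pi ^ 2 / (t + 1) ^ 2 * ∑ l ∈ Finset.range (k + 1), (2 : ℝ) ^ l ≤ ε / 2 := by
    calc _ ≤ Real.pi ^ 2 / (t + 1) ^ 2 * (4 / ε) := by gcongr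
      _ ≤ ε / 2 := by
          rw [div_mul_div_comm, div_le_div_iff₀ (by positivity) (by norm_num)]
          have h3 : (200 : ℝ) ^ 2 ≤ (ε * (t + 1)) ^ 2 :=
            pow_le_pow_left₀ (by norm_num) (by linarith) 2
          nlinarith
  linarith

/-- The discarded values satisfy `f ≥ 2 ^ k ≥ 1 / ε̃`, hence `f ≤ ε̃ f²`, and the truncation loses
at most `ε̃` times the second moment. -/
theorem abs_sum_level_sub_gridMean_le (hf : ∀ y, 0 ≤ f y)
    (hM : gridMean n umin umax θ (fun y => f y ^ 2) ≤ 5) (he0 : 0 < e) :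
    |∑ l ∈ Finset.range (numLevels 1 e + 1), 2 ^ l * gridMean n umin umax θ (level f l)
      - gridMean n umin umax θ f| ≤ 5 * epsTilde 1 e := by
  have hε0 : 0 < epsTilde 1 e := by rw [epsTilde_one]; positivity
  set k := numLevels 1 e with hk
  have h1 : ∑ l ∈ Finset.range (k + 1), 2 ^ l * gridMean n umin umax θ (level f l)
      = gridMean n umin umax θ (fun y => if f y < 2 ^ k then f y else 0) := by
    simp only [← sum_two_pow_mul_level hf]
    rw [gridMean_sum]
    exact Finset.sum_congr rfl fun l _ => (gridMean_const_mul n umin umax θ _ _).symm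
  have hk2 := inv_le_two_pow_numLevels he0
  rw [← hk] at hk2
  have hle : gridMean n umin umax θ f ≤
      gridMean n umin umax θ (fun y => (if f y < 2 ^ k then f y else 0)
        + epsTilde 1 e * f y ^ 2) := by
    refine gridMean_mono n umin umax θ fun y => ?_
    split_ifs with h
    · have : 0 ≤ epsTilde 1 e * f y ^ 2 := by positivity
      linarith
    · have h2 : 1 ≤ epsTilde 1 e * f y := by
        rw [div_le_iff₀ hε0] at hk2
        nlinarith [not_lt.1 h]
      nlinarith [hf y]
  rw [gridMean_add, gridMean_const_mul] at hle
  have hge : gridMean n umin umax θ (fun y => if f y < 2 ^ k then f y else 0)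
      ≤ gridMean n umin umax θ f := by
    refine gridMean_mono n umin umax θ fun y => ?_
    split_ifs with h
    · exact le_rfl
    · exact hf y
  rw [h1, abs_le]
  constructor
  · nlinarith
  · nlinarith

/-- Estimation contributes `ε̃` and truncation `5 ε̃`, in total `6 * (e / 12) = e / 2`. The failure
parameters add up exactly: `δ / 2` at level `0` and `k` times `δ / (2k)` above. -/
theorem prob_algorithm₂_le {D : ℝ} (hn : n = numQubits D 1 e) (hf : ∀ y, 0 ≤ f y)
    (hM : gridMean n umin umax θ (fun y => f y ^ 2) ≤ 5) (he0 : 0 < e) (he1 : e < 1 / 2) :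
    (algorithm₂ 100 50 D umin umax 1 e (1 / 9) θ f).prob
      (fun x => ¬ |x - gridMean n umin umax θ f| ≤ e / 2) ≤ ENNReal.ofReal (1 / 9) := by
  have hk4 := four_le_numLevels he0 he1
  have hk4' : (4 : ℝ) ≤ numLevels 1 e := by exact_mod_cast hk4
  have hδ : ∀ l : ℕ, 0 < (if l = 0 then (1 / 9 : ℝ) / 2 else 1 / 9 / (2 * numLevels 1 e)) ∧
      (if l = 0 then (1 / 9 : ℝ) / 2 else 1 / 9 / (2 * numLevels 1 e)) < 1 := by
    intro l
    split_ifs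
    · norm_num
    · exact ⟨by positivity, by rw [div_lt_one (by positivity)]; linarith⟩
  have key := prob_sumLevels_le
    (fun l => algorithm₁ 50 n umin umax (numIterations 100 1 e)
      (if l = 0 then 1 / 9 / 2 else 1 / 9 / (2 * numLevels 1 e)) θ (level f l))
    (fun l => gridMean n umin umax θ (level f l))
    (fun l => estimationError (numIterations 100 1 e) (gridMean n umin umax θ (level f l)))
    (fun l => ENNReal.ofReal (if l = 0 then 1 / 9 / 2 else 1 / 9 / (2 * numLevels 1 e)))
    (fun l => prob_algorithm₁_le umin umax θ (level f l) (level_mem_Icc f l)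
      (three_le_numIterations he0 he1) (hδ l).1 (hδ l).2) (numLevels 1 e)
  have hsum : ∑ l ∈ Finset.range (numLevels 1 e + 1),
      ENNReal.ofReal (if l = 0 then 1 / 9 / 2 else 1 / 9 / (2 * numLevels 1 e))
      = ENNReal.ofReal (1 / 9) := by
    rw [← ENNReal.ofReal_sum_of_nonneg fun l _ => (hδ l).1.le, Finset.sum_range_succ']
    congr 1
    simp only [Nat.add_eq_zero_iff, one_ne_zero, and_false, if_false, if_true, Finset.sum_const,
      Finset.card_range, nsmul_eq_mul]
    field_simp
    norm_num
  rw [hsum] at key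
  refine le_trans ?_ key
  rw [hn] at *
  refine Alg.prob_mono _ fun x hx hgood => hx ?_
  have h1 := sum_estimationError_le hM he0 he1
  have h2 := abs_sum_level_sub_gridMean_le hf hM he0
  have h3 := (abs_sub_le x _ _).trans (add_le_add (hgood.trans h1) h2)
  rw [epsTilde_one] at h3
  linarith

end SecondAlgorithm

/-! ### Centering by one sample, and accuracy of Algorithm 3 -/

section ThirdAlgorithm

theorem expect_sampleValue (n : ℕ) (umin umax : ℝ) (θ : ℝ → ℝ → ℝ) (g : ℝ → ℝ)
    (F : ℝ → ℝ≥0∞) :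
    (sampleValue n umin umax θ g).expect F =
      ∑ i, ENNReal.ofReal (((1 / 2 : ℝ) ^ n) ^ 2) * F (g (gridValue n umin umax θ i)) := by
  classical
  have hm : ∀ b, (Circuit.measured (valueCircuit n umin umax θ g) (Reg.zero n)) b
      = ‖(valueCircuit n umin umax θ g).op (groundState n) b‖ₑ ^ 2 := fun b => rfl
  rw [sampleValue, Alg.expect_ofCircuit]
  simp only [hm, valueCircuit_apply_zero]
  have hinj : Function.Injective fun i => gridState n umin umax θ g (i, 0) := fun i j h =>
    (Prod.ext_iff.1 (gridState_injective n umin umax θ g h)).1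
  rw [← hinj.tsum_eq, tsum_fintype]
  · refine Finset.sum_congr rfl fun i _ => ?_
    have hi : gridState n umin umax θ g (i, 0) = gridState n umin umax θ g
        (((gridState n umin umax θ g (i, 0)).j, (gridState n umin umax θ g (i, 0)).k), 0) := rfl
    rw [if_pos hi, ENNReal.ofReal_pow (by positivity), ← ofReal_norm, Complex.norm_real,
      Real.norm_eq_abs, abs_of_pos (by positivity)]
    rfl
  · intro b hb
    by_contra h
    apply hb
    have : b ≠ gridState n umin umax θ g ((b.j, b.k), 0) := fun h' => h ⟨_, h'.symm⟩
    simp [this]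

/-- Chebyshev's inequality for a uniformly random grid point: `3 / 36 = 1 / 12`. -/
theorem prob_sampleValue_le (n : ℕ) (umin umax : ℝ) (θ : ℝ → ℝ → ℝ) (g : ℝ → ℝ) (μ : ℝ)
    (h : gridMean n umin umax θ (fun y => (g y - μ) ^ 2) ≤ 3) :
    (sampleValue n umin umax θ g).prob (fun x => ¬ |x - μ| ≤ 6) ≤ ENNReal.ofReal (1 / 12) := by
  classical
  rw [Alg.prob, expect_sampleValue]
  refine (Finset.sum_le_sum fun i _ => (?_ : _ ≤ ENNReal.ofReal (((1 / 2 : ℝ) ^ n) ^ 2 *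
    (g (gridValue n umin umax θ i) - μ) ^ 2 / 36))).trans ?_
  · by_cases hi : |g (gridValue n umin umax θ i) - μ| ≤ 6
    · rw [if_neg (not_not.2 hi), mul_zero]
      exact zero_le
    · rw [if_pos hi, mul_one]
      refine ENNReal.ofReal_le_ofReal ?_
      rw [mul_div_assoc]
      refine le_mul_of_one_le_right (by positivity) ?_
      rw [one_le_div (by norm_num), ← sq_abs]
      nlinarith [not_le.1 hi]
  rw [← ENNReal.ofReal_sum_of_nonneg fun i _ => by positivity]
  refine ENNReal.ofReal_le_ofReal ?_
  rw [← Finset.sum_div]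
  rw [gridMean] at h
  linarith

/-- On a fixed grid, the third algorithm estimates the mean over the grid. -/
theorem prob_algorithm₃_le {D umin umax σ ε : ℝ} {θ : ℝ → ℝ → ℝ} {n : ℕ}
    (hn : n = numQubits D 1 (ε / (8 * σ))) (hσ : 0 < σ) (hε0 : 0 < ε) (hε1 : ε < 4 * σ) (μ : ℝ)
    (h : gridMean n umin umax θ (fun y => (y / σ - μ) ^ 2) ≤ 3) :
    (algorithm₃ 100 50 D umin umax σ ε θ).prob
      (fun x => ¬ |x - σ * gridMean n umin umax θ (fun y => y / σ)| ≤ ε / 2)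
      ≤ ENNReal.ofReal (1 / 3) := by
  set e := ε / (8 * σ) with he
  have he0 : 0 < e := by positivity
  have he1 : e < 1 / 2 := by rw [he, div_lt_iff₀ (by positivity)]; linarith
  -- The budget is one sample and two calls of Algorithm 2, that is `11 / 36`; the `0` belongs to
  -- the final return.
  have hconst : ENNReal.ofReal (1 / 12) + (ENNReal.ofReal (1 / 9) + (ENNReal.ofReal (1 / 9) + 0))
      ≤ ENNReal.ofReal (1 / 3) := by
    rw [add_zero, ← ENNReal.ofReal_add (by norm_num) (by norm_num),
      ← ENNReal.ofReal_add (by norm_num) (by norm_num)]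
    exact ENNReal.ofReal_le_ofReal (by norm_num)
  refine le_trans ?_ hconst
  rw [algorithm₃, ← he, ← hn]
  refine (Alg.prob_andThen_le _ _ (fun x => ¬ |x - μ| ≤ 6) _ fun m hm => ?_).trans
    (add_le_add_left (prob_sampleValue_le n umin umax θ _ μ h) _)
  rw [not_not] at hm
  set fm : ℝ → ℝ := fun y => -cut (Set.Iio 0) (fun x => x / σ - m) y / 4 with hfm
  set fp : ℝ → ℝ := fun y => cut (Set.Ici 0) (fun x => x / σ - m) y / 4 with hfp
  have hcases : ∀ y, (0 ≤ fm y ∧ 0 ≤ fp y) ∧ fp y - fm y = (y / σ - m) / 4 ∧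
      fm y ^ 2 ≤ (y / σ - m) ^ 2 / 16 ∧ fp y ^ 2 ≤ (y / σ - m) ^ 2 / 16 := by
    intro y
    simp only [hfm, hfp, cut, Set.indicator, Set.mem_Iio, Set.mem_Ici, id]
    rcases lt_or_ge (y / σ - m) 0 with h | h
    · rw [if_pos h, if_neg (not_le.2 h)]
      refine ⟨⟨by linarith, by norm_num⟩, by ring, le_of_eq (by ring), ?_⟩
      rw [zero_div, zero_pow (by norm_num)]
      positivity
    · rw [if_neg (not_lt.2 h), if_pos h]
      refine ⟨⟨by norm_num, by linarith⟩, by ring, ?_, le_of_eq (by ring)⟩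
      rw [neg_zero, zero_div, zero_pow (by norm_num)]
      positivity
  -- From `(y/σ - m)² ≤ 2 (y/σ - μ)² + 2 (m - μ)²`, divided by `16`, the second moment is at most `3
  -- / 8 + 36 / 8`. The constant `5` of Algorithm 2 is chosen above this.
  have hsecond : ∀ φ : ℝ → ℝ, (∀ y, φ y ^ 2 ≤ (y / σ - m) ^ 2 / 16) →
      gridMean n umin umax θ (fun y => φ y ^ 2) ≤ 5 := by
    intro φ hφ
    have h1 : gridMean n umin umax θ (fun y => φ y ^ 2) ≤
        gridMean n umin umax θ (fun y => 1 / 8 * (y / σ - μ) ^ 2 + 36 / 8) := by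
      refine gridMean_mono n umin umax θ fun y => (hφ y).trans ?_
      have h2 : (m - μ) ^ 2 ≤ 36 := by
        rw [← sq_abs]
        nlinarith [abs_nonneg (m - μ)]
      nlinarith [sq_nonneg ((y / σ - μ) + (m - μ))]
    rw [gridMean_add, gridMean_const_mul, gridMean_const] at h1
    linarith
  refine (Alg.prob_andThen_le _ _ _ _ fun a ha => ?_).trans
    (add_le_add_left (prob_algorithm₂_le hn (fun y => (hcases y).1.1)
      (hsecond fm fun y => (hcases y).2.2.1) he0 he1) _)
  refine (Alg.prob_andThen_le _ _ _ _ fun b hb => ?_).trans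
    (add_le_add_left (prob_algorithm₂_le hn (fun y => (hcases y).1.2)
      (hsecond fp fun y => (hcases y).2.2.2) he0 he1) _)
  rw [Alg.prob_ret_of_not]
  rw [not_not] at ha hb ⊢
  have hmean : gridMean n umin umax θ (fun y => y / σ)
      = m + 4 * (gridMean n umin umax θ fp - gridMean n umin umax θ fm) := by
    have h1 : (fun y => y / σ) = fun y => (m + 4 * fp y) + (-4) * fm y := by
      funext y
      linarith [(hcases y).2.1]
    rw [h1, gridMean_add, gridMean_add, gridMean_const, gridMean_const_mul, gridMean_const_mul]
    ring
  have e1 : σ * (m - 4 * a + 4 * b) - σ * gridMean n umin umax θ (fun y => y / σ)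
      = σ * (4 * ((b - gridMean n umin umax θ fp) - (a - gridMean n umin umax θ fm))) := by
    rw [hmean]
    ring
  have e2 : ε / 2 = σ * (4 * (e / 2 + e / 2)) := by
    rw [he]
    field_simp
    ring
  rw [e1, e2, abs_mul, abs_of_pos hσ, abs_mul, abs_of_pos (by norm_num : (0 : ℝ) < 4)]
  gcongr
  exact (abs_sub _ _).trans (add_le_add hb ha)

end ThirdAlgorithm

/-! ## Query counts -/

section Queries

theorem queries_controlledPowers {M : ℕ} {B : Type} (Q : Circuit B) (c : ℕ) :
    (controlledPowers (M := M) Q c).queries = c * Q.queries := by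
  induction c with
  | zero => simp [controlledPowers, Circuit.skip]
  | succ c ih =>
    simp only [controlledPowers, Circuit.andThen, Circuit.controlled] at ih ⊢
    rw [ih]
    ring

/-- One preparation makes one call each of the oracle and the rotation. A Grover iterate contains
the preparation and its inverse, hence `4`. -/
theorem queries_amplitudeEstimationCircuit (n : ℕ) (umin umax : ℝ) (θ : ℝ → ℝ → ℝ) (g : ℝ → ℝ)
    (t : ℕ) :
    (amplitudeEstimationCircuit (amplitudeCircuit n umin umax θ g) t).queries = 2 + t * 4 := by
  have hA : (amplitudeCircuit n umin umax θ g).queries = 2 := rfl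
  have hG : (grover (amplitudeCircuit n umin umax θ g)).queries = 4 := rfl
  simp [amplitudeEstimationCircuit, Circuit.andThen, queries_controlledPowers, Circuit.controlled,
    Circuit.multiplexed, Circuit.inverse, hA, hG]

theorem queriesLE_algorithm₁ (R : ℝ) (n : ℕ) (umin umax : ℝ) (t : ℕ) (δ : ℝ) (θ : ℝ → ℝ → ℝ)
    (g : ℝ → ℝ) :
    (algorithm₁ R n umin umax t δ θ g).QueriesLE (⌈R * Real.log (1 / δ)⌉₊ * (2 + t * 4)) := by
  have h : (amplitudeEstimation (amplitudeCircuit n umin umax θ g) t).QueriesLE (2 + t * 4) := by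
    rw [← queries_amplitudeEstimationCircuit n umin umax θ g t]
    exact Alg.queriesLE_ofCircuit _ _ _
  exact (h.repeated _).andThen (fun l => Alg.queriesLE_ret _)

theorem queriesLE_sumLevels {est : ℕ → Alg ℝ} {c : ℕ} (h : ∀ l, (est l).QueriesLE c) (k : ℕ) :
    (sumLevels est k).QueriesLE ((k + 1) * c) := by
  induction k with
  | zero => simpa [sumLevels] using h 0
  | succ k ih =>
    refine (ih.andThen fun s => (h (k + 1)).andThen fun m =>
      Alg.queriesLE_ret (s + 2 ^ (k + 1) * m)).mono (le_of_eq ?_)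
    ring

/-- The levels above `0` have the smallest failure parameter, `1 / (18 k)`, and determine a common
bound for the number of repetitions. -/
theorem queriesLE_algorithm₂ {Dt D umin umax e : ℝ} {θ : ℝ → ℝ → ℝ} {f : ℝ → ℝ}
    (hk : 1 ≤ numLevels 1 e) :
    (algorithm₂ Dt 50 D umin umax 1 e (1 / 9) θ f).QueriesLE
      ((numLevels 1 e + 1) *
        (⌈50 * Real.log (18 * numLevels 1 e)⌉₊ * (2 + numIterations Dt 1 e * 4))) := by
  have hk' : (1 : ℝ) ≤ numLevels 1 e := by exact_mod_cast hk
  refine queriesLE_sumLevels (fun l => (queriesLE_algorithm₁ _ _ _ _ _ _ _ _).mono ?_) _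
  gcongr
  split_ifs
  · norm_num
    linarith
  · rw [one_div_div]
    norm_num
    linarith

theorem queriesLE_algorithm₃ {Dt D umin umax σ ε : ℝ} {θ : ℝ → ℝ → ℝ}
    (hk : 1 ≤ numLevels 1 (ε / (8 * σ))) :
    (algorithm₃ Dt 50 D umin umax σ ε θ).QueriesLE
      (1 + 2 * ((numLevels 1 (ε / (8 * σ)) + 1) *
        (⌈50 * Real.log (18 * numLevels 1 (ε / (8 * σ)))⌉₊ *
          (2 + numIterations Dt 1 (ε / (8 * σ)) * 4)))) := by
  refine Alg.QueriesLE.mono (Alg.QueriesLE.andThen (c := 1) ?_ fun m =>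
    (queriesLE_algorithm₂ hk).andThen fun a => (queriesLE_algorithm₂ hk).andThen fun b =>
      Alg.queriesLE_ret _) (le_of_eq (by ring))
  exact Alg.queriesLE_ofCircuit _ _ _

end Queries

end QBM

namespace QBM

/-! ## The Box-Muller transform -/

/-- The uniform distribution on the unit interval. -/
noncomputable def unitUniform : Measure ℝ := volume.restrict (Set.Ioo 0 1)

instance : IsProbabilityMeasure unitUniform :=
  ⟨by simp [unitUniform]⟩

/-- `√(-2 ln u)`. -/
noncomputable def radius (u : ℝ) : ℝ := Real.sqrt (-2 * Real.log u)

/-- The Box-Muller transform. -/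
noncomputable def boxMuller (p : ℝ × ℝ) : ℝ × ℝ := (boxMuller₁ p.1 p.2, boxMuller₂ p.1 p.2)

theorem boxMuller₁_eq (u v : ℝ) : boxMuller₁ u v = radius u * Real.sin (2 * Real.pi * v) := rfl

theorem boxMuller₂_eq (u v : ℝ) : boxMuller₂ u v = radius u * Real.cos (2 * Real.pi * v) := rfl

theorem measurable_radius : Measurable radius := by
  unfold radius
  fun_prop

theorem measurable_boxMuller : Measurable boxMuller := by
  have := measurable_radius
  unfold boxMuller
  simp only [boxMuller₁_eq, boxMuller₂_eq]
  fun_prop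

theorem radius_exp {r : ℝ} (hr : 0 ≤ r) : radius (Real.exp (-(r ^ 2 / 2))) = r := by
  rw [radius, Real.log_exp, show -2 * -(r ^ 2 / 2) = r ^ 2 by ring, Real.sqrt_sq hr]

/-- The shift by `π` moves the angle to the interval `(-π, π)` used by `polarCoord`. -/
theorem lintegral_unitUniform_angle (F : ℝ → ℝ≥0∞) :
    ∫⁻ v, ENNReal.ofReal (2 * Real.pi) * F (2 * Real.pi * v - Real.pi) ∂unitUniform
      = ∫⁻ φ in Set.Ioo (-Real.pi) Real.pi, F φ := by
  have hπ := Real.pi_pos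
  have himg : (fun v => 2 * Real.pi * v - Real.pi) '' Set.Ioo 0 1
      = Set.Ioo (-Real.pi) Real.pi := by
    ext φ
    simp only [Set.mem_image, Set.mem_Ioo]
    constructor
    · rintro ⟨v, hv, rfl⟩
      constructor <;> nlinarith
    · rintro ⟨h1, h2⟩
      refine ⟨(φ + Real.pi) / (2 * Real.pi), ⟨?_, ?_⟩, ?_⟩
      · have : 0 < φ + Real.pi := by linarith
        positivity
      · rw [div_lt_one (by positivity)]
        linarith
      · field_simp
        ring
  have h := lintegral_image_eq_lintegral_abs_deriv_mul (s := Set.Ioo (0 : ℝ) 1)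
    (f := fun v => 2 * Real.pi * v - Real.pi) (f' := fun _ => 2 * Real.pi) measurableSet_Ioo
    (fun v _ => by
      have := ((hasDerivAt_id v).const_mul (2 * Real.pi)).sub_const Real.pi
      simpa using this.hasDerivWithinAt)
    (fun x _ y _ hxy => by
      have : 2 * Real.pi * x = 2 * Real.pi * y := by simpa using hxy
      exact mul_left_cancel₀ (by positivity) this) F
  rw [himg] at h
  rw [h, abs_of_pos (by positivity)]
  rfl

/-- Substitution `u = exp (-r² / 2)`, whose Jacobian `r exp (-r² / 2)` is the polar form of the
normal density up to the angular factor. -/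
theorem lintegral_unitUniform_radius (F : ℝ → ℝ≥0∞) :
    ∫⁻ u, F (radius u) ∂unitUniform
      = ∫⁻ r in Set.Ioi (0 : ℝ), ENNReal.ofReal (r * Real.exp (-(r ^ 2 / 2))) * F r := by
  have himg : (fun r : ℝ => Real.exp (-(r ^ 2 / 2))) '' Set.Ioi 0 = Set.Ioo 0 1 := by
    ext u
    simp only [Set.mem_image, Set.mem_Ioi, Set.mem_Ioo]
    constructor
    · rintro ⟨r, hr, rfl⟩
      refine ⟨Real.exp_pos _, ?_⟩
      rw [Real.exp_lt_one_iff]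
      have : 0 < r ^ 2 / 2 := by positivity
      linarith
    · rintro ⟨h1, h2⟩
      have hlog : 0 < -2 * Real.log u := by linarith [Real.log_neg h1 h2]
      refine ⟨radius u, Real.sqrt_pos.2 hlog, ?_⟩
      rw [radius, Real.sq_sqrt hlog.le, show -(-2 * Real.log u / 2) = Real.log u by ring,
        Real.exp_log h1]
  have h := lintegral_image_eq_lintegral_abs_deriv_mul (s := Set.Ioi (0 : ℝ))
    (f := fun r => Real.exp (-(r ^ 2 / 2))) (f' := fun r => Real.exp (-(r ^ 2 / 2)) * -r)
    measurableSet_Ioi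
    (fun r _ => by
      have h1 : HasDerivAt (fun r : ℝ => -(r ^ 2 / 2)) (-r) r := by
        have := ((hasDerivAt_pow 2 r).div_const 2).neg
        refine this.congr_deriv ?_
        norm_num
      exact h1.exp.hasDerivWithinAt)
    (fun x hx y hy hxy => by
      have h1 := congrArg radius hxy
      simp only [radius_exp (le_of_lt hx), radius_exp (le_of_lt hy)] at h1
      exact h1) (fun u => F (radius u))
  rw [himg] at h
  rw [unitUniform, h]
  refine setLIntegral_congr_fun measurableSet_Ioi fun r hr => ?_
  rw [radius_exp (le_of_lt hr), abs_mul, abs_neg, abs_of_pos (Real.exp_pos _),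
    abs_of_pos (show (0 : ℝ) < r from hr), mul_comm r]

theorem gaussianPDF_mul (x y : ℝ) :
    gaussianPDF 0 1 x * gaussianPDF 0 1 y
      = ENNReal.ofReal (Real.exp (-((x ^ 2 + y ^ 2) / 2)) / (2 * Real.pi)) := by
  rw [gaussianPDF, gaussianPDF, ← ENNReal.ofReal_mul (gaussianPDFReal_nonneg _ _ _)]
  congr 1
  simp only [gaussianPDFReal, NNReal.coe_one, mul_one, sub_zero]
  have h : Real.sqrt (2 * Real.pi) * Real.sqrt (2 * Real.pi) = 2 * Real.pi :=
    Real.mul_self_sqrt (by positivity)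
  rw [mul_mul_mul_comm, ← Real.exp_add, ← mul_inv, h, div_eq_mul_inv (Real.exp _) (2 * Real.pi), mul_comm]
  congr 2
  ring

theorem lintegral_normalPair {F : ℝ × ℝ → ℝ≥0∞} (hF : Measurable F) :
    ∫⁻ p, F p ∂normalPair
      = ∫⁻ p : ℝ × ℝ, ENNReal.ofReal (Real.exp (-((p.1 ^ 2 + p.2 ^ 2) / 2)) / (2 * Real.pi))
          * F p := by
  rw [normalPair, gaussianReal_of_var_ne_zero _ one_ne_zero,
    prod_withDensity (measurable_gaussianPDF _ _) (measurable_gaussianPDF _ _),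
    lintegral_withDensity_eq_lintegral_mul _ (by fun_prop) hF]
  refine lintegral_congr fun p => ?_
  rw [Pi.mul_apply, gaussianPDF_mul]

/-- Box-Muller puts the sine first, polar coordinates the cosine, and the angles are shifted by `π`.
Together this is the map `(x, y) ↦ (-y, -x)`, which preserves area. -/
theorem lintegral_neg_swap {F : ℝ × ℝ → ℝ≥0∞} :
    ∫⁻ p : ℝ × ℝ, F (-p.2, -p.1) = ∫⁻ p, F p := by
  rw [← lintegral_neg_eq_self (μ := (volume : Measure (ℝ × ℝ))) F, Measure.volume_eq_prod,
    ← lintegral_prod_swap]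
  rfl

/-- The Box-Muller transform of a uniform point of the unit square is a pair of independent
standard normal variables. -/
theorem map_boxMuller : (unitUniform.prod unitUniform).map boxMuller = normalPair := by
  refine Measure.ext_of_lintegral _ fun F hF => ?_
  have hπ := Real.pi_pos
  rw [lintegral_map hF measurable_boxMuller, lintegral_normalPair hF, ← lintegral_neg_swap,
    ← lintegral_comp_polarCoord_symm, polarCoord_target, Measure.volume_eq_prod,
    ← Measure.prod_restrict, lintegral_prod (fun a => F (boxMuller a)) (hF.comp measurable_boxMuller).aemeasurable,
    lintegral_prod]
  · have hinner : ∀ u, ∫⁻ v, F (boxMuller (u, v)) ∂unitUniform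
        = (ENNReal.ofReal (2 * Real.pi))⁻¹ * ∫⁻ φ in Set.Ioo (-Real.pi) Real.pi,
          F (-(radius u * Real.sin φ), -(radius u * Real.cos φ)) := by
      intro u
      have h2π : ENNReal.ofReal (2 * Real.pi) ≠ 0 := by
        rw [Ne, ENNReal.ofReal_eq_zero, not_le]
        positivity
      rw [← lintegral_unitUniform_angle (fun φ =>
        F (-(radius u * Real.sin φ), -(radius u * Real.cos φ))),
        lintegral_const_mul' _ _ ENNReal.ofReal_ne_top, ← mul_assoc,
        ENNReal.inv_mul_cancel h2π ENNReal.ofReal_ne_top, one_mul]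
      refine lintegral_congr fun v => ?_
      rw [Real.sin_sub_pi, Real.cos_sub_pi, mul_neg, mul_neg, neg_neg, neg_neg]
      rfl
    simp only [hinner]
    rw [lintegral_unitUniform_radius (fun r => (ENNReal.ofReal (2 * Real.pi))⁻¹ *
      ∫⁻ φ in Set.Ioo (-Real.pi) Real.pi, F (-(r * Real.sin φ), -(r * Real.cos φ)))]
    refine setLIntegral_congr_fun measurableSet_Ioi fun r hr => ?_
    have hr' : (0 : ℝ) < r := hr
    simp only [polarCoord_symm_apply, smul_eq_mul]
    have hexp : ∀ φ : ℝ, (-(r * Real.sin φ)) ^ 2 + (-(r * Real.cos φ)) ^ 2 = r ^ 2 := by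
      intro φ
      linear_combination r ^ 2 * Real.sin_sq_add_cos_sq φ
    simp only [hexp]
    rw [lintegral_const_mul' _ _ ENNReal.ofReal_ne_top,
      lintegral_const_mul' _ _ ENNReal.ofReal_ne_top, ← mul_assoc, ← mul_assoc]
    congr 1
    rw [← ENNReal.ofReal_inv_of_pos (by positivity), ← ENNReal.ofReal_mul (by positivity),
      ← ENNReal.ofReal_mul (by positivity)]
    congr 1
    ring
  · refine Measurable.aemeasurable ?_
    have h1 : Measurable fun p : ℝ × ℝ => polarCoord.symm p := continuous_polarCoord_symm.measurable
    fun_prop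

end QBM

namespace QBM

/-! ## Midpoint sums of monotone functions -/

/-- The midpoint of the cell `[j/N, (j+1)/N)` which contains `u`. -/
noncomputable def cellMid (N : ℕ) (u : ℝ) : ℝ := ((⌊N * u⌋₊ : ℝ) + 1 / 2) / N

theorem measurable_cellMid (N : ℕ) : Measurable (cellMid N) := by
  unfold cellMid
  have : Measurable fun u : ℝ => (⌊N * u⌋₊ : ℝ) :=
    (measurable_from_nat (f := fun m : ℕ => (m : ℝ))).comp
      (Nat.measurable_floor.comp (measurable_const_mul (N : ℝ)))
  fun_prop

theorem cellMid_bounds {N : ℕ} (hN : 0 < N) {u : ℝ} (hu : 0 ≤ u) :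
    1 / (2 * N : ℝ) ≤ cellMid N u ∧ u - 1 / (2 * N : ℝ) ≤ cellMid N u ∧
      cellMid N u ≤ u + 1 / (2 * N : ℝ) := by
  have hN' : (0 : ℝ) < N := by exact_mod_cast hN
  have h1 : (⌊N * u⌋₊ : ℝ) ≤ N * u := Nat.floor_le (by positivity)
  have h2 : N * u < (⌊N * u⌋₊ : ℝ) + 1 := Nat.lt_floor_add_one _
  have h0 : (0 : ℝ) ≤ (⌊N * u⌋₊ : ℝ) := by positivity
  unfold cellMid
  have e : 1 / (2 * N : ℝ) = (1 / 2) / N := by field_simp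
  refine ⟨?_, ?_, ?_⟩
  · rw [e]
    gcongr
    linarith
  · rw [e, le_div_iff₀ hN', sub_mul, div_mul_cancel₀ _ hN'.ne']
    linarith
  · rw [e, div_le_iff₀ hN', add_mul, div_mul_cancel₀ _ hN'.ne']
    linarith

section Antitone

variable {φ : ℝ → ℝ} {N : ℕ}

theorem integrable_unitUniform_iff {f : ℝ → ℝ} :
    Integrable f unitUniform ↔ IntervalIntegrable f volume 0 1 := by
  rw [unitUniform, intervalIntegrable_iff_integrableOn_Ioo_of_le zero_le_one]
  rfl

theorem integral_unitUniform (f : ℝ → ℝ) : ∫ u, f u ∂unitUniform = ∫ u in (0 : ℝ)..1, f u := by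
  rw [unitUniform, intervalIntegral.integral_of_le zero_le_one, integral_Ioc_eq_integral_Ioo]

theorem ae_unitUniform_mem : ∀ᵐ u ∂unitUniform, u ∈ Set.Ioo (0 : ℝ) 1 :=
  ae_restrict_mem measurableSet_Ioo

theorem integrable_comp_cellMid (hN : 0 < N) (hφ : Measurable φ)
    (hanti : ∀ x y, 0 < x → x ≤ y → φ y ≤ φ x) (h0 : ∀ x, 0 < x → 0 ≤ φ x) :
    Integrable (fun u => φ (cellMid N u)) unitUniform := by
  have hN' : (0 : ℝ) < N := by exact_mod_cast hN
  refine Integrable.of_bound (hφ.comp (measurable_cellMid N)).aestronglyMeasurable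
    (φ (1 / (2 * N))) ?_
  filter_upwards [ae_unitUniform_mem] with u hu
  have h := cellMid_bounds hN hu.1.le
  have hpos : (0 : ℝ) < 1 / (2 * N) := by positivity
  rw [Real.norm_eq_abs, abs_of_nonneg (h0 _ (hpos.trans_le h.1))]
  exact hanti _ _ hpos h.1

/-- Let `h` be half a cell. Away from the first cell the midpoint lies between `u - h` and `u + h`,
so monotonicity bounds the integrand by `φ (u - h) - φ (u + h)`, and in the integral of this
difference only boundary terms survive. The first cell is estimated directly through `h * φ h ≤ ∫ φ`
over `[0, h]`. Everything left is an integral near `0`. Integrability beyond `1` is needed because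
the shifted interval ends at `1 + h`. -/
theorem integral_abs_sub_cellMid_le (hN : 2 ≤ N) (hφ : Measurable φ)
    (hanti : ∀ x y, 0 < x → x ≤ y → φ y ≤ φ x) (h0 : ∀ x, 0 < x → 0 ≤ φ x)
    (hint : ∀ b, 0 ≤ b → IntervalIntegrable φ volume 0 b) :
    ∫ u, |φ u - φ (cellMid N u)| ∂unitUniform ≤ 4 * ∫ u in (0 : ℝ)..2 / N, φ u := by
  have hN0 : 0 < N := by omega
  have hN' : (2 : ℝ) ≤ N := by exact_mod_cast hN
  set h : ℝ := 1 / (2 * N) with hh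
  have hh0 : 0 < h := by positivity
  have hh1 : h ≤ 1 / 4 := by
    rw [hh, div_le_div_iff₀ (by positivity) (by norm_num)]
    linarith
  have h4 : 2 / (N : ℝ) = 4 * h := by rw [hh]; field_simp; norm_num
  set F : ℝ → ℝ := fun x => ∫ u in (0 : ℝ)..x, φ u with hF
  have hFsub : ∀ a b, 0 ≤ a → 0 ≤ b → ∫ u in a..b, φ u = F b - F a := fun a b ha hb =>
    (intervalIntegral.integral_interval_sub_left (hint b hb) (hint a ha)).symm
  have hii : ∀ a b, 0 ≤ a → 0 ≤ b → IntervalIntegrable φ volume a b := fun a b ha hb =>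
    (hint a ha).symm.trans (hint b hb)
  have hFmono : ∀ a b, 0 ≤ a → a ≤ b → F a ≤ F b := by
    intro a b ha hab
    have : 0 ≤ ∫ u in a..b, φ u := by
      rw [intervalIntegral.integral_of_le hab]
      refine setIntegral_nonneg measurableSet_Ioc fun u hu => h0 u (ha.trans_lt hu.1)
    rw [hFsub a b ha (ha.trans hab)] at this
    linarith
  have hψ : IntervalIntegrable (fun u => |φ u - φ (cellMid N u)|) volume 0 1 := by
    rw [← integrable_unitUniform_iff]
    exact ((integrable_unitUniform_iff.2 (hint 1 zero_le_one)).sub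
      (integrable_comp_cellMid hN0 hφ hanti h0)).abs
  have hψ1 : IntervalIntegrable (fun u => |φ u - φ (cellMid N u)|) volume 0 (2 * h) :=
    hψ.mono_set (by
      rw [Set.uIcc_of_le (by linarith), Set.uIcc_of_le zero_le_one]
      exact Set.Icc_subset_Icc le_rfl (by linarith))
  have hψ2 : IntervalIntegrable (fun u => |φ u - φ (cellMid N u)|) volume (2 * h) 1 :=
    hψ.mono_set (by
      rw [Set.uIcc_of_le (by linarith), Set.uIcc_of_le zero_le_one]
      exact Set.Icc_subset_Icc (by linarith) le_rfl)
  have hfirst : ∫ u in (0 : ℝ)..2 * h, |φ u - φ (cellMid N u)| ≤ F (2 * h) + 2 * (h * φ h) := by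
    calc ∫ u in (0 : ℝ)..2 * h, |φ u - φ (cellMid N u)|
        ≤ ∫ u in (0 : ℝ)..2 * h, (φ u + φ h) := by
          refine intervalIntegral.integral_mono_on_of_le_Ioo (by linarith) hψ1
            ((hint _ (by linarith)).add intervalIntegrable_const) fun u hu => ?_
          have hb := cellMid_bounds hN0 hu.1.le
          have h1 := h0 u hu.1
          have h2 := h0 (cellMid N u) (hh0.trans_le hb.1)
          have h3 := hanti h (cellMid N u) hh0 hb.1
          rw [abs_le]
          constructor <;> linarith [h0 h hh0]
      _ = F (2 * h) + 2 * (h * φ h) := by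
          rw [intervalIntegral.integral_add (hint _ (by linarith)) intervalIntegrable_const,
            intervalIntegral.integral_const, smul_eq_mul]
          ring
  have hconst : h * φ h ≤ F h := by
    have : ∫ _ in (0 : ℝ)..h, φ h ≤ ∫ u in (0 : ℝ)..h, φ u :=
      intervalIntegral.integral_mono_on_of_le_Ioo hh0.le intervalIntegrable_const (hint h hh0.le)
        fun u hu => hanti u h hu.1 hu.2.le
    rwa [intervalIntegral.integral_const, smul_eq_mul, sub_zero] at this
  have hshift1 : IntervalIntegrable (fun u => φ (u - h)) volume (2 * h) 1 := by
    have := (hii h (1 - h) hh0.le (by linarith)).comp_sub_right h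
    rwa [show h + h = 2 * h by ring, sub_add_cancel] at this
  have hshift2 : IntervalIntegrable (fun u => φ (u + h)) volume (2 * h) 1 := by
    have := (hii (3 * h) (1 + h) (by linarith) (by linarith)).comp_add_right h
    rwa [show 3 * h - h = 2 * h by ring, add_sub_cancel_right] at this
  have hsecond : ∫ u in 2 * h..1, |φ u - φ (cellMid N u)|
      ≤ (F (1 - h) - F h) - (F (1 + h) - F (3 * h)) := by
    calc ∫ u in 2 * h..1, |φ u - φ (cellMid N u)|
        ≤ ∫ u in 2 * h..1, (φ (u - h) - φ (u + h)) := by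
          refine intervalIntegral.integral_mono_on_of_le_Ioo (by linarith) hψ2
            (hshift1.sub hshift2) fun u hu => ?_
          have hu0 : 0 < u := by linarith [hu.1]
          have hb := cellMid_bounds hN0 hu0.le
          have hc0 : 0 < cellMid N u := hh0.trans_le hb.1
          have h1 := hanti (u - h) u (by linarith [hu.1]) (by linarith)
          have h2 := hanti u (u + h) hu0 (by linarith)
          have h3 := hanti (u - h) (cellMid N u) (by linarith [hu.1]) hb.2.1
          have h4 := hanti (cellMid N u) (u + h) hc0 hb.2.2
          rw [abs_le]
          constructor <;> linarith
      _ = (F (1 - h) - F h) - (F (1 + h) - F (3 * h)) := by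
          rw [intervalIntegral.integral_sub hshift1 hshift2,
            intervalIntegral.integral_comp_sub_right (fun u => φ u) h,
            intervalIntegral.integral_comp_add_right (fun u => φ u) h,
            show 2 * h - h = h by ring, show 2 * h + h = 3 * h by ring,
            hFsub _ _ hh0.le (by linarith), hFsub _ _ (by linarith) (by linarith)]
  rw [integral_unitUniform, ← intervalIntegral.integral_add_adjacent_intervals hψ1 hψ2, h4]
  change _ ≤ 4 * F (4 * h)
  have m1 := hFmono (2 * h) (4 * h) (by linarith) (by linarith)
  have m2 := hFmono h (4 * h) (by linarith) (by linarith)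
  have m3 := hFmono (3 * h) (4 * h) (by linarith) (by linarith)
  have m4 := hFmono (1 - h) (1 + h) (by linarith) (by linarith)
  have m5 := hFmono 0 (4 * h) le_rfl (by linarith)
  have m6 : F 0 = 0 := intervalIntegral.integral_same
  have m7 := hFmono 0 h le_rfl hh0.le
  linarith

end Antitone

/-! ## The radius of the Box-Muller transform -/

theorem radius_nonneg (u : ℝ) : 0 ≤ radius u := Real.sqrt_nonneg _

theorem radius_anti {x y : ℝ} (hx : 0 < x) (hxy : x ≤ y) : radius y ≤ radius x :=
  Real.sqrt_le_sqrt (by have := Real.log_le_log hx hxy; linarith)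

/-- A logarithm is dominated by any power; for `u > 1` the radius is `0` since the root of a
negative number is `0`. The exponent `-1/2` leaves `-1/4` for the radius, hence the rate `N^(-3/4)`
of the bias. -/
theorem radius_sq_le {u : ℝ} (hu : 0 < u) : radius u ^ 2 ≤ 4 * u ^ (-(1 / 2) : ℝ) := by
  have hpos : 0 ≤ 4 * u ^ (-(1 / 2) : ℝ) := by positivity
  rcases le_total 0 (-2 * Real.log u) with h | h
  · rw [radius, Real.sq_sqrt h]
    have h1 := Real.log_le_rpow_div (x := u⁻¹) (by positivity) (ε := 1 / 2) (by norm_num)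
    rw [Real.log_inv, Real.inv_rpow hu.le, ← Real.rpow_neg hu.le] at h1
    linarith
  · rw [radius, Real.sqrt_eq_zero_of_nonpos h]
    simpa using hpos

theorem radius_le {u : ℝ} (hu : 0 < u) : radius u ≤ 2 * u ^ (-(1 / 4) : ℝ) := by
  refine (pow_le_pow_iff_left₀ (radius_nonneg u) (by positivity) two_ne_zero).1 ?_
  refine (radius_sq_le hu).trans (le_of_eq ?_)
  rw [mul_pow, ← Real.rpow_natCast (u ^ _), ← Real.rpow_mul hu.le]
  norm_num

theorem intervalIntegrable_of_le_rpow {φ : ℝ → ℝ} (hφ : Measurable φ) {c p : ℝ} (hp : -1 < p)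
    (h0 : ∀ u, 0 < u → 0 ≤ φ u) (h : ∀ u, 0 < u → φ u ≤ c * u ^ p) {b : ℝ} (hb : 0 ≤ b) :
    IntervalIntegrable φ volume 0 b := by
  refine ((intervalIntegral.intervalIntegrable_rpow' hp).const_mul c).mono_fun
    hφ.aestronglyMeasurable ?_
  rw [Set.uIoc_of_le hb]
  refine (ae_restrict_iff' measurableSet_Ioc).2 (Filter.Eventually.of_forall fun u hu => ?_)
  have := h u hu.1
  have h1 := h0 u hu.1
  simp only [Real.norm_eq_abs]
  rw [abs_of_nonneg h1]
  exact this.trans (le_abs_self _)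

theorem integral_le_of_le_rpow {φ : ℝ → ℝ} (hφ : Measurable φ) {c p : ℝ} (hp : -1 < p)
    (h0 : ∀ u, 0 < u → 0 ≤ φ u) (h : ∀ u, 0 < u → φ u ≤ c * u ^ p) {b : ℝ} (hb : 0 ≤ b) :
    ∫ u in (0 : ℝ)..b, φ u ≤ c * (b ^ (p + 1) / (p + 1)) := by
  have h1 : ∫ u in (0 : ℝ)..b, φ u ≤ ∫ u in (0 : ℝ)..b, c * u ^ p :=
    intervalIntegral.integral_mono_on_of_le_Ioo hb
      (intervalIntegrable_of_le_rpow hφ hp h0 h hb)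
      ((intervalIntegral.intervalIntegrable_rpow' hp).const_mul c) fun u hu => h u hu.1
  rwa [intervalIntegral.integral_const_mul, integral_rpow (Or.inl hp),
    Real.zero_rpow (by linarith), sub_zero] at h1

theorem intervalIntegrable_radius {b : ℝ} (hb : 0 ≤ b) : IntervalIntegrable radius volume 0 b :=
  intervalIntegrable_of_le_rpow measurable_radius (by norm_num) (fun u _ => radius_nonneg u)
    (fun _ hu => radius_le hu) hb

theorem intervalIntegrable_radius_sq {b : ℝ} (hb : 0 ≤ b) :
    IntervalIntegrable (fun u => radius u ^ 2) volume 0 b :=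
  intervalIntegrable_of_le_rpow (measurable_radius.pow_const 2) (by norm_num)
    (fun u _ => sq_nonneg _) (fun _ hu => radius_sq_le hu) hb

theorem integrable_radius : Integrable radius unitUniform :=
  integrable_unitUniform_iff.2 (intervalIntegrable_radius zero_le_one)

theorem integrable_radius_sq : Integrable (fun u => radius u ^ 2) unitUniform :=
  integrable_unitUniform_iff.2 (intervalIntegrable_radius_sq zero_le_one)

section Bounds

variable {N : ℕ}

theorem integrable_radius_cellMid (hN : 0 < N) :
    Integrable (fun u => radius (cellMid N u)) unitUniform :=
  integrable_comp_cellMid hN measurable_radius (fun _ _ hx hxy => radius_anti hx hxy)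
    fun u _ => radius_nonneg u

theorem integrable_radius_sq_cellMid (hN : 0 < N) :
    Integrable (fun u => radius (cellMid N u) ^ 2) unitUniform :=
  integrable_comp_cellMid (φ := fun u => radius u ^ 2) hN (measurable_radius.pow_const 2)
    (fun _ _ hx hxy => pow_le_pow_left₀ (radius_nonneg _) (radius_anti hx hxy) 2)
    fun _ _ => sq_nonneg _

theorem radius_cellMid_le (hN : 0 < N) {u : ℝ} (hu : 0 ≤ u) :
    radius (cellMid N u) ≤ 2 * (2 * N : ℝ) ^ (1 / 4 : ℝ) := by
  have hN' : (0 : ℝ) < N := by exact_mod_cast hN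
  refine (radius_anti (by positivity) (cellMid_bounds hN hu).1).trans
    ((radius_le (by positivity)).trans (le_of_eq ?_))
  rw [one_div, Real.inv_rpow (by positivity), Real.rpow_neg (by positivity), inv_inv]

theorem integral_abs_radius_sub_le (hN : 2 ≤ N) :
    ∫ u, |radius u - radius (cellMid N u)| ∂unitUniform
      ≤ 32 / 3 * (2 / N : ℝ) ^ (3 / 4 : ℝ) := by
  refine (integral_abs_sub_cellMid_le hN measurable_radius (fun _ _ hx hxy => radius_anti hx hxy)
    (fun u _ => radius_nonneg u) fun _ hb => intervalIntegrable_radius hb).trans ?_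
  have := integral_le_of_le_rpow measurable_radius (p := -(1 / 4)) (by norm_num)
    (fun u _ => radius_nonneg u) (fun _ hu => radius_le hu) (b := 2 / N) (by positivity)
  norm_num at this ⊢
  linarith

theorem integral_abs_radius_sq_sub_le (hN : 2 ≤ N) :
    ∫ u, |radius u ^ 2 - radius (cellMid N u) ^ 2| ∂unitUniform
      ≤ 32 * (2 / N : ℝ) ^ (1 / 2 : ℝ) := by
  refine (integral_abs_sub_cellMid_le (φ := fun u => radius u ^ 2) hN
    (measurable_radius.pow_const 2)
    (fun _ _ hx hxy => pow_le_pow_left₀ (radius_nonneg _) (radius_anti hx hxy) 2)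
    (fun _ _ => sq_nonneg _) fun _ hb => intervalIntegrable_radius_sq hb).trans ?_
  have := integral_le_of_le_rpow (measurable_radius.pow_const 2) (p := -(1 / 2)) (by norm_num)
    (fun u _ => sq_nonneg _) (fun _ hu => radius_sq_le hu) (b := 2 / N) (by positivity)
  norm_num at this ⊢
  linarith

end Bounds

/-! ## Step functions on the unit square -/

theorem integral_floor_eq {N j : ℕ} (hj : j < N) :
    ∫ u, (if ⌊N * u⌋₊ = j then (1 : ℝ) else 0) ∂unitUniform = 1 / N := by
  have hN' : (0 : ℝ) < N := by exact_mod_cast (Nat.zero_le j).trans_lt hj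
  have hj' : (j : ℝ) + 1 ≤ N := by exact_mod_cast hj
  have h1 : ∫ u, (if ⌊N * u⌋₊ = j then (1 : ℝ) else 0) ∂unitUniform
      = ∫ u, (Set.Ico ((j : ℝ) / N) ((j + 1) / N)).indicator (fun _ => (1 : ℝ)) u
        ∂unitUniform := by
    refine integral_congr_ae ?_
    filter_upwards [ae_unitUniform_mem] with u hu
    have hiff : ⌊N * u⌋₊ = j ↔ u ∈ Set.Ico ((j : ℝ) / N) ((j + 1) / N) := by
      rw [Nat.floor_eq_iff (by have := hu.1; positivity), Set.mem_Ico, div_le_iff₀ hN',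
        lt_div_iff₀ hN', mul_comm]
    by_cases h : ⌊N * u⌋₊ = j
    · rw [if_pos h, Set.indicator_of_mem (hiff.1 h)]
    · rw [if_neg h, Set.indicator_of_notMem (fun h' => h (hiff.2 h'))]
  have hsub : Set.Ico ((j : ℝ) / N) ((j + 1) / N) ⊆ Set.Ico 0 1 :=
    Set.Ico_subset_Ico (by positivity) ((div_le_one hN').2 hj')
  rw [h1, integral_indicator measurableSet_Ico, setIntegral_const, smul_eq_mul, mul_one,
    unitUniform, restrict_Ioo_eq_restrict_Ico, Measure.real,
    Measure.restrict_apply measurableSet_Ico, Set.inter_eq_left.2 hsub, Real.volume_Ico,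
    ENNReal.toReal_ofReal (sub_nonneg.2 (by gcongr; linarith))]
  ring

theorem integrable_floor (N j : ℕ) :
    Integrable (fun u : ℝ => if ⌊N * u⌋₊ = j then (1 : ℝ) else 0) unitUniform := by
  refine Integrable.of_bound (C := 1) ?_ (Filter.Eventually.of_forall fun u => ?_)
  · exact (Measurable.comp (g := fun m : ℕ => if m = j then (1 : ℝ) else 0) measurable_from_nat
      (Nat.measurable_floor.comp (measurable_const_mul (N : ℝ)))).aestronglyMeasurable
  · split_ifs <;> simp

theorem ae_unitSquare_mem :
    ∀ᵐ p ∂unitUniform.prod unitUniform, p.1 ∈ Set.Ioo (0 : ℝ) 1 ∧ p.2 ∈ Set.Ioo (0 : ℝ) 1 := by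
  have h1 : ∀ᵐ p ∂unitUniform.prod unitUniform, p.1 ∈ Set.Ioo (0 : ℝ) 1 :=
    Measure.quasiMeasurePreserving_fst.ae ae_unitUniform_mem
  have h2 : ∀ᵐ p ∂unitUniform.prod unitUniform, p.2 ∈ Set.Ioo (0 : ℝ) 1 :=
    Measure.quasiMeasurePreserving_snd.ae ae_unitUniform_mem
  filter_upwards [h1, h2] with p hp1 hp2 using ⟨hp1, hp2⟩

theorem step_ae_eq {N : ℕ} (hN : 0 < N) (F : ℕ → ℕ → ℝ) :
    (fun p : ℝ × ℝ => F ⌊N * p.1⌋₊ ⌊N * p.2⌋₊) =ᵐ[unitUniform.prod unitUniform]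
      fun p => ∑ j ∈ Finset.range N, ∑ k ∈ Finset.range N,
        F j k * ((if ⌊N * p.1⌋₊ = j then (1 : ℝ) else 0) *
          (if ⌊N * p.2⌋₊ = k then (1 : ℝ) else 0)) := by
  have hN' : (0 : ℝ) < N := by exact_mod_cast hN
  have hfloor : ∀ u ∈ Set.Ioo (0 : ℝ) 1, ⌊N * u⌋₊ ∈ Finset.range N := by
    intro u hu
    rw [Finset.mem_range, Nat.floor_lt (by have := hu.1; positivity)]
    nlinarith [hu.2]
  filter_upwards [ae_unitSquare_mem] with p hp
  rw [Finset.sum_eq_single ⌊N * p.1⌋₊, Finset.sum_eq_single ⌊N * p.2⌋₊]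
  · simp
  · intro k _ hk
    rw [if_neg (Ne.symm hk), mul_zero, mul_zero]
  · intro hk
    exact absurd (hfloor p.2 hp.2) hk
  · intro j _ hj
    simp [Ne.symm hj]
  · intro hj
    exact absurd (hfloor p.1 hp.1) hj

theorem integrable_step {N : ℕ} (hN : 0 < N) (F : ℕ → ℕ → ℝ) :
    Integrable (fun p : ℝ × ℝ => F ⌊N * p.1⌋₊ ⌊N * p.2⌋₊) (unitUniform.prod unitUniform) := by
  refine Integrable.congr ?_ (step_ae_eq hN F).symm
  refine integrable_finsetSum _ fun j _ => integrable_finsetSum _ fun k _ => ?_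
  exact ((integrable_floor N j).mul_prod (integrable_floor N k)).const_mul _

theorem integral_step {N : ℕ} (hN : 0 < N) (F : ℕ → ℕ → ℝ) :
    ∫ p, F ⌊N * p.1⌋₊ ⌊N * p.2⌋₊ ∂unitUniform.prod unitUniform
      = ∑ j ∈ Finset.range N, ∑ k ∈ Finset.range N, (1 / N : ℝ) ^ 2 * F j k := by
  have hint : ∀ j k : ℕ, Integrable (fun p : ℝ × ℝ =>
      F j k * ((if ⌊N * p.1⌋₊ = j then (1 : ℝ) else 0) *
          (if ⌊N * p.2⌋₊ = k then (1 : ℝ) else 0))) (unitUniform.prod unitUniform) := fun j k =>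
    ((integrable_floor N j).mul_prod (integrable_floor N k)).const_mul _
  rw [integral_congr_ae (step_ae_eq hN F),
    integral_finsetSum _ fun j _ => integrable_finsetSum _ fun k _ => hint j k]
  refine Finset.sum_congr rfl fun j hj => ?_
  rw [integral_finsetSum _ fun k _ => hint j k]
  refine Finset.sum_congr rfl fun k hk => ?_
  rw [integral_const_mul, integral_prod_mul (fun u : ℝ => if ⌊N * u⌋₊ = j then (1 : ℝ) else 0)
    (fun u : ℝ => if ⌊N * u⌋₊ = k then (1 : ℝ) else 0),
    integral_floor_eq (Finset.mem_range.1 hj), integral_floor_eq (Finset.mem_range.1 hk)]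
  ring

/-! ## The grid of midpoints -/

/-- The truncation points are chosen for this: the spacing `(1 - 1/N) / (N - 1)` equals `1 / N`, and
the first point is the midpoint of the first cell. -/
theorem gridU_midpoint {n : ℕ} (hn : 1 ≤ n) (j : ℕ) :
    gridU n (1 / (2 * 2 ^ n)) (1 - 1 / (2 * 2 ^ n)) j = ((j : ℝ) + 1 / 2) / ((2 ^ n : ℕ) : ℝ) := by
  have h2 : (2 : ℝ) ≤ 2 ^ n := le_self_pow₀ (by norm_num) (by omega)
  have h1 : (2 : ℝ) ^ n - 1 ≠ 0 := by linarith
  rw [gridU]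
  push_cast
  field_simp
  ring

/-- Each of the `N²` cells has area `1 / N²`, the weight of its grid point, so the mean over the
grid is the integral of a function constant on cells. -/
theorem gridMean_midpoint {n : ℕ} (hn : 1 ≤ n) (θ : ℝ → ℝ → ℝ) (φ : ℝ → ℝ) :
    gridMean n (1 / (2 * 2 ^ n)) (1 - 1 / (2 * 2 ^ n)) θ φ =
      ∫ p, φ (θ (boxMuller₁ (cellMid (2 ^ n) p.1) (gridV n ⌊(2 ^ n : ℕ) * p.2⌋₊))
        (boxMuller₂ (cellMid (2 ^ n) p.1) (gridV n ⌊(2 ^ n : ℕ) * p.2⌋₊)))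
        ∂unitUniform.prod unitUniform := by
  set G : ℕ → ℕ → ℝ := fun j k =>
    φ (θ (boxMuller₁ (((j : ℝ) + 1 / 2) / ((2 ^ n : ℕ) : ℝ)) (gridV n k))
      (boxMuller₂ (((j : ℝ) + 1 / 2) / ((2 ^ n : ℕ) : ℝ)) (gridV n k))) with hG
  have h := integral_step (N := 2 ^ n) (by positivity) G
  refine Eq.trans ?_ h.symm
  rw [gridMean, Fintype.sum_prod_type]
  simp only [gridValue, gridU_midpoint hn]
  have key : ∀ f : ℕ → ℝ, ∑ x : Qubits n, f x.toNat = ∑ j ∈ Finset.range (2 ^ n), f j := by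
    intro f
    rw [← Fin.sum_univ_eq_sum_range]
    exact Fintype.sum_equiv finFunctionFinEquiv _ _ fun x => rfl
  rw [← key (fun j => ∑ k ∈ Finset.range (2 ^ n), (1 / ((2 ^ n : ℕ) : ℝ)) ^ 2 * G j k)]
  refine Finset.sum_congr rfl fun x _ => ?_
  rw [← key (fun k => (1 / ((2 ^ n : ℕ) : ℝ)) ^ 2 * G x.toNat k)]
  refine Finset.sum_congr rfl fun y _ => ?_
  rw [one_div_pow, hG]
  push_cast
  rfl

/-- The point `k / (N - 1)` lies between `k / N` and `(k + 1) / N` because `k ≤ N - 1`; it therefore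
shares the closed cell of `v`, although this grid includes both endpoints `0` and `1`. -/
theorem abs_sub_gridV_le {n : ℕ} (hn : 1 ≤ n) {v : ℝ} (hv : v ∈ Set.Ioo (0 : ℝ) 1) :
    |v - gridV n ⌊(2 ^ n : ℕ) * v⌋₊| ≤ 1 / ((2 ^ n : ℕ) : ℝ) := by
  have h2 : (2 : ℝ) ≤ 2 ^ n := le_self_pow₀ (by norm_num) (by omega)
  push_cast
  set M : ℝ := 2 ^ n with hM
  set k := ⌊M * v⌋₊ with hk
  have h0 : 0 ≤ M * v := by have := hv.1; positivity
  have hk1 : (k : ℝ) ≤ M * v := Nat.floor_le h0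
  have hk2 : M * v < k + 1 := Nat.lt_floor_add_one _
  have hk3 : (k : ℝ) ≤ M - 1 := by
    have h3 : k < 2 ^ n := by
      rw [hk, Nat.floor_lt h0]
      push_cast
      rw [← hM]
      nlinarith [hv.2]
    have h4 : k + 1 ≤ 2 ^ n := h3
    have h5 : (k : ℝ) + 1 ≤ M := by rw [hM]; exact_mod_cast h4
    linarith
  have hM1 : 0 < M - 1 := by linarith
  have hM0 : 0 < M := by linarith
  have hlow : (k : ℝ) / M ≤ gridV n k := by
    rw [gridV, ← hM]
    gcongr
    linarith
  have hup : gridV n k ≤ ((k : ℝ) + 1) / M := by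
    rw [gridV, ← hM, div_le_div_iff₀ hM1 hM0]
    nlinarith
  have hv1 : (k : ℝ) / M ≤ v := by rw [div_le_iff₀ hM0]; linarith
  have hv2 : v ≤ ((k : ℝ) + 1) / M := by rw [le_div_iff₀ hM0]; linarith
  have e : ((k : ℝ) + 1) / M = k / M + 1 / M := add_div _ _ _
  rw [abs_le]
  constructor <;> linarith

end QBM

namespace QBM

/-! ## Discretization errors for Lipschitz functions -/

/-- `θ` is Lipschitz with constant `K` for the `ℓ¹` distance. -/
def LipschitzBound (θ : ℝ → ℝ → ℝ) (K : ℝ) : Prop :=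
  ∀ x y x' y', |θ x y - θ x' y'| ≤ K * (|x - x'| + |y - y'|)

theorem BoundedDerivatives.lipschitzBound {θ : ℝ → ℝ → ℝ} {D₁ D₂ : ℝ}
    (h : BoundedDerivatives θ D₁ D₂) : LipschitzBound θ D₁ := by
  intro x y x' y'
  have h1 : |θ x y - θ x' y| ≤ D₁ * |x - x'| := by
    have := Convex.norm_image_sub_le_of_norm_deriv_le (f := fun s => θ s y) (C := D₁)
      (s := Set.univ) (x := x') (y := x) (fun s _ => (h.diff₁ y).differentiableAt)
      (fun s _ => (le_add_of_nonneg_right (abs_nonneg _)).trans (h.bound₁ s y)) convex_univ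
      trivial trivial
    simpa using this
  have h2 : |θ x' y - θ x' y'| ≤ D₁ * |y - y'| := by
    have := Convex.norm_image_sub_le_of_norm_deriv_le (f := fun s => θ x' s) (C := D₁)
      (s := Set.univ) (x := y') (y := y) (fun s _ => (h.diff₂ x').differentiableAt)
      (fun s _ => (le_add_of_nonneg_left (abs_nonneg _)).trans (h.bound₁ x' s)) convex_univ
      trivial trivial
    simpa using this
  calc |θ x y - θ x' y'| ≤ |θ x y - θ x' y| + |θ x' y - θ x' y'| := abs_sub_le _ _ _
    _ ≤ D₁ * |x - x'| + D₁ * |y - y'| := add_le_add h1 h2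
    _ = _ := by ring

/-- The angular difference is multiplied by the radius at `u'`, which will be the grid point: there
the radius is bounded by a power of `N`, whereas at `u` it is not bounded at all. -/
theorem abs_radius_mul_sub_le (u u' a b a' b' : ℝ) (ha : |a| ≤ 1) (hab : |a - a'| ≤ |b - b'|) :
    |radius u * a - radius u' * a'| ≤ |radius u - radius u'| + radius u' * |b - b'| := by
  have e : radius u * a - radius u' * a' = (radius u - radius u') * a + radius u' * (a - a') := by
    ring
  rw [e]
  refine (abs_add_le _ _).trans (add_le_add ?_ ?_)
  · rw [abs_mul]
    exact mul_le_of_le_one_right (abs_nonneg _) ha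
  · rw [abs_mul, abs_of_nonneg (radius_nonneg u')]
    exact mul_le_mul_of_nonneg_left hab (radius_nonneg u')

section Lipschitz

variable {τ : ℝ → ℝ → ℝ} {K : ℝ}

theorem LipschitzBound.abs_boxMuller_sub_le (hτ : LipschitzBound τ K) (hK : 0 ≤ K)
    (u u' v v' : ℝ) :
    |τ (boxMuller₁ u v) (boxMuller₂ u v) - τ (boxMuller₁ u' v') (boxMuller₂ u' v')|
      ≤ 2 * K * (|radius u - radius u'| + 2 * Real.pi * radius u' * |v - v'|) := by
  have hb : |2 * Real.pi * v - 2 * Real.pi * v'| = 2 * Real.pi * |v - v'| := by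
    rw [← mul_sub, abs_mul, abs_of_pos (by positivity)]
  have h1 := abs_radius_mul_sub_le u u' _ _ _ _ (Real.abs_sin_le_one (2 * Real.pi * v))
    (Real.abs_sin_sub_sin_le (2 * Real.pi * v) (2 * Real.pi * v'))
  have h2 := abs_radius_mul_sub_le u u' _ _ _ _ (Real.abs_cos_le_one (2 * Real.pi * v))
    (Real.abs_cos_sub_cos_le (2 * Real.pi * v) (2 * Real.pi * v'))
  rw [hb, ← boxMuller₁_eq, ← boxMuller₁_eq] at h1
  rw [hb, ← boxMuller₂_eq, ← boxMuller₂_eq] at h2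
  refine (hτ _ _ _ _).trans ?_
  calc K * (|boxMuller₁ u v - boxMuller₁ u' v'| + |boxMuller₂ u v - boxMuller₂ u' v'|)
      ≤ K * ((|radius u - radius u'| + radius u' * (2 * Real.pi * |v - v'|))
        + (|radius u - radius u'| + radius u' * (2 * Real.pi * |v - v'|))) := by gcongr
    _ = _ := by ring

theorem LipschitzBound.measurable (hτ : LipschitzBound τ K) (hK : 0 ≤ K) :
    Measurable fun z : ℝ × ℝ => τ z.1 z.2 := by
  have : LipschitzWith (Real.toNNReal (2 * K)) fun z : ℝ × ℝ => τ z.1 z.2 := by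
    refine LipschitzWith.of_dist_le_mul fun z w => ?_
    rw [Real.coe_toNNReal _ (by positivity), Real.dist_eq]
    refine (hτ _ _ _ _).trans ?_
    have h1 : |z.1 - w.1| ≤ dist z w := by
      rw [Prod.dist_eq, ← Real.dist_eq]; exact le_max_left _ _
    have h2 : |z.2 - w.2| ≤ dist z w := by
      rw [Prod.dist_eq, ← Real.dist_eq]; exact le_max_right _ _
    nlinarith
  exact this.continuous.measurable

/-- A Lipschitz function grows at most linearly in the radius, and the radius is square integrable.
-/
theorem LipschitzBound.integrable_sq_boxMuller (hτ : LipschitzBound τ K) (hK : 0 ≤ K) (c : ℝ) :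
    Integrable (fun p : ℝ × ℝ => (τ (boxMuller₁ p.1 p.2) (boxMuller₂ p.1 p.2) - c) ^ 2)
      (unitUniform.prod unitUniform) := by
  have hbound : Integrable (fun p : ℝ × ℝ => 2 * (τ 0 0 - c) ^ 2 + 8 * K ^ 2 * radius p.1 ^ 2)
      (unitUniform.prod unitUniform) :=
    (integrable_const _).add ((integrable_radius_sq.comp_fst unitUniform).const_mul _)
  refine hbound.mono' ((((hτ.measurable hK).comp measurable_boxMuller).sub_const
    c).pow_const 2).aestronglyMeasurable (Filter.Eventually.of_forall fun p => ?_)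
  rw [Real.norm_eq_abs, abs_of_nonneg (sq_nonneg _)]
  have h1 := hτ (boxMuller₁ p.1 p.2) (boxMuller₂ p.1 p.2) 0 0
  have h2 : |boxMuller₁ p.1 p.2| ≤ radius p.1 := by
    rw [boxMuller₁_eq, abs_mul, abs_of_nonneg (radius_nonneg _)]
    exact mul_le_of_le_one_right (radius_nonneg _) (Real.abs_sin_le_one _)
  have h3 : |boxMuller₂ p.1 p.2| ≤ radius p.1 := by
    rw [boxMuller₂_eq, abs_mul, abs_of_nonneg (radius_nonneg _)]
    exact mul_le_of_le_one_right (radius_nonneg _) (Real.abs_cos_le_one _)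
  rw [sub_zero, sub_zero] at h1
  have h4 : |τ (boxMuller₁ p.1 p.2) (boxMuller₂ p.1 p.2) - τ 0 0| ≤ 2 * K * radius p.1 := by
    nlinarith
  have h5 : (τ (boxMuller₁ p.1 p.2) (boxMuller₂ p.1 p.2) - τ 0 0) ^ 2 ≤ (2 * K * radius p.1) ^ 2 :=
    sq_le_sq.2 (h4.trans (le_abs_self _))
  nlinarith [sq_nonneg ((τ (boxMuller₁ p.1 p.2) (boxMuller₂ p.1 p.2) - τ 0 0) - (τ 0 0 - c))]

theorem LipschitzBound.integrable_boxMuller (hτ : LipschitzBound τ K) (hK : 0 ≤ K) :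
    Integrable (fun p : ℝ × ℝ => τ (boxMuller₁ p.1 p.2) (boxMuller₂ p.1 p.2))
      (unitUniform.prod unitUniform) := by
  have h := hτ.integrable_sq_boxMuller hK 0
  simp only [sub_zero] at h
  have hm : AEStronglyMeasurable
      (fun p : ℝ × ℝ => τ (boxMuller₁ p.1 p.2) (boxMuller₂ p.1 p.2))
      (unitUniform.prod unitUniform) :=
    ((hτ.measurable hK).comp measurable_boxMuller).aestronglyMeasurable
  exact ((memLp_two_iff_integrable_sq hm).2 h).integrable one_le_two

theorem integral_normalPair {f : ℝ × ℝ → ℝ} (hf : Measurable f) :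
    ∫ z, f z ∂normalPair
      = ∫ p : ℝ × ℝ, f (boxMuller₁ p.1 p.2, boxMuller₂ p.1 p.2)
        ∂unitUniform.prod unitUniform := by
  rw [← map_boxMuller,
    integral_map measurable_boxMuller.aemeasurable hf.aestronglyMeasurable]
  rfl

/-- The value of `τ` at the grid point which represents the cell of `p`. -/
noncomputable def stepValue (n : ℕ) (τ : ℝ → ℝ → ℝ) (p : ℝ × ℝ) : ℝ :=
  τ (boxMuller₁ (cellMid (2 ^ n) p.1) (gridV n ⌊((2 ^ n : ℕ) : ℝ) * p.2⌋₊))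
    (boxMuller₂ (cellMid (2 ^ n) p.1) (gridV n ⌊((2 ^ n : ℕ) : ℝ) * p.2⌋₊))

theorem integrable_comp_stepValue (n : ℕ) (τ : ℝ → ℝ → ℝ) (φ : ℝ → ℝ) :
    Integrable (fun p => φ (stepValue n τ p)) (unitUniform.prod unitUniform) :=
  integrable_step (N := 2 ^ n) (by positivity) fun j k =>
    φ (τ (boxMuller₁ (((j : ℝ) + 1 / 2) / ((2 ^ n : ℕ) : ℝ)) (gridV n k))
      (boxMuller₂ (((j : ℝ) + 1 / 2) / ((2 ^ n : ℕ) : ℝ)) (gridV n k)))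

/-- An upper bound for the distance between the grid points with the same `u` in one cell. -/
noncomputable def angleError (N : ℝ) : ℝ := 2 * Real.pi * (2 * (2 * N) ^ (1 / 4 : ℝ)) * (1 / N)

theorem angleError_nonneg {N : ℝ} (hN : 0 ≤ N) : 0 ≤ angleError N := by
  unfold angleError
  positivity

theorem LipschitzBound.ae_abs_sub_stepValue_le (hτ : LipschitzBound τ K) (hK : 0 ≤ K) {n : ℕ}
    (hn : 1 ≤ n) :
    ∀ᵐ p ∂unitUniform.prod unitUniform,
      |τ (boxMuller₁ p.1 p.2) (boxMuller₂ p.1 p.2) - stepValue n τ p|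
        ≤ 2 * K * (|radius p.1 - radius (cellMid (2 ^ n) p.1)| + angleError ((2 ^ n : ℕ) : ℝ)) := by
  filter_upwards [ae_unitSquare_mem] with p hp
  refine (hτ.abs_boxMuller_sub_le hK _ _ _ _).trans ?_
  have h1 := abs_sub_gridV_le hn hp.2
  have h2 := radius_cellMid_le (N := 2 ^ n) (by positivity) hp.1.1.le
  have h3 := radius_nonneg (cellMid (2 ^ n) p.1)
  unfold angleError
  gcongr

theorem LipschitzBound.abs_integral_sub_stepValue_le (hτ : LipschitzBound τ K) (hK : 0 ≤ K)
    {n : ℕ} (hn : 1 ≤ n) :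
    |∫ z, τ z.1 z.2 ∂normalPair - ∫ p, stepValue n τ p ∂unitUniform.prod unitUniform|
      ≤ 2 * K * (32 / 3 * (2 / ((2 ^ n : ℕ) : ℝ)) ^ (3 / 4 : ℝ)
        + angleError ((2 ^ n : ℕ) : ℝ)) := by
  have hN : 2 ≤ 2 ^ n := le_self_pow₀ (by norm_num) (by omega)
  have hrad : Integrable (fun u => |radius u - radius (cellMid (2 ^ n) u)|) unitUniform :=
    (integrable_radius.sub (integrable_radius_cellMid (by positivity))).abs
  have hstep : Integrable (fun p => stepValue n τ p) (unitUniform.prod unitUniform) :=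
    integrable_comp_stepValue n τ id
  rw [integral_normalPair (hτ.measurable hK), ← integral_sub (hτ.integrable_boxMuller hK) hstep]
  refine abs_integral_le_integral_abs.trans ?_
  calc _ ≤ ∫ p : ℝ × ℝ, 2 * K * (|radius p.1 - radius (cellMid (2 ^ n) p.1)|
          + angleError ((2 ^ n : ℕ) : ℝ)) ∂unitUniform.prod unitUniform :=
        integral_mono_ae
          ((hτ.integrable_boxMuller hK).sub hstep).abs
          (((hrad.comp_fst unitUniform).add (integrable_const _)).const_mul _)
          (hτ.ae_abs_sub_stepValue_le hK hn)
    _ = 2 * K * (∫ u, |radius u - radius (cellMid (2 ^ n) u)| ∂unitUniform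
          + angleError ((2 ^ n : ℕ) : ℝ)) := by
        rw [integral_const_mul, integral_add (hrad.comp_fst unitUniform) (integrable_const _),
          integral_fun_fst (fun u => |radius u - radius (cellMid (2 ^ n) u)|)]
        simp
    _ ≤ _ := by
        gcongr
        exact integral_abs_radius_sub_le hN

/-- The square about `μ` is at most twice the true square plus twice the squared discretization
error. Since `|r - r'|² ≤ |r² - r'²|` for nonnegative radii, the latter reduces to the rounding
error of the monotone function `radius ^ 2`. -/
theorem LipschitzBound.integral_sq_stepValue_le (hτ : LipschitzBound τ K) (hK : 0 ≤ K)
    {n : ℕ} (hn : 1 ≤ n) (μ : ℝ) :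
    ∫ p, (stepValue n τ p - μ) ^ 2 ∂unitUniform.prod unitUniform
      ≤ 2 * ∫ z, (τ z.1 z.2 - μ) ^ 2 ∂normalPair
        + 16 * K ^ 2 * (32 * (2 / ((2 ^ n : ℕ) : ℝ)) ^ (1 / 2 : ℝ)
          + angleError ((2 ^ n : ℕ) : ℝ) ^ 2) := by
  have hN : 2 ≤ 2 ^ n := le_self_pow₀ (by norm_num) (by omega)
  have hrad : Integrable (fun u => |radius u ^ 2 - radius (cellMid (2 ^ n) u) ^ 2|) unitUniform :=
    (integrable_radius_sq.sub (integrable_radius_sq_cellMid (by positivity))).abs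
  rw [integral_normalPair (((hτ.measurable hK).sub_const μ).pow_const 2)]
  have hint1 := (hτ.integrable_sq_boxMuller hK μ).const_mul 2
  have hint2 : Integrable (fun p : ℝ × ℝ => 16 * K ^ 2 *
      (|radius p.1 ^ 2 - radius (cellMid (2 ^ n) p.1) ^ 2| + angleError ((2 ^ n : ℕ) : ℝ) ^ 2))
      (unitUniform.prod unitUniform) :=
    ((hrad.comp_fst unitUniform).add (integrable_const _)).const_mul _
  calc _ ≤ ∫ p : ℝ × ℝ, (2 * (τ (boxMuller₁ p.1 p.2) (boxMuller₂ p.1 p.2) - μ) ^ 2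
          + 16 * K ^ 2 * (|radius p.1 ^ 2 - radius (cellMid (2 ^ n) p.1) ^ 2|
            + angleError ((2 ^ n : ℕ) : ℝ) ^ 2)) ∂unitUniform.prod unitUniform := by
        refine integral_mono_ae (integrable_comp_stepValue n τ fun y => (y - μ) ^ 2)
          (hint1.add hint2) ?_
        filter_upwards [hτ.ae_abs_sub_stepValue_le hK hn] with p hp
        set h := τ (boxMuller₁ p.1 p.2) (boxMuller₂ p.1 p.2)
        set H := stepValue n τ p
        set r := radius p.1 with hr
        set r' := radius (cellMid (2 ^ n) p.1) with hr'
        set a := angleError ((2 ^ n : ℕ) : ℝ) with ha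
        have hr0 : 0 ≤ r := radius_nonneg _
        have hr'0 : 0 ≤ r' := radius_nonneg _
        have h1 : |r - r'| ^ 2 ≤ |r ^ 2 - r' ^ 2| := by
          rw [show r ^ 2 - r' ^ 2 = (r - r') * (r + r') by ring, abs_mul, sq]
          refine mul_le_mul_of_nonneg_left ?_ (abs_nonneg _)
          rw [abs_of_nonneg (add_nonneg hr0 hr'0), abs_le]
          constructor <;> linarith
        have h2 : (h - H) ^ 2 ≤ (2 * K * (|r - r'| + a)) ^ 2 :=
          sq_le_sq.2 (hp.trans (le_abs_self _))
        have h3 : (|r - r'| + a) ^ 2 ≤ 2 * (|r ^ 2 - r' ^ 2| + a ^ 2) := by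
          nlinarith [sq_nonneg (|r - r'| - a)]
        have h4 : (h - H) ^ 2 ≤ 8 * K ^ 2 * (|r ^ 2 - r' ^ 2| + a ^ 2) := by
          nlinarith [mul_le_mul_of_nonneg_left h3 (by positivity : 0 ≤ 4 * K ^ 2)]
        change (H - μ) ^ 2 ≤ _
        nlinarith [sq_nonneg ((h - μ) + (h - H))]
    _ = 2 * ∫ p : ℝ × ℝ, (τ (boxMuller₁ p.1 p.2) (boxMuller₂ p.1 p.2) - μ) ^ 2
          ∂unitUniform.prod unitUniform
        + 16 * K ^ 2 * (∫ u, |radius u ^ 2 - radius (cellMid (2 ^ n) u) ^ 2| ∂unitUniform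
          + angleError ((2 ^ n : ℕ) : ℝ) ^ 2) := by
        rw [integral_add hint1 hint2, integral_const_mul, integral_const_mul,
          integral_add (hrad.comp_fst unitUniform) (integrable_const _),
          integral_fun_fst (fun u => |radius u ^ 2 - radius (cellMid (2 ^ n) u) ^ 2|)]
        simp
    _ ≤ _ := by
        gcongr
        exact integral_abs_radius_sq_sub_le hN

end Lipschitz

/-! ## Numerical bounds for the discretization errors -/

section Numeric

variable {s : ℝ}

/-- Writing the grid size as `s ^ 4` turns the fractional powers of the error bounds into integer
powers of `s`. -/
theorem two_div_rpow_le (hs : 0 < s) {p : ℝ} (hp1 : p ≤ 1) (m : ℕ)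
    (hm : 4 * p = m) : (2 / s ^ 4) ^ p ≤ 2 / s ^ m := by
  rw [Real.div_rpow (by norm_num) (by positivity), ← Real.rpow_natCast s 4, ← Real.rpow_mul hs.le,
    show ((4 : ℕ) : ℝ) * p = m by exact_mod_cast hm, Real.rpow_natCast]
  gcongr
  calc (2 : ℝ) ^ p ≤ 2 ^ (1 : ℝ) := Real.rpow_le_rpow_of_exponent_le (by norm_num) hp1
    _ = 2 := by norm_num

theorem angleError_le (hs : 0 < s) : angleError (s ^ 4) ≤ 26 / s ^ 3 := by
  have h1 : (2 * s ^ 4) ^ (1 / 4 : ℝ) ≤ 2 * s := by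
    rw [Real.mul_rpow (by norm_num) (by positivity), ← Real.rpow_natCast s 4,
      ← Real.rpow_mul hs.le]
    norm_num
    gcongr
    calc (2 : ℝ) ^ (1 / 4 : ℝ) ≤ 2 ^ (1 : ℝ) :=
          Real.rpow_le_rpow_of_exponent_le (by norm_num) (by norm_num)
      _ = 2 := by norm_num
  have hπ := Real.pi_lt_d4
  unfold angleError
  calc 2 * Real.pi * (2 * (2 * s ^ 4) ^ (1 / 4 : ℝ)) * (1 / s ^ 4)
      ≤ 2 * 3.2 * (2 * (2 * s)) * (1 / s ^ 4) := by gcongr; linarith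
    _ = 25.6 / s ^ 3 := by field_simp; ring
    _ ≤ 26 / s ^ 3 := by gcongr; norm_num

end Numeric

end QBM

namespace QBM

/-! ## Parameters -/

/-- The constant `D` in the size of the grid. -/
noncomputable def gridConst (D₁ : ℝ) : ℝ := 10 ^ 12 * (1 + |D₁|) ^ 4

theorem gridConst_ge (D₁ : ℝ) : 10 ^ 12 ≤ gridConst D₁ := by
  unfold gridConst
  have : (1 : ℝ) ≤ (1 + |D₁|) ^ 4 := one_le_pow₀ (by linarith [abs_nonneg D₁])
  linarith

section Size

variable {D e : ℝ}

theorem one_le_inv_rpow (he0 : 0 < e) (he1 : e < 1 / 2) : 1 ≤ 1 / e ^ (3 / 2 : ℝ) := by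
  rw [one_le_div (by positivity)]
  exact Real.rpow_le_one he0.le (by linarith) (by norm_num)

theorem le_two_pow_numQubits (hD : 2 ≤ D) (he0 : 0 < e) :
    D * (1 / e ^ (3 / 2 : ℝ)) ≤ 2 ^ numQubits D 1 e := by
  have h1 : D * (1 / e ^ (3 / 2 : ℝ)) ≤ D * Real.sqrt (numLevels 1 e + 1) / e ^ (3 / 2 : ℝ) := by
    rw [mul_one_div]
    have : 1 ≤ Real.sqrt ((numLevels 1 e : ℝ) + 1) := Real.one_le_sqrt.2 (by simp)
    gcongr
    nlinarith
  refine h1.trans ((Nat.le_ceil _).trans ?_)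
  rw [numQubits]
  exact_mod_cast Nat.le_pow_clog one_lt_two _

theorem one_le_numQubits (hD : 2 ≤ D) (he0 : 0 < e) (he1 : e < 1 / 2) :
    1 ≤ numQubits D 1 e := by
  by_contra h
  have h0 : numQubits D 1 e = 0 := by omega
  have h1 := le_two_pow_numQubits hD he0
  rw [h0, pow_zero] at h1
  nlinarith [one_le_inv_rpow he0 he1]

/-- Rounding up to an integer and then to a power of two costs a bounded factor; `√(k + 1)` is
replaced by `k + 1`, which only affects the power of the logarithm. -/
theorem two_pow_numQubits_le (hD : 2 ≤ D) (he0 : 0 < e) (he1 : e < 1 / 2) :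
    2 ^ numQubits D 1 e ≤ 4 * (D * (numLevels 1 e + 1) * (1 / e ^ (3 / 2 : ℝ))) := by
  set X := D * Real.sqrt (numLevels 1 e + 1) / e ^ (3 / 2 : ℝ) with hX
  have hs1 : 1 ≤ Real.sqrt ((numLevels 1 e : ℝ) + 1) := Real.one_le_sqrt.2 (by simp)
  have hX2 : 2 ≤ X := by
    rw [hX, ← mul_one_div]
    calc (2 : ℝ) = 2 * 1 * 1 := by norm_num
      _ ≤ D * Real.sqrt (numLevels 1 e + 1) * (1 / e ^ (3 / 2 : ℝ)) := by
        gcongr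
        exact one_le_inv_rpow he0 he1
  have hc : 1 < ⌈X⌉₊ := by
    have : (1 : ℝ) < ⌈X⌉₊ := by linarith [Nat.le_ceil X]
    exact_mod_cast this
  have h1 := Nat.pow_pred_clog_lt_self one_lt_two hc
  have h2 : numQubits D 1 e = (Nat.clog 2 ⌈X⌉₊).pred + 1 := by
    have := one_le_numQubits hD he0 he1
    rw [numQubits, ← hX] at this ⊢
    rw [Nat.pred_eq_sub_one]
    omega
  have h3 : ((2 : ℝ) ^ (Nat.clog 2 ⌈X⌉₊).pred) < ⌈X⌉₊ := by exact_mod_cast h1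
  have h4 : (⌈X⌉₊ : ℝ) < X + 1 := Nat.ceil_lt_add_one (by linarith)
  have h5 : X ≤ D * (numLevels 1 e + 1) * (1 / e ^ (3 / 2 : ℝ)) := by
    rw [hX, mul_one_div]
    gcongr
    rw [Real.sqrt_le_left (by positivity)]
    nlinarith [Nat.cast_nonneg (α := ℝ) (numLevels 1 e)]
  rw [h2, pow_succ]
  linarith

end Size

/-- On a sufficiently fine grid the mean over the grid is close to the true mean, and the second
moment about the true mean is bounded. -/
theorem gridMean_estimates {θ : ℝ → ℝ → ℝ} {D₁ σ e : ℝ} {n : ℕ} (hσ : 0 < σ)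
    (hθ : LipschitzBound θ (D₁ * σ))
    (hvar : variance (fun z : ℝ × ℝ => θ z.1 z.2) normalPair ≤ σ ^ 2) (he0 : 0 < e)
    (he1 : e < 1 / 2) (hn : 1 ≤ n)
    (hN : gridConst D₁ * (1 / e ^ (3 / 2 : ℝ)) ≤ 2 ^ n) :
    |(∫ z, θ z.1 z.2 ∂normalPair) / σ
      - gridMean n (1 / (2 * 2 ^ n)) (1 - 1 / (2 * 2 ^ n)) θ (fun y => y / σ)| ≤ 4 * e ∧
    gridMean n (1 / (2 * 2 ^ n)) (1 - 1 / (2 * 2 ^ n)) θ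
      (fun y => (y / σ - (∫ z, θ z.1 z.2 ∂normalPair) / σ) ^ 2) ≤ 3 := by
  set K := |D₁| with hKdef
  have hK : 0 ≤ K := abs_nonneg _
  set τ : ℝ → ℝ → ℝ := fun x y => θ x y / σ with hτdef
  have hτ : LipschitzBound τ K := by
    intro x y x' y'
    rw [hτdef]
    simp only
    rw [← sub_div, abs_div, abs_of_pos hσ, div_le_iff₀ hσ]
    refine (hθ x y x' y').trans ?_
    have : D₁ * σ ≤ K * σ := mul_le_mul_of_nonneg_right (le_abs_self _) hσ.le
    calc D₁ * σ * (|x - x'| + |y - y'|) ≤ K * σ * (|x - x'| + |y - y'|) := by gcongr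
      _ = _ := by ring
  set μ := (∫ z, θ z.1 z.2 ∂normalPair) / σ with hμ
  have hμτ : ∫ z, τ z.1 z.2 ∂normalPair = μ := by
    rw [hμ, hτdef]
    simp only
    rw [integral_div]
  have hθm : Measurable fun z : ℝ × ℝ => θ z.1 z.2 := by
    have h1 := (hτ.measurable hK).mul_const σ
    have h2 : (fun z : ℝ × ℝ => θ z.1 z.2) = fun z : ℝ × ℝ => τ z.1 z.2 * σ := by
      funext z
      exact (div_mul_cancel₀ _ hσ.ne').symm
    rw [h2]
    exact h1
  have hsecond : ∫ z, (τ z.1 z.2 - μ) ^ 2 ∂normalPair ≤ 1 := by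
    rw [variance_eq_integral hθm.aemeasurable] at hvar
    have h1 : ∀ z : ℝ × ℝ, (τ z.1 z.2 - μ) ^ 2
        = (θ z.1 z.2 - ∫ z, θ z.1 z.2 ∂normalPair) ^ 2 / σ ^ 2 := by
      intro z
      rw [hτdef, hμ]
      simp only
      rw [← sub_div, div_pow]
    simp only [h1]
    rw [integral_div, div_le_one (by positivity)]
    exact hvar
  -- Here `s` is the fourth root of the grid size and `q` below is the fourth root of `e^(-3/2)`.
  -- Thus `q ^ 3 = e^(-9/8)` exceeds `1 / e`, which is what an error of order `1 / s ^ 3` requires.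
  set s : ℝ := ((2 : ℝ) ^ n) ^ (1 / 4 : ℝ) with hs
  have hs4 : s ^ 4 = ((2 ^ n : ℕ) : ℝ) := by
    rw [hs, ← Real.rpow_natCast, ← Real.rpow_mul (by positivity)]
    norm_num
  set q : ℝ := e ^ (-(3 / 8) : ℝ) with hq
  have hq1 : 1 ≤ q := Real.one_le_rpow_of_pos_of_le_one_of_nonpos he0 (by linarith) (by norm_num)
  have hq4 : q ^ 4 = 1 / e ^ (3 / 2 : ℝ) := by
    rw [hq, ← Real.rpow_natCast, ← Real.rpow_mul he0.le, one_div, ← Real.rpow_neg he0.le]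
    norm_num
  have hq3 : 1 / e ≤ q ^ 3 := by
    rw [hq, ← Real.rpow_natCast, ← Real.rpow_mul he0.le, one_div, ← Real.rpow_neg_one]
    exact Real.rpow_le_rpow_of_exponent_ge he0 (by linarith) (by norm_num)
  have hs0 : 0 < s := by positivity
  -- The constant `10 ^ 12 * (1 + |D₁|) ^ 4` is the fourth power of `1000 * (1 + K)`.
  have hsq : 1000 * (1 + K) * q ≤ s := by
    refine (pow_le_pow_iff_left₀ (by positivity) hs0.le (by norm_num : 4 ≠ 0)).1 ?_
    rw [hs4, mul_pow, mul_pow, hq4]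
    rw [gridConst, ← hKdef] at hN
    norm_num at hN ⊢
    exact hN
  have hs1 : 1 ≤ s := by nlinarith
  have hsK : 1000 * (1 + K) ≤ s := by nlinarith
  have hK3 : 25 * K * (1 / e) ≤ s ^ 3 := by
    calc 25 * K * (1 / e) ≤ (1000 * (1 + K)) ^ 3 * q ^ 3 := by
          gcongr
          have : 1 ≤ (1000 * (1 + K)) ^ 2 := one_le_pow₀ (by linarith)
          nlinarith
      _ = (1000 * (1 + K) * q) ^ 3 := by ring
      _ ≤ s ^ 3 := by gcongr
  have hang := angleError_le hs0
  have hangn : 0 ≤ angleError (s ^ 4) := angleError_nonneg (by positivity)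
  constructor
  · rw [gridMean_midpoint hn]
    have h := hτ.abs_integral_sub_stepValue_le hK hn
    rw [hμτ] at h
    refine h.trans ?_
    rw [← hs4]
    have h34 := two_div_rpow_le hs0 (p := 3 / 4) (by norm_num) 3 (by norm_num)
    calc 2 * K * (32 / 3 * (2 / s ^ 4) ^ (3 / 4 : ℝ) + angleError (s ^ 4))
        ≤ 2 * K * (32 / 3 * (2 / s ^ 3) + 26 / s ^ 3) := by gcongr
      _ ≤ 100 * K / s ^ 3 := by
          rw [le_div_iff₀ (by positivity)]
          have : 2 * K * (32 / 3 * (2 / s ^ 3) + 26 / s ^ 3) * s ^ 3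
            = 2 * K * (32 / 3 * 2 + 26) := by field_simp
          rw [this]
          nlinarith
      _ ≤ 4 * e := by
          rw [div_le_iff₀ (by positivity)]
          rw [mul_one_div, div_le_iff₀ he0] at hK3
          linarith
  · rw [gridMean_midpoint hn]
    refine (hτ.integral_sq_stepValue_le hK hn μ).trans ?_
    rw [← hs4]
    have h12 := two_div_rpow_le hs0 (p := 1 / 2) (by norm_num) 2 (by norm_num)
    have hang2 : angleError (s ^ 4) ^ 2 ≤ 676 / s ^ 2 := by
      calc angleError (s ^ 4) ^ 2 ≤ (26 / s ^ 3) ^ 2 := by gcongr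
        _ ≤ (26 / s) ^ 2 := by
            gcongr
            exact le_self_pow₀ hs1 (by norm_num)
        _ = 676 / s ^ 2 := by rw [div_pow]; norm_num
    have h1 : 16 * K ^ 2 * (32 * (2 / s ^ 4) ^ (1 / 2 : ℝ) + angleError (s ^ 4) ^ 2) ≤ 1 := by
      calc 16 * K ^ 2 * (32 * (2 / s ^ 4) ^ (1 / 2 : ℝ) + angleError (s ^ 4) ^ 2)
          ≤ 16 * K ^ 2 * (32 * (2 / s ^ 2) + 676 / s ^ 2) := by gcongr
        _ = 11840 * K ^ 2 / s ^ 2 := by ring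
        _ ≤ 1 := by
            rw [div_le_one (by positivity)]
            have : (1000 * (1 + K)) ^ 2 ≤ s ^ 2 := by gcongr
            nlinarith
    linarith

/-! ### Bounds for grid size, iterations and queries in terms of `σ / ε` -/

section Complexity

variable {σ ε : ℝ}

theorem log_two_add_ge {x : ℝ} (hx : 0 ≤ x) : 0.69 ≤ Real.log (2 + x) := by
  have h1 := Real.log_two_gt_d9
  have h2 : Real.log 2 ≤ Real.log (2 + x) := Real.log_le_log (by norm_num) (by linarith)
  linarith

theorem epsTilde_ratio (hσ : 0 < σ) (hε : 0 < ε) :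
    1 / epsTilde 1 (ε / (8 * σ)) = 96 * (σ / ε) := by
  rw [epsTilde_one]
  field_simp
  norm_num

/-- `96 ≤ 2 ^ 7`, and the additive constant is absorbed because `log (2 + σ/ε)` is at least `0.69`.
-/
theorem logb_ratio_le (hσ : 0 < σ) (hε : 0 < ε) :
    Real.logb 2 (1 / epsTilde 1 (ε / (8 * σ))) ≤ 13 * Real.log (2 + σ / ε) := by
  rw [epsTilde_ratio hσ hε]
  set x := σ / ε with hx
  have hx0 : 0 < x := by positivity
  have hL := log_two_add_ge hx0.le
  have h2 := Real.log_two_gt_d9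
  have h2' := Real.log_two_lt_d9
  have h96 : Real.log (96 * x) ≤ 7 * Real.log 2 + Real.log (2 + x) := by
    rw [← Real.log_rpow (by norm_num), ← Real.log_mul (by positivity) (by positivity)]
    refine Real.log_le_log (by positivity) ?_
    norm_num
    linarith
  rw [Real.logb, div_le_iff₀ (by positivity)]
  nlinarith

theorem numLevels_add_one_le (hσ : 0 < σ) (hε : 0 < ε) (h : ε < 4 * σ) :
    (numLevels 1 (ε / (8 * σ)) : ℝ) + 1 ≤ 16 * Real.log (2 + σ / ε) := by
  have h1 := numLevels_le (e := ε / (8 * σ)) (by positivity)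
    (by rw [div_lt_iff₀ (by positivity)]; linarith)
  have h2 := logb_ratio_le hσ hε
  have h3 := log_two_add_ge (x := σ / ε) (by positivity)
  linarith

theorem numIterations_le (hσ : 0 < σ) (hε : 0 < ε) (h : ε < 4 * σ) :
    (numIterations 100 1 (ε / (8 * σ)) : ℝ) ≤ 200000 * (σ / ε) * Real.log (2 + σ / ε) := by
  have he1 : ε / (8 * σ) < 1 / 2 := by rw [div_lt_iff₀ (by positivity)]; linarith
  have h4 := four_le_logb (e := ε / (8 * σ)) (by positivity) he1
  have h1 := logb_ratio_le hσ hε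
  rw [numIterations, div_eq_mul_one_div _ (epsTilde _ _)]
  rw [epsTilde_ratio hσ hε] at *
  set Λ := Real.logb 2 (96 * (σ / ε))
  set x := σ / ε with hx
  have hx4 : 1 / 4 ≤ x := by rw [hx, div_le_div_iff₀ (by norm_num) hε]; linarith
  set L := Real.log (2 + x)
  have hL : 0.69 ≤ L := log_two_add_ge (by linarith)
  have hs : Real.sqrt Λ ≤ Λ := by
    rw [Real.sqrt_le_left (by linarith)]
    nlinarith
  refine (Nat.ceil_lt_add_one (by positivity)).le.trans ?_
  have h5 : 100 * Real.sqrt Λ * (96 * x) ≤ 100 * (13 * L) * (96 * x) := by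
    gcongr
    linarith
  nlinarith [mul_le_mul hx4 hL (by norm_num) (by linarith)]

/-- Levels, repetitions and iterations each contribute one logarithm, the repetitions through the
crude bound `log (18 k) ≤ 18 k`; this accounts for the exponent `3`. Additive constants are absorbed
since `σ / ε` exceeds `1 / 4` and the logarithm is at least `0.69`. -/
theorem queries_le (hσ : 0 < σ) (hε : 0 < ε) (h : ε < 4 * σ) :
    ((1 + 2 * ((numLevels 1 (ε / (8 * σ)) + 1) *
        (⌈50 * Real.log (18 * numLevels 1 (ε / (8 * σ)))⌉₊ *
          (2 + numIterations 100 1 (ε / (8 * σ)) * 4))) : ℕ) : ℝ)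
      ≤ 10 ^ 12 * (ε / σ)⁻¹ * Real.log (2 + σ / ε) ^ 3 := by
  have he1 : ε / (8 * σ) < 1 / 2 := by rw [div_lt_iff₀ (by positivity)]; linarith
  have hk4 := four_le_numLevels (e := ε / (8 * σ)) (by positivity) he1
  have hk := numLevels_add_one_le hσ hε h
  have ht := numIterations_le hσ hε h
  rw [inv_div]
  set k := numLevels 1 (ε / (8 * σ))
  set t := numIterations 100 1 (ε / (8 * σ))
  set x := σ / ε with hx
  have hx4 : 1 / 4 ≤ x := by rw [hx, div_le_div_iff₀ (by norm_num) hε]; linarith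
  set L := Real.log (2 + x)
  have hL : 0.69 ≤ L := log_two_add_ge (by linarith)
  have hk' : (4 : ℝ) ≤ k := by exact_mod_cast hk4
  have hreps : (⌈50 * Real.log (18 * k)⌉₊ : ℝ) ≤ 15000 * L := by
    have h1 : Real.log (18 * k) ≤ 18 * k := by
      have := Real.log_le_sub_one_of_pos (x := 18 * (k : ℝ)) (by positivity)
      linarith
    have h2 := (Nat.ceil_lt_add_one (a := 50 * Real.log (18 * k))
      (mul_nonneg (by norm_num) (Real.log_nonneg (by linarith)))).le
    linarith
  have hxL : 1 / 4 * 0.69 ≤ x * L := mul_le_mul hx4 hL (by norm_num) (by linarith)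
  have ht' : 2 + (t : ℝ) * 4 ≤ 1000000 * (x * L) := by nlinarith
  have hL2 : 0.69 * 0.69 ≤ L * L := mul_le_mul hL hL (by norm_num) (by linarith)
  have hxL3 : 1 / 4 * 0.69 * (0.69 * 0.69) ≤ x * L * (L * L) :=
    mul_le_mul hxL hL2 (by norm_num) (by positivity)
  push_cast
  calc (1 : ℝ) + 2 * (((k : ℝ) + 1) * ((⌈50 * Real.log (18 * k)⌉₊ : ℝ) * (2 + (t : ℝ) * 4)))
      ≤ 1 + 2 * ((16 * L) * ((15000 * L) * (1000000 * (x * L)))) := by gcongr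
    _ = 1 + 480000000000 * (x * L * (L * L)) := by ring
    _ ≤ 10 ^ 12 * x * L ^ 3 := by
        have : 10 ^ 12 * x * L ^ 3 = 10 ^ 12 * (x * L * (L * L)) := by ring
        rw [this]
        linarith

theorem numIterations_le' (hσ : 0 < σ) (hε : 0 < ε) (h : ε < 4 * σ) :
    (numIterations 100 1 (ε / (8 * σ)) : ℝ)
      ≤ 10 ^ 12 * (ε / σ)⁻¹ * Real.log (2 + σ / ε) ^ 3 := by
  refine (numIterations_le hσ hε h).trans ?_
  rw [inv_div]
  have hL : 0.69 ≤ Real.log (2 + σ / ε) := log_two_add_ge (by positivity)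
  set L := Real.log (2 + σ / ε)
  have hL3 : 0.69 ^ 2 * L ≤ L ^ 3 := by
    rw [show L ^ 3 = L ^ 2 * L by ring]
    gcongr
  have hx : 0 < σ / ε := by positivity
  rw [mul_assoc, mul_assoc]
  nlinarith [mul_le_mul_of_nonneg_left hL3 hx.le, mul_pos hx (by linarith : 0 < L)]

theorem gridSize_le {D : ℝ} (hD : 2 ≤ D) (hσ : 0 < σ) (hε : 0 < ε) (h : ε < 4 * σ) :
    (2 : ℝ) ^ numQubits D 1 (ε / (8 * σ)) ≤
      64 * D * 8 ^ (3 / 2 : ℝ) * (ε / σ) ^ (-(3 / 2) : ℝ) * Real.log (2 + σ / ε) ^ 1 := by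
  have he1 : ε / (8 * σ) < 1 / 2 := by rw [div_lt_iff₀ (by positivity)]; linarith
  refine (two_pow_numQubits_le hD (by positivity) he1).trans ?_
  have hk := numLevels_add_one_le hσ hε h
  have hpow : 1 / (ε / (8 * σ)) ^ (3 / 2 : ℝ)
      = 8 ^ (3 / 2 : ℝ) * (ε / σ) ^ (-(3 / 2) : ℝ) := by
    rw [show ε / (8 * σ) = ε / σ / 8 by field_simp, Real.div_rpow (by positivity) (by norm_num),
      Real.rpow_neg (by positivity), one_div_div]
    rfl
  rw [hpow]
  calc 4 * (D * ((numLevels 1 (ε / (8 * σ)) : ℝ) + 1)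
        * (8 ^ (3 / 2 : ℝ) * (ε / σ) ^ (-(3 / 2) : ℝ)))
      ≤ 4 * (D * (16 * Real.log (2 + σ / ε))
        * (8 ^ (3 / 2 : ℝ) * (ε / σ) ^ (-(3 / 2) : ℝ))) := by gcongr
    _ = _ := by ring

end Complexity

end QBM

/-! ### Choice of the constants and combination of the two error halves -/

theorem mainTheorem3 :
    ∃ Dt > (0 : ℝ), ∃ R > (0 : ℝ), ∃ Ct > (0 : ℝ), ∃ ct : ℕ,
    ∀ D₁ D₂ : ℝ, ∃ D > (0 : ℝ), ∃ CN > (0 : ℝ), ∃ cN : ℕ,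
    ∀ σ ε : ℝ, 0 < ε → ε < 4 * σ →
    ∃ umin umax : ℝ, 0 < umin ∧ umin < umax ∧ umax < 1 ∧
      (2 : ℝ) ^ QBM.numQubits D 1 (ε / (8 * σ)) ≤
        CN * (ε / σ) ^ (-(3 / 2) : ℝ) * Real.log (2 + σ / ε) ^ cN ∧
      (QBM.numIterations Dt 1 (ε / (8 * σ)) : ℝ) ≤
        Ct * (ε / σ)⁻¹ * Real.log (2 + σ / ε) ^ ct ∧
      ∀ θ : ℝ → ℝ → ℝ,
        QBM.BoundedDerivatives θ (D₁ * σ) (D₂ * σ) →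
        variance (fun z : ℝ × ℝ => θ z.1 z.2) QBM.normalPair ≤ σ ^ 2 →
        2 / 3 ≤ (QBM.algorithm₃ Dt R D umin umax σ ε θ).toOuterMeasure
            {x : ℝ × ℕ | |(∫ z, θ z.1 z.2 ∂QBM.normalPair) - x.1| ≤ ε} ∧
        ∀ x ∈ (QBM.algorithm₃ Dt R D umin umax σ ε θ).support,
          (x.2 : ℝ) ≤ Ct * (ε / σ)⁻¹ * Real.log (2 + σ / ε) ^ ct := by
  refine ⟨100, by norm_num, 50, by norm_num, 10 ^ 12, by norm_num, 3, fun D₁ D₂ => ?_⟩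
  have hD : 2 ≤ QBM.gridConst D₁ := le_trans (by norm_num) (QBM.gridConst_ge D₁)
  refine ⟨QBM.gridConst D₁, by linarith, 64 * QBM.gridConst D₁ * 8 ^ (3 / 2 : ℝ), by positivity,
    1, fun σ ε hε hεσ => ?_⟩
  have hσ : 0 < σ := by linarith
  have he0 : 0 < ε / (8 * σ) := by positivity
  have he1 : ε / (8 * σ) < 1 / 2 := by rw [div_lt_iff₀ (by positivity)]; linarith
  obtain ⟨n, hn⟩ : ∃ n, n = QBM.numQubits (QBM.gridConst D₁) 1 (ε / (8 * σ)) := ⟨_, rfl⟩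
  have hn1 : 1 ≤ n := hn ▸ QBM.one_le_numQubits hD he0 he1
  have hN : QBM.gridConst D₁ * (1 / (ε / (8 * σ)) ^ (3 / 2 : ℝ)) ≤ 2 ^ n :=
    hn ▸ QBM.le_two_pow_numQubits hD he0
  have h2n : (2 : ℝ) ≤ 2 ^ n := le_self_pow₀ (by norm_num) (by omega)
  have hu0 : (0 : ℝ) < 1 / (2 * 2 ^ n) := by positivity
  have hu1 : (1 : ℝ) / (2 * 2 ^ n) ≤ 1 / 4 := by
    rw [div_le_div_iff₀ (by positivity) (by norm_num)]
    linarith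
  -- These truncation points make the grid in `u` the midpoint grid.
  refine ⟨1 / (2 * 2 ^ n), 1 - 1 / (2 * 2 ^ n), hu0, by linarith, by linarith,
    QBM.gridSize_le hD hσ hε hεσ, QBM.numIterations_le' hσ hε hεσ, fun θ hθ hvar => ⟨?_, ?_⟩⟩
  · obtain ⟨hmean, hsecond⟩ :=
      QBM.gridMean_estimates hσ hθ.lipschitzBound hvar he0 he1 hn1 hN
    have h3 := QBM.prob_algorithm₃_le hn hσ hε hεσ _ hsecond
    rw [QBM.Alg.prob_eq_toOuterMeasure _ (fun y => |(∫ z, θ z.1 z.2 ∂QBM.normalPair) - y| ≤ ε)]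
    have hbad : (QBM.algorithm₃ 100 50 (QBM.gridConst D₁) (1 / (2 * 2 ^ n)) (1 - 1 / (2 * 2 ^ n))
        σ ε θ).prob (fun y => ¬ |(∫ z, θ z.1 z.2 ∂QBM.normalPair) - y| ≤ ε)
        ≤ ENNReal.ofReal (1 / 3) := by
      refine (QBM.Alg.prob_mono _ fun y hy hgood => hy ?_).trans h3
      set g := QBM.gridMean n (1 / (2 * 2 ^ n)) (1 - 1 / (2 * 2 ^ n)) θ (fun y => y / σ) with hg
      set I := ∫ z, θ z.1 z.2 ∂QBM.normalPair with hI
      -- The bias: `4e` for `θ / σ` becomes `4 σ ε / (8 σ)` after scaling back.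
      have h4 : |I - σ * g| ≤ ε / 2 := by
        have : I - σ * g = σ * (I / σ - g) := by field_simp
        rw [this, abs_mul, abs_of_pos hσ]
        calc σ * |I / σ - g| ≤ σ * (4 * (ε / (8 * σ))) := by gcongr
          _ = ε / 2 := by field_simp; ring
      rw [abs_sub_comm] at hgood
      linarith [abs_sub_le I (σ * g) y]
    have htot := QBM.Alg.prob_add_prob_not (QBM.algorithm₃ 100 50 (QBM.gridConst D₁)
      (1 / (2 * 2 ^ n)) (1 - 1 / (2 * 2 ^ n)) σ ε θ)
      (fun y => |(∫ z, θ z.1 z.2 ∂QBM.normalPair) - y| ≤ ε)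
    have hsum : (2 / 3 : ℝ≥0∞) + ENNReal.ofReal (1 / 3) = 1 := by
      rw [← ENNReal.toReal_eq_toReal_iff' (by finiteness) (by finiteness),
        ENNReal.toReal_add (by finiteness) (by finiteness), ENNReal.toReal_ofReal (by norm_num)]
      norm_num
    refine (ENNReal.add_le_add_iff_right (a := ENNReal.ofReal (1 / 3)) (by finiteness)).1 ?_
    rw [hsum, ← htot]
    gcongr
  · intro x hx
    have hq := QBM.queriesLE_algorithm₃
      (le_trans (by norm_num) (QBM.four_le_numLevels he0 he1)) x hx
    refine le_trans ?_ (QBM.queries_le hσ hε hεσ)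
    exact_mod_cast hq
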